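/- **Trees.** Let $(M,\le)$ be a partial order. Two elements of $M$ are *incompatible* if they have no common upper bound in $M$. For $B\subseteq M$ and $\nu\in B$ let $B_{\ge\nu}=\{\rho\in B:\nu\le\rho\}$, let $\mathrm{suc}_B(\nu)$ be the set of $\rho\in B$ with $\nu<\rho$ and no $\sigma\in B$ with $\nu<\sigma<\rho$, and let $\max(B)$ be the set of maximal elements of $B$. A *front* of $B$ is a set $Y\subseteq B$ of pairwise incomparable elements that meets every maximal chain of $B$. $\mathrm{CWT}(M)$ is the set of $B\subseteq M$ such that: $B$ is countable and has a least element, its root; for $\nu\in B$ the set $\{\rho\in B:\rho<\nu\}$ is a finite chain; $B$ has no infinite increasing sequence; each $\mathrm{suc}_B(\nu)$ is empty or infinite; incomparable elements of $B$ are incompatible in $M$; and if $\nu\in B\setminus\max(B)$ and $F\subseteq M$ is finite with $\rho\not\le\nu$ for all $\rho\in F$, then infinitely many $\varrho\in\mathrm{suc}_B(\nu)$ are incompatible with every $\rho\in F$. For $B\in\mathrm{CWT}(M)$, $\mathrm{sb}(B)$ is the set of $B'\in\mathrm{CWT}(M)$ with $B'\subseteq B$, with the same root, and such that $\mathrm{suc}_{B'}(\nu)\subseteq\mathrm{suc}_B(\nu)$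 with finite difference for all $\nu\in B'$; $\mathrm{psb}(B)$ is the set of $B'\in\mathrm{CWT}(M)$ with $B'\subseteq B$, with the same root, and such that $\mathrm{suc}_{B'}(\nu)$ is an infinite subset of $\mathrm{suc}_B(\nu)$ for all $\nu\in B'\setminus\max(B)$. An antichain $Y\subseteq M$ (a set of pairwise incomparable elements) is an *almost front* of $B$ if $Y\cap B'$ is a front of $B'$ for some $B'\in\mathrm{sb}(B)$. For $B_1,B_2\in\mathrm{CWT}(M)$ write $B_1\le^*_M B_2$ if they have the same root and for some $B_2'\in\mathrm{sb}(B_2)$ we have $B_2'\cap B_1\in\mathrm{psb}(B_1)$ and every almost front of $B_2'\cap B_1$ is an almost front of $B_2$. For $Y\subseteq M$ let $B[\le Y]=\{\nu\in B:\nu\le\eta\text{ for some }\eta\in Y\}$. **Systems.** $\mathbf K$ is the class of $\mathbf x=(M,\le,\langle\mathcal A_\eta:\eta\in M\rangle,\le_{\mathbf x})$ such that $M$ is a partial order with least element $\mathrm{rt}$; each $\mathcal A_\eta$ is a set of trees in $\mathrm{CWT}(M)$ with root $\eta$, with $\{\eta\}\in\mathcal A_\eta$; if $\nu\in B\in\mathcal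 A_\eta$ then $B_{\ge\nu}\in\mathcal A_\nu$; and, with $\mathcal B_{\mathbf x}=\mathcal A_{\mathrm{rt}}\setminus\{\{\mathrm{rt}\}\}$, $\le_{\mathbf x}$ is a directed partial order on $\mathcal B_{\mathbf x}$ for which $B_1\le_{\mathbf x}B_2$ implies $B_1\le^*_M B_2$. For $Y\subseteq M$, $D^{\mathbf x}_Y$ is the family of $Z\subseteq Y$ such that for some $B\in\mathcal B_{\mathbf x}$ and $B'\in\mathrm{sb}(B)$, $Y$ is an almost front of $B$ and $B'\cap Y\subseteq Z$. An ultrafilter $D$ on a countable set $Y$ is a *Q-point* if every finite-to-one function on $Y$ is one-to-one on some member of $D$. (Principal ultrafilters are not excluded.) **Theorem.** Assume CH. There is $\mathbf x\in\mathbf K$ such that: (a) $\mathcal A_\eta\ne\{\{\eta\}\}$ for all $\eta\in M$, and $\mathcal B_{\mathbf x}$ is $\aleph_1$-directed under $\le_{\mathbf x}$ (every countable subset has an upper bound); (b) for every $B\in\mathcal B_{\mathbf x}$ and every front $Y$ of $B$, $D^{\mathbf x}_Y$ is an ultrafilter on $Y$, and it is non-principal iff $Y\ne\{\mathrm{rt}\}$;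 (c) for every $B_1\in\mathcal B_{\mathbf x}$ there is $B_2\in\mathcal B_{\mathbf x}$ with $B_1\le_{\mathbf x}B_2$, $B_1\cap\mathrm{suc}_{B_2}(\mathrm{rt})=\emptyset$, and such that every $\varrho\in\mathrm{suc}_{B_2}(\mathrm{rt})$ is below infinitely many $\rho\in\mathrm{suc}_{B_1}(\mathrm{rt})$; (d) if $\eta\in M$, $B\in\mathcal A_\eta$ and $Y$ is a front of $B$, then $B[\le Y]\in\mathcal A_\eta$; (e) for every $B\in\mathcal B_{\mathbf x}$ and every front $Y$ of $B$, $D^{\mathbf x}_Y$ is a Q-point; (f) $\mathbf x$ is - *fat*: if $B\in\mathcal B_{\mathbf x}$ and $B'\in\mathrm{sb}(B)$, there is $B''\in\mathrm{sb}(B')\cap\mathcal B_{\mathbf x}$ with $B\le_{\mathbf x}B''$; - *big*: if $B\in\mathcal B_{\mathbf x}$ and $c:\max(B)\to\{0,1\}$, there is $B'\in\mathrm{psb}(B)\cap\mathcal B_{\mathbf x}$ with $B\le_{\mathbf x}B'$ and $c$ constant on $\max(B')$; - *large*: if $B\in\mathcal B_{\mathbf x}$ and $c$ is a function on $\max(B)$,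 there are $B'\in\mathrm{psb}(B)\cap\mathcal B_{\mathbf x}$, $B''\in\mathcal B_{\mathbf x}$ with $B\le_{\mathbf x}B'\le_{\mathbf x}B''$, and a front $Y$ of $B''$, such that for all $\eta,\nu\in\max(B')$: $c(\eta)=c(\nu)$ iff some $\rho\in Y$ satisfies $\rho\le\eta$ and $\rho\le\nu$; - *full*: if $\eta\ne\mathrm{rt}$, $B\in\mathcal A_\eta$ and $B'\in\mathrm{psb}(B)$, then $B'\in\mathcal A_\eta$. -/

import Mathlib

namespace TreeSys

section Trees

variable {M : Type*} [PartialOrder M]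

/-- `a` and `b` are incompatible: they have no common upper bound in `M`. -/
def Incompat (a b : M) : Prop := ¬ ∃ c : M, a ≤ c ∧ b ≤ c

/-- The maximal members of `B`. -/
def maxNodes (B : Set M) : Set M := {η | η ∈ B ∧ ∀ ν ∈ B, ¬ η < ν}

/-- The immediate successors of `ν` inside `B`. -/
def succs (B : Set M) (ν : M) : Set M :=
  {ρ | ρ ∈ B ∧ ν < ρ ∧ ¬ ∃ σ ∈ B, ν < σ ∧ σ < ρ}

/-- A branch of `B` is a maximal chain of `B`. -/
def IsBranch (B C : Set M) : Prop :=
  Maximal (fun X : Set M => X ⊆ B ∧ IsChain (· ≤ ·) X) C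

/-- `Y` is a front of `B`: a set of pairwise incomparable members of `B` that meets every branch
of `B`. -/
def IsFront (B Y : Set M) : Prop :=
  Y ⊆ B ∧ (∀ C : Set M, IsBranch B C → (C ∩ Y).Nonempty) ∧ IsAntichain (· ≤ ·) Y

/-- `B` is a countable well-founded subtree of `M`. The root of `B` is its least member. -/
structure IsCWT (B : Set M) : Prop where
  countable : B.Countable
  exists_root : ∃ r, IsLeast B r
  /-- `B` is a tree with at most `ω` levels -/
  chain_below : ∀ ν ∈ B, IsChain (· ≤ ·) {ρ | ρ ∈ B ∧ ρ < ν}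
  finite_below : ∀ ν ∈ B, {ρ | ρ ∈ B ∧ ρ < ν}.Finite
  /-- `B` has no infinite branch -/
  no_omega_branch : ¬ ∃ f : ℕ → M, StrictMono f ∧ ∀ n, f n ∈ B
  succs_infinite : ∀ ν ∈ B, succs B ν = ∅ ∨ (succs B ν).Infinite
  incompat : ∀ η ∈ B, ∀ ν ∈ B, ¬ η ≤ ν → ¬ ν ≤ η → Incompat η ν
  escape : ∀ ν ∈ B, ν ∉ maxNodes B → ∀ F : Set M, F.Finite → (∀ ρ ∈ F, ¬ ρ ≤ ν) →
    {ϱ | ϱ ∈ succs B ν ∧ ∀ ρ ∈ F, Incompat ρ ϱ}.Infinite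

/-- `B` and `C` have the same root. -/
def SameRoot (B C : Set M) : Prop := ∃ r, IsLeast B r ∧ IsLeast C r

/-- `sb B` is the set of exhaustive subtrees of `B`. -/
def sb (B : Set M) : Set (Set M) :=
  {C | IsCWT C ∧ C ⊆ B ∧ SameRoot B C ∧
    ∀ ν ∈ C, succs C ν ⊆ succs B ν ∧ (succs B ν \ succs C ν).Finite}

/-- `psb B` is the set of positive subtrees of `B`. -/
def psb (B : Set M) : Set (Set M) :=
  {C | IsCWT C ∧ C ⊆ B ∧ SameRoot B C ∧
    ∀ ν ∈ C, ν ∉ maxNodes B → succs C ν ⊆ succs B ν ∧ (succs C ν).Infinite}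

/-- `Y` is an almost front of `B`. -/
def IsAlmostFront (B Y : Set M) : Prop :=
  IsAntichain (· ≤ ·) Y ∧ ∃ C ∈ sb B, IsFront C (Y ∩ C)

/-- The relation `B₁ ≤* B₂` between countable well-founded subtrees. -/
def StarLE (B₁ B₂ : Set M) : Prop :=
  IsCWT B₁ ∧ IsCWT B₂ ∧ SameRoot B₁ B₂ ∧
    ∃ C ∈ sb B₂, C ∩ B₁ ∈ psb B₁ ∧ ∀ Y : Set M, IsAlmostFront (C ∩ B₁) Y → IsAlmostFront B₂ Y

/-- The part `B[≤ Y]` of `B` that lies below `Y`. -/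
def below (B Y : Set M) : Set M := {ν | ν ∈ B ∧ ∃ η ∈ Y, ν ≤ η}

end Trees

section Filters

variable {M : Type*}

/-- The family `D` of subsets of `Y` is an ultrafilter on the set `Y`. -/
def IsUltrafilterOn (Y : Set M) (D : Set (Set M)) : Prop :=
  (∀ Z ∈ D, Z ⊆ Y) ∧ ∃ U : Ultrafilter Y, ∀ Z : Set Y, Z ∈ U ↔ Subtype.val '' Z ∈ D

/-- `D` is a non-principal ultrafilter on `Y`. -/
def IsNonprincipalOn (Y : Set M) (D : Set (Set M)) : Prop :=
  IsUltrafilterOn Y D ∧ ∀ y ∈ Y, {y} ∉ D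

/-- `D` is a Q-point on the countable set `Y`: an ultrafilter such that every finite-to-one
function on `Y` is one-to-one on a member of `D`. -/
def IsQPointOn (Y : Set M) (D : Set (Set M)) : Prop :=
  Y.Countable ∧ IsUltrafilterOn Y D ∧
    ∀ (β : Type) (f : M → β), (∀ b, {y | y ∈ Y ∧ f y = b}.Finite) → ∃ Z ∈ D, Set.InjOn f Z

end Filters

/-- The class **K** of systems of well-founded trees, over a partial order `M` with smallest
element `⊥` (the root of the system). -/
structure System (M : Type*) [PartialOrder M] [OrderBot M] where
  /-- the families of trees with root `η` -/
  A : M → Set (Set M)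
  /-- the order `≤_x` between the nontrivial trees with root `⊥` -/
  le : Set M → Set M → Prop
  isCWT : ∀ η, ∀ B ∈ A η, IsCWT B
  isLeast : ∀ η, ∀ B ∈ A η, IsLeast B η
  singleton_mem : ∀ η, {η} ∈ A η
  cone_mem : ∀ η, ∀ B ∈ A η, ∀ ν ∈ B, B ∩ Set.Ici ν ∈ A ν
  le_mem : ∀ B₁ B₂, le B₁ B₂ → B₁ ∈ A ⊥ \ {{⊥}} ∧ B₂ ∈ A ⊥ \ {{⊥}}
  le_refl : ∀ B ∈ A ⊥ \ {{⊥}}, le B B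
  le_trans : ∀ B₁ B₂ B₃, le B₁ B₂ → le B₂ B₃ → le B₁ B₃
  le_antisymm : ∀ B₁ B₂, le B₁ B₂ → le B₂ B₁ → B₁ = B₂
  directed : ∀ B₁ ∈ A ⊥ \ {{⊥}}, ∀ B₂ ∈ A ⊥ \ {{⊥}}, ∃ B, le B₁ B ∧ le B₂ B
  starLE_of_le : ∀ B₁ B₂, le B₁ B₂ → StarLE B₁ B₂

namespace System

variable {M : Type*} [PartialOrder M] [OrderBot M] (x : System M)

/-- The family `B_x` of the nontrivial trees of `x` whose root is the root of `x`. -/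
def BB : Set (Set M) := x.A ⊥ \ {{⊥}}

/-- The family `D_Y` of subsets of `Y`. -/
def D (Y : Set M) : Set (Set M) :=
  {Z | Z ⊆ Y ∧ ∃ B ∈ x.BB, ∃ C ∈ sb B, IsAlmostFront B Y ∧ C ∩ Y ⊆ Z}

/-- `B_x` is `ℵ₁`-directed under `≤_x`. -/
def Aleph1Directed : Prop :=
  ∀ S : Set (Set M), S ⊆ x.BB → S.Countable → ∃ B ∈ x.BB, ∀ C ∈ S, x.le C B

def Fat : Prop :=
  ∀ B ∈ x.BB, ∀ B₁ ∈ sb B, ∃ B₂ ∈ sb B₁, B₂ ∈ x.BB ∧ x.le B B₂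

def Big : Prop :=
  ∀ B ∈ x.BB, ∀ c : M → Bool, ∃ B₁ ∈ psb B, B₁ ∈ x.BB ∧ x.le B B₁ ∧
    ∀ η ∈ maxNodes B₁, ∀ ν ∈ maxNodes B₁, c η = c ν

/-- Only the restriction of `c` to the maximal nodes of `B` matters. The front `Y` that describes
the equivalence relation induced by `c` is a front of a tree `B₂` above `B₁`. -/
def Large : Prop :=
  ∀ B ∈ x.BB, ∀ (β : Type) (c : M → β), ∃ B₁ ∈ psb B, ∃ B₂ ∈ x.BB,
    B₁ ∈ x.BB ∧ x.le B B₁ ∧ x.le B₁ B₂ ∧ ∃ Y, IsFront B₂ Y ∧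
      ∀ η ∈ maxNodes B₁, ∀ ν ∈ maxNodes B₁, (c η = c ν ↔ ∃ ρ ∈ Y, ρ ≤ η ∧ ρ ≤ ν)

def Full : Prop :=
  ∀ η : M, η ≠ ⊥ → ∀ B ∈ x.A η, ∀ B₁ ∈ psb B, B₁ ∈ x.A η

end System

end TreeSys

/-! The relation `StarLE` is replaced by a combinatorial one. `Cov B C` says that each maximal node
of `C` sits above a maximal node of `B` whose whole `B`-path lies in `C`; `TLE B C` allows `C` to be
shrunk to an exhaustive subtree first. `TLE` is transitive, implies `StarLE` for trees with the same
root (`TLE.starLE`), and is preserved in both directions by order embeddings (`tle_image_iff`), so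
it can be used before `M` is known.

Everything comes from an `ω₁`-chain of trees `B j`. A condition (`Cond`) is a countable set `N` of
regions with a tree inside it that escapes strongly from `N`: a member of `N` not below a node is
compatible with only finitely many of its successors. A countable increasing sequence of conditions
is handled in three moves. `Good.exists_limit` takes a diagonal union of cones, giving one tree
above all the given ones. `Good.exists_canon` thins it so that one prescribed colouring becomes
canonical. `Good.exists_lump` inserts a new level of unions of regions just above the root. Under CH
there are only `ℵ₁` pairs of a countable tree and a colouring of it, so bookkeeping treats each of
them cofinally often. The order `M` is the union of the sets `N`.

New lumps could destroy escape for old trees. The relation `Ext` prevents this at nodes other than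
`⊥`: escaping from a new element reduces to escaping from finitely many old ones. At the root it
would fail, but there the covering by later trees restores escape in its weak form
(`Good.infinite_escape`).

In the system, `A η` for `η ≠ ⊥` consists of all trees of `CWT(M)` rooted at `η`, which gives
fullness; `A ⊥` consists of `{⊥}` and the nontrivial trees that are `TLE` some `B j`. The
canonization `exists_canonical` is the source of (b), (e), bigness and largeness: on a positive
subtree any colouring is induced by a front. With two colours this front must be `{⊥}`, because any
other front is infinite; that gives bigness and hence ultrafilters. For a finite-to-one colouring no
front element can lie strictly below a coloured node, which gives Q-points. The inserted level gives
(c). -/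

namespace TreeSys

/-! ### Trees, fronts, positive and exhaustive subtrees. -/

section PureTrees

variable {α : Type*} [PartialOrder α] {A B C D E T Y : Set α} {ν ρ σ τ z : α}

/-- The part of `IsCWT` that only depends on the order between the members of `B`. -/
structure IsTree (B : Set α) : Prop where
  countable : B.Countable
  exists_root : ∃ r, IsLeast B r
  chain_below : ∀ ν ∈ B, IsChain (· ≤ ·) {ρ | ρ ∈ B ∧ ρ < ν}
  finite_below : ∀ ν ∈ B, {ρ | ρ ∈ B ∧ ρ < ν}.Finite
  no_omega_branch : ¬ ∃ f : ℕ → α, StrictMono f ∧ ∀ n, f n ∈ B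
  succs_infinite : ∀ ν ∈ B, succs B ν = ∅ ∨ (succs B ν).Infinite

theorem IsCWT.isTree (h : IsCWT B) : IsTree B :=
  ⟨h.countable, h.exists_root, h.chain_below, h.finite_below, h.no_omega_branch, h.succs_infinite⟩

theorem succs_eq_empty_of_max (h : ν ∈ maxNodes B) : succs B ν = ∅ :=
  Set.eq_empty_of_forall_notMem fun σ hσ => h.2 σ hσ.1 hσ.2.1

theorem eq_of_max_le (h : ν ∈ maxNodes B) (hρ : ρ ∈ B) (hle : ν ≤ ρ) : ν = ρ := by
  by_contra hne
  exact h.2 ρ hρ (lt_of_le_of_ne hle hne)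

namespace IsTree

variable (hB : IsTree B)
include hB

theorem nonempty : B.Nonempty := hB.exists_root.imp fun _ h => h.1

theorem le_or_le (hρ : ρ ∈ B) (hσ : σ ∈ B) (hz : z ∈ B) (h₁ : ρ ≤ z) (h₂ : σ ≤ z) :
    ρ ≤ σ ∨ σ ≤ ρ := by
  rcases h₁.eq_or_lt with rfl | h₁
  · exact Or.inr h₂
  rcases h₂.eq_or_lt with rfl | h₂
  · exact Or.inl h₁.le
  exact (hB.chain_below z hz).total ⟨hρ, h₁⟩ ⟨hσ, h₂⟩

theorem exists_succ_le (hz : z ∈ B) (h : ν < z) : ∃ σ ∈ succs B ν, σ ≤ z := by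
  have hfin : {ρ | ρ ∈ B ∧ ν < ρ ∧ ρ ≤ z}.Finite := by
    refine ((hB.finite_below z hz).insert z).subset ?_
    rintro ρ ⟨h1, -, h3⟩
    rcases h3.eq_or_lt with rfl | h3
    · exact Set.mem_insert _ _
    · exact Set.mem_insert_of_mem _ ⟨h1, h3⟩
  obtain ⟨σ, hσ⟩ := hfin.exists_minimal ⟨z, hz, h, le_rfl⟩
  refine ⟨σ, ⟨hσ.prop.1, hσ.prop.2.1, ?_⟩, hσ.prop.2.2⟩
  rintro ⟨τ, hτ, h1, h2⟩
  exact hσ.not_lt ⟨hτ, h1, h2.le.trans hσ.prop.2.2⟩ h2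

theorem exists_max_ge (hν : ν ∈ B) : ∃ z ∈ maxNodes B, ν ≤ z := by
  by_contra! hcon
  have step : ∀ x : {x // x ∈ B ∧ ν ≤ x}, ∃ y : {x // x ∈ B ∧ ν ≤ x}, x.1 < y.1 := by
    rintro ⟨x, hx, hle⟩
    by_contra! h
    exact hcon x ⟨hx, fun y hy hlt => h ⟨y, hy, hle.trans hlt.le⟩ hlt⟩ hle
  choose g hg using step
  let f : ℕ → {x // x ∈ B ∧ ν ≤ x} := fun n => g^[n] ⟨ν, hν, le_rfl⟩
  refine hB.no_omega_branch ⟨fun n => (f n).1, strictMono_nat_of_lt_succ fun n => ?_,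
    fun n => (f n).2.1⟩
  simp only [f, Function.iterate_succ_apply']
  exact hg _

theorem succ_le_of_lt (hσ : σ ∈ succs B ν) (hρ : ρ ∈ B) (hz : z ∈ B) (h : ν < ρ) (h₁ : σ ≤ z)
    (h₂ : ρ ≤ z) : σ ≤ ρ := by
  rcases hB.le_or_le hσ.1 hρ hz h₁ h₂ with h' | h'
  · exact h'
  · rcases h'.eq_or_lt with rfl | h'
    · exact le_rfl
    · exact absurd ⟨ρ, hρ, h, h'⟩ hσ.2.2

theorem succs_unique (hσ : σ ∈ succs B ν) (hτ : τ ∈ succs B ν) (hz : z ∈ B) (h₁ : σ ≤ z)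
    (h₂ : τ ≤ z) : σ = τ :=
  le_antisymm (hB.succ_le_of_lt hσ hτ.1 hz hτ.2.1 h₁ h₂)
    (hB.succ_le_of_lt hτ hσ.1 hz hσ.2.1 h₂ h₁)

theorem exists_greatest_le (P : α → Prop) (hz : z ∈ B) (hρ : ρ ∈ B) (hle : ρ ≤ z) (hP : P ρ) :
    ∃ μ ∈ B, μ ≤ z ∧ P μ ∧ ∀ x ∈ B, x ≤ z → P x → x ≤ μ := by
  have hfin : {x | x ∈ B ∧ x ≤ z ∧ P x}.Finite := by
    refine ((hB.finite_below z hz).insert z).subset ?_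
    rintro ρ ⟨h1, h3, -⟩
    rcases h3.eq_or_lt with rfl | h3
    · exact Set.mem_insert _ _
    · exact Set.mem_insert_of_mem _ ⟨h1, h3⟩
  obtain ⟨μ, hμ⟩ := hfin.exists_maximal ⟨ρ, hρ, hle, hP⟩
  refine ⟨μ, hμ.prop.1, hμ.prop.2.1, hμ.prop.2.2, fun x hx hxz hPx => ?_⟩
  rcases hB.le_or_le hx hμ.prop.1 hz hxz hμ.prop.2.1 with h | h
  · exact h
  · exact hμ.le_of_ge ⟨hx, hxz, hPx⟩ h

theorem exists_least_le (P : α → Prop) (hz : z ∈ B) (hρ : ρ ∈ B) (hle : ρ ≤ z) (hP : P ρ) :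
    ∃ μ ∈ B, μ ≤ z ∧ P μ ∧ ∀ x ∈ B, x < μ → ¬ P x := by
  have hfin : {x | x ∈ B ∧ x ≤ z ∧ P x}.Finite := by
    refine ((hB.finite_below z hz).insert z).subset ?_
    rintro ρ ⟨h1, h3, -⟩
    rcases h3.eq_or_lt with rfl | h3
    · exact Set.mem_insert _ _
    · exact Set.mem_insert_of_mem _ ⟨h1, h3⟩
  obtain ⟨μ, hμ⟩ := hfin.exists_minimal ⟨ρ, hρ, hle, hP⟩
  exact ⟨μ, hμ.prop.1, hμ.prop.2.1, hμ.prop.2.2, fun x hx hxμ hPx =>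
    hμ.not_lt ⟨hx, hxμ.le.trans hμ.prop.2.1, hPx⟩ hxμ⟩

theorem exists_parent {r : α} (hr : IsLeast B r) (hσ : σ ∈ B) (hne : σ ≠ r) :
    ∃ μ ∈ B, σ ∈ succs B μ := by
  have hlt : r < σ := lt_of_le_of_ne (hr.2 hσ) hne.symm
  obtain ⟨μ, hμ, -, hμσ, hmax⟩ := hB.exists_greatest_le (fun x => x < σ) hσ hr.1 hlt.le hlt
  exact ⟨μ, hμ, hσ, hμσ, fun ⟨τ, hτ, h1, h2⟩ => (hmax τ hτ h2.le h2).not_gt h1⟩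

theorem parent_unique {μ μ' : α} (hμ : μ ∈ B) (hμ' : μ' ∈ B) (h : σ ∈ succs B μ)
    (h' : σ ∈ succs B μ') : μ = μ' := by
  rcases hB.le_or_le hμ hμ' h.1 h.2.1.le h'.2.1.le with hle | hle
  · rcases hle.eq_or_lt with rfl | hlt
    · rfl
    · exact absurd ⟨μ', hμ', hlt, h'.2.1⟩ h.2.2
  · rcases hle.eq_or_lt with rfl | hlt
    · rfl
    · exact absurd ⟨μ, hμ, hlt, h.2.1⟩ h'.2.2

theorem succs_infinite_of_not_max (hν : ν ∈ B) (h : ν ∉ maxNodes B) : (succs B ν).Infinite := by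
  refine (hB.succs_infinite ν hν).resolve_left fun he => h ⟨hν, fun ρ hρ hlt => ?_⟩
  obtain ⟨σ, hσ, -⟩ := hB.exists_succ_le hρ hlt
  exact (he ▸ hσ : σ ∈ (∅ : Set α))

/-- No node lies above two successors of `ν`, so choosing a member of `R` above each `τ` is
injective. This is the standard way below to move infinitude upward in a tree. -/
theorem infinite_of_forall_succ {S R : Set α} (hS : S ⊆ succs B ν) (hinf : S.Infinite)
    (hR : R ⊆ B) (h : ∀ τ ∈ S, ∃ σ ∈ R, τ ≤ σ) : R.Infinite := by
  choose! g hg hle using h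
  refine Set.infinite_of_injOn_mapsTo (f := g) (s := S) ?_ (fun τ hτ => hg τ hτ) hinf
  intro τ hτ τ' hτ' heq
  refine hB.succs_unique (hS hτ) (hS hτ') (hR (hg τ hτ)) (hle τ hτ) ?_
  rw [heq]
  exact hle τ' hτ'

/-- Since chains are well-founded upward, every branch ends in a maximal node, and the nodes below a
maximal node form a branch. Fronts can therefore be tested on maximal nodes alone. -/
theorem isFront_iff : IsFront B Y ↔
    Y ⊆ B ∧ IsAntichain (· ≤ ·) Y ∧ ∀ z ∈ maxNodes B, ∃ y ∈ Y, y ≤ z := by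
  constructor
  · rintro ⟨h1, h2, h3⟩
    refine ⟨h1, h3, fun z hz => ?_⟩
    have hbr : IsBranch B {ρ | ρ ∈ B ∧ ρ ≤ z} := by
      refine ⟨⟨fun ρ hρ => hρ.1, fun x hx y hy _ => hB.le_or_le hx.1 hy.1 hz.1 hx.2 hy.2⟩, ?_⟩
      rintro X ⟨hXB, hX⟩ hle x hx
      refine ⟨hXB hx, ?_⟩
      rcases hX.total hx (hle ⟨hz.1, le_rfl⟩) with h | h
      · exact h
      · exact (eq_of_max_le hz (hXB hx) h).ge
    obtain ⟨y, hy, hyY⟩ := h2 _ hbr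
    exact ⟨y, hyY, hy.2⟩
  · rintro ⟨h1, h3, h2⟩
    refine ⟨h1, fun X hX => ?_, h3⟩
    have hXB : X ⊆ B := hX.prop.1
    have hXc : IsChain (· ≤ ·) X := hX.prop.2
    have key : ∃ z ∈ X, z ∈ maxNodes B := by
      by_contra! hcon
      have hXne : X.Nonempty := by
        by_contra! he
        obtain ⟨r, hr⟩ := hB.nonempty
        have := hX.le_of_ge (y := {r}) ⟨by simpa using hr, IsChain.singleton⟩ (by simp [he])
        simp [he] at this
      have step : ∀ x : X, ∃ y : X, x.1 < y.1 := by
        rintro ⟨x, hx⟩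
        by_contra! h
        have htop : ∀ y ∈ X, y ≤ x := fun y hy => by
          rcases hXc.total hx hy with h' | h'
          · rcases h'.eq_or_lt with h' | h'
            · exact h'.ge
            · exact absurd h' (h ⟨y, hy⟩)
          · exact h'
        obtain ⟨w, hw, hxw⟩ : ∃ w ∈ B, x < w := by
          by_contra! h'
          exact hcon x hx ⟨hXB hx, h'⟩
        have := hX.le_of_ge (y := insert w X) ⟨Set.insert_subset hw hXB,
          hXc.insert fun b hb _ => Or.inr ((htop b hb).trans hxw.le)⟩ (Set.subset_insert _ _)
        exact (htop w (this (Set.mem_insert _ _))).not_gt hxw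
      choose g hg using step
      obtain ⟨x0, hx0⟩ := hXne
      let f : ℕ → X := fun n => g^[n] ⟨x0, hx0⟩
      refine hB.no_omega_branch ⟨fun n => (f n).1, strictMono_nat_of_lt_succ fun n => ?_,
        fun n => hXB (f n).2⟩
      simp only [f, Function.iterate_succ_apply']
      exact hg _
    obtain ⟨z, hzX, hz⟩ := key
    obtain ⟨y, hy, hle⟩ := h2 z hz
    refine ⟨y, hX.le_of_ge (y := insert y X) ⟨Set.insert_subset (h1 hy) hXB,
      hXc.insert fun b hb _ => ?_⟩ (Set.subset_insert _ _) (Set.mem_insert _ _), hy⟩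
    have hbz : b ≤ z := by
      rcases hXc.total hb hzX with h | h
      · exact h
      · exact (eq_of_max_le hz (hXB hb) h).ge
    exact hB.le_or_le (h1 hy) (hXB hb) hz.1 hle hbz

/-- Each of the infinitely many successors of `ν` has a member of the front above it, since branches
through `ν` meet the front only after `ν`. -/
theorem front_infinite (hY : IsFront B Y) (hν : ν ∈ B) (hmax : ν ∉ maxNodes B)
    (h : ∀ y ∈ Y, ∀ z ∈ B, ν < z → y ≤ z → ν < y) : Y.Infinite := by
  obtain ⟨h1, h2, h3⟩ := hB.isFront_iff.1 hY
  refine hB.infinite_of_forall_succ subset_rfl (hB.succs_infinite_of_not_max hν hmax) h1 ?_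
  intro τ hτ
  obtain ⟨z, hz, hle⟩ := hB.exists_max_ge hτ.1
  obtain ⟨y, hy, hyz⟩ := h3 z hz
  exact ⟨y, hy, hB.succ_le_of_lt hτ (h1 hy) hz.1 (h y hy z hz.1 (hτ.2.1.trans_le hle) hyz) hle hyz⟩

end IsTree

/-- `T` is a nonempty lower subset of `B`. -/
def Lower (T B : Set α) : Prop := T ⊆ B ∧ T.Nonempty ∧ ∀ ρ ∈ B, ∀ ν ∈ T, ρ ≤ ν → ρ ∈ T

namespace Lower

theorem refl (h : B.Nonempty) : Lower B B := ⟨subset_rfl, h, fun _ h _ _ _ => h⟩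

theorem trans (h₁ : Lower T C) (h₂ : Lower C B) : Lower T B :=
  ⟨h₁.1.trans h₂.1, h₁.2.1, fun ρ hρ ν hν hle => h₁.2.2 ρ (h₂.2.2 ρ hρ ν (h₁.1 hν) hle) ν hν hle⟩

variable (h : Lower T B)
include h

theorem root_mem {r : α} (hr : IsLeast B r) : r ∈ T := by
  obtain ⟨x, hx⟩ := h.2.1
  exact h.2.2 r hr.1 x hx (hr.2 (h.1 hx))

theorem isLeast {r : α} (hr : IsLeast B r) : IsLeast T r :=
  ⟨h.root_mem hr, fun _ hx => hr.2 (h.1 hx)⟩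

theorem inter {r : α} (hr : IsLeast B r) (h' : Lower C B) : Lower (T ∩ C) B :=
  ⟨fun _ hx => h.1 hx.1, ⟨r, h.root_mem hr, h'.root_mem hr⟩,
    fun ρ hρ ν hν hle => ⟨h.2.2 ρ hρ ν hν.1 hle, h'.2.2 ρ hρ ν hν.2 hle⟩⟩

theorem succs_eq : succs T ν = succs B ν ∩ T := by
  ext σ
  constructor
  · rintro ⟨h1, h2, h3⟩
    exact ⟨⟨h.1 h1, h2, fun ⟨τ, hτ, h4, h5⟩ => h3 ⟨τ, h.2.2 τ hτ σ h1 h5.le, h4, h5⟩⟩, h1⟩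
  · rintro ⟨⟨h1, h2, h3⟩, h4⟩
    exact ⟨h4, h2, fun ⟨τ, hτ, h5⟩ => h3 ⟨τ, h.1 hτ, h5⟩⟩

theorem isTree (hB : IsTree B) (hs : ∀ ν ∈ T, succs B ν ∩ T = ∅ ∨ (succs B ν ∩ T).Infinite) :
    IsTree T where
  countable := hB.countable.mono h.1
  exists_root := hB.exists_root.imp fun _ => h.isLeast
  chain_below ν hν := (hB.chain_below ν (h.1 hν)).mono (by
    rintro x ⟨h1, h2⟩
    exact ⟨h.1 h1, h2⟩)
  finite_below ν hν := (hB.finite_below ν (h.1 hν)).subset fun _ hx => ⟨h.1 hx.1, hx.2⟩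
  no_omega_branch := fun ⟨f, hf, hfT⟩ => hB.no_omega_branch ⟨f, hf, fun n => h.1 (hfT n)⟩
  succs_infinite ν hν := by rw [h.succs_eq]; exact hs ν hν

end Lower

/-- `T` is a positive subtree of `B`, regardless of incompatibility and escape. -/
def PSub (T B : Set α) : Prop :=
  Lower T B ∧ ∀ ν ∈ T, ν ∉ maxNodes B → (succs B ν ∩ T).Infinite

/-- `T` is an exhaustive subtree of `B`, regardless of incompatibility and escape. -/
def SSub (T B : Set α) : Prop :=
  Lower T B ∧ ∀ ν ∈ T, (succs B ν \ T).Finite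

theorem PSub.isTree (h : PSub T B) (hB : IsTree B) : IsTree T := by
  refine h.1.isTree hB fun ν hν => ?_
  by_cases hm : ν ∈ maxNodes B
  · left; rw [succs_eq_empty_of_max hm, Set.empty_inter]
  · exact Or.inr (h.2 ν hν hm)

theorem PSub.maxNodes_eq (h : PSub T B) : maxNodes T = maxNodes B ∩ T := by
  ext ν
  constructor
  · intro hν
    refine ⟨?_, hν.1⟩
    by_contra hm
    obtain ⟨σ, hσ, hσT⟩ := (h.2 ν hν.1 hm).nonempty
    exact hν.2 σ hσT hσ.2.1
  · rintro ⟨h1, h2⟩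
    exact ⟨h2, fun ρ hρ => h1.2 ρ (h.1.1 hρ)⟩

theorem PSub.refl (hB : IsTree B) : PSub B B := by
  refine ⟨Lower.refl hB.nonempty, fun ν hν hm => ?_⟩
  rw [Set.inter_eq_left.2 fun _ h => h.1]
  exact hB.succs_infinite_of_not_max hν hm

theorem PSub.trans (h₁ : PSub T C) (h₂ : PSub C B) : PSub T B := by
  refine ⟨h₁.1.trans h₂.1, fun ν hν hm => ?_⟩
  have := h₁.2 ν hν fun h => hm (h₂.maxNodes_eq ▸ h : ν ∈ maxNodes B ∩ C).1
  rw [h₂.1.succs_eq] at this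
  exact this.mono fun x hx => ⟨hx.1.1, hx.2⟩

theorem SSub.pSub (h : SSub T B) (hB : IsTree B) : PSub T B := by
  refine ⟨h.1, fun ν hν hm => ?_⟩
  have := (hB.succs_infinite_of_not_max (h.1.1 hν) hm).sdiff (h.2 ν hν)
  rwa [Set.sdiff_sdiff_right_self] at this

theorem SSub.isTree (h : SSub T B) (hB : IsTree B) : IsTree T := (h.pSub hB).isTree hB

theorem SSub.refl (hB : IsTree B) : SSub B B := by
  refine ⟨Lower.refl hB.nonempty, fun ν _ => ?_⟩
  rw [Set.sdiff_eq_empty.2 fun _ h => h.1]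
  exact Set.finite_empty

theorem SSub.trans (h₁ : SSub T C) (h₂ : SSub C B) : SSub T B := by
  refine ⟨h₁.1.trans h₂.1, fun ν hν => ?_⟩
  refine ((h₁.2 ν hν).union (h₂.2 ν (h₁.1.1 hν))).subset ?_
  rintro σ ⟨h, h'⟩
  by_cases hC : σ ∈ C
  · left; exact ⟨by rw [h₂.1.succs_eq]; exact ⟨h, hC⟩, h'⟩
  · exact Or.inr ⟨h, hC⟩

theorem SSub.inter (hB : IsTree B) (h₁ : SSub T B) (h₂ : SSub C B) : SSub (T ∩ C) B := by
  obtain ⟨r, hr⟩ := hB.exists_root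
  refine ⟨h₁.1.inter hr h₂.1, fun ν hν => ?_⟩
  rw [Set.sdiff_inter]
  exact (h₁.2 ν hν.1).union (h₂.2 ν hν.2)

theorem SSub.of_subset (h₁ : SSub T B) (h₂ : Lower T C) (h₃ : Lower C B) : SSub T C := by
  refine ⟨h₂, fun ν hν => ((h₁.2 ν hν).subset ?_)⟩
  rw [h₃.succs_eq]
  exact fun x hx => ⟨hx.1.1, hx.2⟩

/-! ### The covering relation between trees. -/

/-- Every maximal node of `C` lies above a maximal node of `B` whose predecessors in `B` belong
to `C`. -/
def Cov (B C : Set α) : Prop :=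
  ∀ z ∈ maxNodes C, ∃ η ∈ maxNodes B, η ≤ z ∧ ∀ ρ ∈ B, ρ ≤ η → ρ ∈ C

namespace Cov

theorem of_pSub (h : PSub T B) : Cov B T := by
  intro z hz
  rw [h.maxNodes_eq] at hz
  exact ⟨z, hz.1, le_rfl, fun ρ hρ hle => h.1.2.2 ρ hρ z hz.2 hle⟩

theorem mono (h : Cov B C) (hD : PSub D C) : Cov B D := by
  intro z hz
  rw [hD.maxNodes_eq] at hz
  obtain ⟨η, h1, h2, h3⟩ := h z hz.1
  exact ⟨η, h1, h2, fun ρ hρ hle => hD.1.2.2 ρ (h3 ρ hρ hle) z hz.2 (hle.trans h2)⟩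

theorem trans (h₁ : Cov A B) (h₂ : Cov B C) : Cov A C := by
  intro z hz
  obtain ⟨η, h1, h2, h3⟩ := h₂ z hz
  obtain ⟨θ, h4, h5, h6⟩ := h₁ η h1
  exact ⟨θ, h4, h5.trans h2, fun ρ hρ hle => h3 ρ (h6 ρ hρ hle) (hle.trans h5)⟩

variable (hC : IsTree C) (h : Cov B C)
include hC h

theorem exists_max (hν : ν ∈ C) (hνB : ν ∈ B) :
    ∃ η ∈ maxNodes B, ν ≤ η ∧ ∀ ρ ∈ B, ρ ≤ η → ρ ∈ C := by
  obtain ⟨z, hz, hle⟩ := hC.exists_max_ge hν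
  obtain ⟨η, h1, h2, h3⟩ := h z hz
  refine ⟨η, h1, ?_, h3⟩
  rcases hC.le_or_le hν (h3 η h1.1 le_rfl) hz.1 hle h2 with h' | h'
  · exact h'
  · exact (eq_of_max_le h1 hνB h').ge

theorem lower : Lower (C ∩ B) B := by
  refine ⟨Set.inter_subset_right, ?_, fun ρ hρ ν hν hle => ?_⟩
  · obtain ⟨x, hx⟩ := hC.nonempty
    obtain ⟨z, hz, -⟩ := hC.exists_max_ge hx
    obtain ⟨η, h1, -, h3⟩ := h z hz
    exact ⟨η, h3 η h1.1 le_rfl, h1.1⟩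
  · obtain ⟨η, h1, h2, h3⟩ := h.exists_max hC hν.1 hν.2
    exact ⟨h3 ρ hρ (hle.trans h2), hρ⟩

theorem not_max (hν : ν ∈ C) (hνB : ν ∈ B) (hm : ν ∉ maxNodes B) : ν ∉ maxNodes C := by
  intro hmC
  obtain ⟨η, h1, h2, h3⟩ := h.exists_max hC hν hνB
  exact hm (eq_of_max_le hmC (h3 η h1.1 le_rfl) h2 ▸ h1)

theorem exists_succ (hB : IsTree B) (hν : ν ∈ C) (hνB : ν ∈ B) (hm : ν ∉ maxNodes B)
    (hz : z ∈ maxNodes C) (hνz : ν ≤ z) : ∃ σ ∈ succs B ν, σ ∈ C ∧ σ ≤ z := by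
  obtain ⟨η, h1, h2, h3⟩ := h z hz
  have hνη : ν < η := by
    rcases hC.le_or_le hν (h3 η h1.1 le_rfl) hz.1 hνz h2 with h' | h'
    · exact lt_of_le_of_ne h' fun he => hm (he ▸ h1)
    · exact absurd (eq_of_max_le h1 hνB h' ▸ h1) hm
  obtain ⟨σ, hσ, hle⟩ := hB.exists_succ_le h1.1 hνη
  exact ⟨σ, hσ, h3 σ hσ.1 hle, hle.trans h2⟩

/-- Successors in `C` are followed by successors in `B`. -/
theorem exists_succ_ge (hB : IsTree B) (hν : ν ∈ C) (hνB : ν ∈ B) (hm : ν ∉ maxNodes B)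
    (hτ : τ ∈ succs C ν) : ∃ σ ∈ succs B ν ∩ C, τ ≤ σ := by
  obtain ⟨z, hz, hle⟩ := hC.exists_max_ge hτ.1
  obtain ⟨σ, h1, h2, h3⟩ := h.exists_succ hC hB hν hνB hm hz (hτ.2.1.le.trans hle)
  exact ⟨σ, ⟨h1, h2⟩, hC.succ_le_of_lt hτ h2 hz.1 h1.2.1 hle h3⟩

theorem infinite_succs (hB : IsTree B) (hν : ν ∈ C) (hνB : ν ∈ B) (hm : ν ∉ maxNodes B)
    {P : α → Prop} (hP : ∀ x y, x ≤ y → P x → P y) (hinf : {τ | τ ∈ succs C ν ∧ P τ}.Infinite) :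
    {σ | σ ∈ succs B ν ∩ C ∧ P σ}.Infinite := by
  refine hC.infinite_of_forall_succ (fun τ hτ => hτ.1) hinf (fun σ hσ => hσ.1.2) fun τ hτ => ?_
  obtain ⟨σ, h1, h2⟩ := h.exists_succ_ge hC hB hν hνB hm hτ.1
  exact ⟨σ, ⟨h1, hP _ _ h2 hτ.2⟩, h2⟩

/-- A node of `C ∩ B` that is not maximal in `B` is not maximal in `C`; its infinitely many
`C`-successors are followed by distinct `B`-successors that lie in `C`. -/
theorem pSub (hB : IsTree B) : PSub (C ∩ B) B := by
  refine ⟨h.lower hC, fun ν hν hm => ?_⟩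
  have := h.infinite_succs hC hB hν.1 hν.2 hm (P := fun _ => True) (fun _ _ _ _ => trivial)
    (by simpa using hC.succs_infinite_of_not_max hν.1 (h.not_max hC hν.1 hν.2 hm))
  exact this.mono fun x hx => ⟨hx.1.1, hx.1.2, hx.1.1.1⟩

theorem inter (hB : IsTree B) : Cov (C ∩ B) C := by
  have hp := h.pSub hC hB
  intro z hz
  obtain ⟨η, h1, h2, h3⟩ := h z hz
  refine ⟨η, ?_, h2, fun ρ hρ _ => hρ.1⟩
  rw [hp.maxNodes_eq]
  exact ⟨h1, h3 η h1.1 le_rfl, h1.1⟩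

/-- An exhaustive subtree of `B` is covered by an exhaustive subtree of `C`. -/
theorem restrict (hB : IsTree B) (hE : SSub E B) :
    ∃ D, SSub D C ∧ Cov E D ∧ D ∩ B ⊆ E := by
  -- Delete from `C` the cones above the nodes of `B` that `E` omits.
  let D : Set α := {ρ | ρ ∈ C ∧ ∀ x ∈ B, x ∈ C → x ∉ E → ¬ x ≤ ρ}
  obtain ⟨r, hr⟩ := hC.exists_root
  obtain ⟨b, hb⟩ := hB.exists_root
  have hbE : b ∈ E := hE.1.root_mem hb
  have hbC : b ∈ C := ((h.lower hC).root_mem hb).1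
  have hlow : Lower D C := by
    refine ⟨fun ρ hρ => hρ.1, ⟨r, hr.1, ?_⟩, fun ρ hρ ν hν hle => ⟨hρ, fun x hx hxC hxE hxρ =>
      hν.2 x hx hxC hxE (hxρ.trans hle)⟩⟩
    intro x hx hxC hxE hxr
    have : x = r := le_antisymm hxr (hr.2 hxC)
    subst this
    exact hxE (le_antisymm (hr.2 hbC) (hb.2 hx) ▸ hbE)
  have hDB : D ∩ B ⊆ E := fun x hx => by
    by_contra hxE
    exact hx.1.2 x hx.2 hx.1.1 hxE le_rfl
  have hSS : SSub D C := by
    refine ⟨hlow, fun ν hν => ?_⟩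
    by_cases hbν : b ≤ ν
    -- With `μ` the last node of `B` below `ν`, any successor of `ν` that is lost is itself a
    -- `B`-successor of `μ` outside `E`, and there are finitely many of those.
    · obtain ⟨μ, hμC, hμν, hμB, hmax⟩ :=
        hC.exists_greatest_le (fun x => x ∈ B) hν.1 hbC hbν hb.1
      have hμE : μ ∈ E := by
        by_contra hμE
        exact hν.2 μ hμB hμC hμE hμν
      refine (hE.2 μ hμE).subset ?_
      rintro σ ⟨hσ, hσD⟩
      have : ∃ x ∈ B, x ∈ C ∧ x ∉ E ∧ x ≤ σ := by
        by_contra! hcon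
        exact hσD ⟨hσ.1, hcon⟩
      obtain ⟨x, hx, hxC, hxE, hxσ⟩ := this
      have hxν : ¬ x ≤ ν := hν.2 x hx hxC hxE
      have hxeq : x = σ := by
        refine le_antisymm hxσ ?_
        rcases hC.le_or_le hν.1 hxC hσ.1 hσ.2.1.le hxσ with h' | h'
        · exact hC.succ_le_of_lt hσ hxC hσ.1 (lt_of_le_of_ne h' fun he => hxν he.ge) le_rfl hxσ
        · exact absurd h' hxν
      subst hxeq
      refine ⟨⟨hx, hμν.trans_lt hσ.2.1, ?_⟩, hxE⟩
      rintro ⟨τ, hτ, h1, h2⟩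
      have hτC : τ ∈ C := ((h.lower hC).2.2 τ hτ x ⟨hxC, hx⟩ h2.le).1
      rcases hC.le_or_le hν.1 hτC hσ.1 hσ.2.1.le h2.le with h' | h'
      · rcases h'.eq_or_lt with rfl | h'
        · exact (hmax _ hτC le_rfl hτ).not_gt h1
        · exact hσ.2.2 ⟨τ, hτC, h', h2⟩
      · exact (hmax _ hτC h' hτ).not_gt h1
    · refine (Set.finite_singleton b).subset ?_
      rintro σ ⟨hσ, hσD⟩
      have : ∃ x ∈ B, x ∈ C ∧ x ∉ E ∧ x ≤ σ := by
        by_contra! hcon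
        exact hσD ⟨hσ.1, hcon⟩
      obtain ⟨x, hx, hxC, hxE, hxσ⟩ := this
      have hbσ : b ≤ σ := (hb.2 hx).trans hxσ
      have hνb : ν < b := by
        rcases hC.le_or_le hν.1 hbC hσ.1 hσ.2.1.le hbσ with h' | h'
        · exact lt_of_le_of_ne h' fun he => hbν he.ge
        · exact absurd h' hbν
      exact le_antisymm (hC.succ_le_of_lt hσ hbC hσ.1 hνb le_rfl hbσ) hbσ
  refine ⟨D, hSS, ?_, hDB⟩
  intro z hz
  have hz' := hz
  rw [(hSS.pSub hC).maxNodes_eq] at hz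
  obtain ⟨η, h1, h2, h3⟩ := h z hz.1
  have hsub : ∀ ρ ∈ B, ρ ≤ η → ρ ∈ D := fun ρ hρ hle =>
    hlow.2.2 ρ (h3 ρ hρ hle) z hz.2 (hle.trans h2)
  refine ⟨η, ?_, h2, fun ρ hρ hle => hsub ρ (hE.1.1 hρ) hle⟩
  rw [(hE.pSub hB).maxNodes_eq]
  exact ⟨h1, hDB ⟨hsub η h1.1 le_rfl, h1.1⟩⟩

end Cov

/-- `B` is covered by an exhaustive subtree of `C`. -/
def TLE (B C : Set α) : Prop := ∃ D, SSub D C ∧ Cov B D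

theorem Cov.tle (h : Cov B C) (hC : IsTree C) : TLE B C := ⟨C, SSub.refl hC, h⟩

theorem PSub.tle (h : PSub T B) (hB : IsTree B) : TLE B T := (Cov.of_pSub h).tle (h.isTree hB)

theorem TLE.refl (hB : IsTree B) : TLE B B := (PSub.refl hB).tle hB

theorem SSub.tle (h : SSub T B) (hB : IsTree B) : TLE T B :=
  ⟨T, h, Cov.of_pSub (PSub.refl (h.isTree hB))⟩

/-- The finitely many successors dropped at each node of `B` for the first relation can be dropped
in `C` as well, by `Cov.restrict`. -/
theorem TLE.trans (hB : IsTree B) (hC : IsTree C) (h₁ : TLE A B) (h₂ : TLE B C) : TLE A C := by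
  obtain ⟨D, hD, hAD⟩ := h₁
  obtain ⟨E, hE, hBE⟩ := h₂
  obtain ⟨F, hF, hDF, -⟩ := hBE.restrict (hE.isTree hC) hB hD
  exact ⟨F, hF.trans hE, hAD.trans hDF⟩

/-- The path to `η` given by `Cov` carries the member of `Y` below `η` into `C`. That member is the
only element of the antichain on its branch of `C`, so `Y ∩ C` has no members outside `B`. -/
theorem Cov.isFront (hC : IsTree C) (h : Cov B C) (hB : IsTree B) (hYa : IsAntichain (· ≤ ·) Y)
    (hY : IsFront B (Y ∩ B)) : IsFront C (Y ∩ C) ∧ Y ∩ C ⊆ B := by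
  obtain ⟨-, -, h3⟩ := hB.isFront_iff.1 hY
  have key : ∀ z ∈ maxNodes C, ∃ y ∈ Y ∩ C, y ∈ B ∧ y ≤ z := by
    intro z hz
    obtain ⟨η, hη, hle, hsub⟩ := h z hz
    obtain ⟨y, hy, hyη⟩ := h3 η hη
    exact ⟨y, ⟨hy.1, hsub y hy.2 hyη⟩, hy.2, hyη.trans hle⟩
  refine ⟨hC.isFront_iff.2 ⟨Set.inter_subset_right, hYa.subset Set.inter_subset_left,
    fun z hz => ?_⟩, fun y hy => ?_⟩
  · obtain ⟨y, hy, -, hle⟩ := key z hz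
    exact ⟨y, hy, hle⟩
  · obtain ⟨z, hz, hle⟩ := hC.exists_max_ge hy.2
    obtain ⟨y', hy', hB', hle'⟩ := key z hz
    rcases hC.le_or_le hy.2 hy'.2 hz.1 hle hle' with h' | h'
    · exact hYa.eq hy.1 hy'.1 h' ▸ hB'
    · exact hYa.eq hy'.1 hy.1 h' ▸ hB'

/-- The cone of a tree above one of its nodes. -/
theorem succs_cone (hρ : ρ ≤ ν) : succs (B ∩ Set.Ici ρ) ν = succs B ν := by
  ext σ
  constructor
  · rintro ⟨h1, h2, h3⟩
    exact ⟨h1.1, h2, fun ⟨τ, hτ, h4, h5⟩ => h3 ⟨τ, ⟨hτ, hρ.trans h4.le⟩, h4, h5⟩⟩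
  · rintro ⟨h1, h2, h3⟩
    exact ⟨⟨h1, hρ.trans h2.le⟩, h2, fun ⟨τ, hτ, h4⟩ => h3 ⟨τ, hτ.1, h4⟩⟩

theorem maxNodes_cone : maxNodes (B ∩ Set.Ici ρ) = maxNodes B ∩ Set.Ici ρ := by
  ext σ
  exact ⟨fun h => ⟨⟨h.1.1, fun τ hτ hlt => h.2 τ ⟨hτ, h.1.2.trans hlt.le⟩ hlt⟩, h.1.2⟩,
    fun h => ⟨⟨h.1.1, h.2⟩, fun τ hτ => h.1.2 τ hτ.1⟩⟩

theorem isLeast_cone (hρ : ρ ∈ B) : IsLeast (B ∩ Set.Ici ρ) ρ :=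
  ⟨⟨hρ, le_rfl⟩, fun _ h => h.2⟩

theorem IsTree.cone (hB : IsTree B) (hρ : ρ ∈ B) : IsTree (B ∩ Set.Ici ρ) where
  countable := hB.countable.mono Set.inter_subset_left
  exists_root := ⟨ρ, isLeast_cone hρ⟩
  chain_below ν hν := (hB.chain_below ν hν.1).mono (by
    rintro x ⟨h1, h2⟩
    exact ⟨h1.1, h2⟩)
  finite_below ν hν := (hB.finite_below ν hν.1).subset fun _ hx => ⟨hx.1.1, hx.2⟩
  no_omega_branch := fun ⟨f, hf, hfT⟩ => hB.no_omega_branch ⟨f, hf, fun n => (hfT n).1⟩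
  succs_infinite ν hν := by rw [succs_cone hν.2]; exact hB.succs_infinite ν hν.1

theorem IsTree.singleton (a : α) : IsTree ({a} : Set α) where
  countable := Set.countable_singleton a
  exists_root := ⟨a, rfl, fun _ h => (Set.mem_singleton_iff.1 h).ge⟩
  chain_below ν hν := by
    rintro x ⟨rfl, h⟩
    exact absurd (Set.mem_singleton_iff.1 hν) h.ne'
  finite_below ν hν := (Set.finite_singleton a).subset fun x hx => hx.1
  no_omega_branch := fun ⟨f, hf, h⟩ => (hf Nat.zero_lt_one).ne ((h 0).trans (h 1).symm)
  succs_infinite ν hν := Or.inl (Set.eq_empty_of_forall_notMem fun x hx =>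
    hx.2.1.ne ((Set.mem_singleton_iff.1 hν).trans (Set.mem_singleton_iff.1 hx.1).symm))

theorem maxNodes_singleton (a : α) : maxNodes ({a} : Set α) = {a} := by
  ext x
  refine ⟨fun h => h.1, fun h => ⟨h, fun y hy hlt => hlt.ne ?_⟩⟩
  exact (Set.mem_singleton_iff.1 h).trans (Set.mem_singleton_iff.1 hy).symm

theorem not_max_of_ne_singleton {r : α} (hr : IsLeast B r) (hne : B ≠ {r}) : r ∉ maxNodes B := by
  intro hm
  exact hne (Set.eq_singleton_iff_unique_mem.2 ⟨hr.1, fun x hx => (eq_of_max_le hm hx (hr.2 hx)).symm⟩)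

theorem Lower.below (hY : Y.Nonempty) (hYB : Y ⊆ B) : Lower (below B Y) B := by
  refine ⟨fun x hx => hx.1, ?_, fun ρ hρ ν hν hle => ⟨hρ, ?_⟩⟩
  · obtain ⟨y, hy⟩ := hY
    exact ⟨y, hYB hy, y, hy, le_rfl⟩
  · obtain ⟨y, hy, h⟩ := hν.2
    exact ⟨y, hy, hle.trans h⟩

end PureTrees

/-! ### Canonical colourings on positive subtrees. -/

section Canonization

variable {α : Type*} [PartialOrder α] {E T W Y : Set α} {ν σ : α}

/-- The nodes of `E` all of whose predecessors other than the root are selected by `s`. -/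
def selTree (E : Set α) (s : α → Set α) : Set α :=
  {ν | ν ∈ E ∧ ∀ μ ∈ E, ∀ σ ∈ succs E μ, σ ≤ ν → σ ∈ s μ}

theorem pSub_selTree (hE : IsTree E) {s : α → Set α}
    (hs : ∀ μ ∈ E, μ ∉ maxNodes E → {σ | σ ∈ succs E μ ∧ σ ∈ s μ}.Infinite) :
    PSub (selTree E s) E := by
  obtain ⟨r, hr⟩ := hE.exists_root
  refine ⟨⟨fun ν h => h.1, ⟨r, hr.1, fun μ hμ σ hσ hle => ?_⟩, fun ρ hρ ν hν hle => ⟨hρ,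
    fun μ hμ σ hσ h => hν.2 μ hμ σ hσ (h.trans hle)⟩⟩, fun ν hν hm => ?_⟩
  · exact absurd (hσ.2.1.trans_le hle) (hr.2 hμ).not_gt
  · refine (hs ν hν.1 hm).mono ?_
    rintro σ ⟨hσ, hσs⟩
    refine ⟨hσ, hσ.1, fun μ hμ τ hτ hle => ?_⟩
    rcases hle.eq_or_lt with rfl | hlt
    · rwa [hE.parent_unique hμ hν.1 hτ hσ]
    · refine hν.2 μ hμ τ hτ ?_
      rcases hE.le_or_le hτ.1 hν.1 hσ.1 hle hσ.2.1.le with h | h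
      · exact h
      · rcases h.eq_or_lt with rfl | h
        · exact le_rfl
        · exact absurd ⟨τ, hτ.1, h, hlt⟩ hσ.2.2

/-- As `v` is finite-to-one on every `S i`, a recursion that visits each index infinitely often can
always pick an element whose value is new. -/
theorem exists_infinite_subsets_injOn {β ι : Type*} [Countable ι] (S : ι → Set β)
    (hS : ∀ i, (S i).Infinite) (v : β → ℕ) (hv : ∀ i n, {x | x ∈ S i ∧ v x = n}.Finite) :
    ∃ S' : ι → Set β, (∀ i, S' i ⊆ S i) ∧ (∀ i, (S' i).Infinite) ∧
      ∀ i j, ∀ x ∈ S' i, ∀ y ∈ S' j, v x = v y → x = y := by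
  rcases isEmpty_or_nonempty ι with hι | hι
  · exact ⟨S, fun i => hι.elim i, fun i => hι.elim i, fun i => hι.elim i⟩
  have hF : ∀ (s : Finset ℕ) (i : ι), ∃ x ∈ S i, v x ∉ s := by
    intro s i
    by_contra! hcon
    refine hS i ((s.finite_toSet.biUnion fun n _ => hv i n).subset fun x hx => ?_)
    simp only [Set.mem_iUnion]
    exact ⟨v x, hcon x hx, hx, rfl⟩
  choose F hFS hFs using hF
  obtain ⟨e, he⟩ := exists_surjective_nat (ι × ℕ)
  let st : ℕ → Finset ℕ := fun k =>
    Nat.rec ∅ (fun k s => insert (v (F s (e k).1)) s) k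
  let x : ℕ → β := fun k => F (st k) (e k).1
  have hst : ∀ k, st (k + 1) = insert (v (x k)) (st k) := fun k => rfl
  have hmono : Monotone st := monotone_nat_of_le_succ fun k => by
    rw [hst]; exact Finset.subset_insert _ _
  have hlt : ∀ j k, j < k → v (x j) ≠ v (x k) := by
    intro j k hjk heq
    refine hFs (st k) (e k).1 ?_
    change v (x k) ∈ st k
    rw [← heq]
    exact hmono (Nat.succ_le_of_lt hjk) (by rw [Nat.succ_eq_add_one, hst]; simp)
  have hinj : ∀ j k, v (x j) = v (x k) → j = k := by
    intro j k h
    rcases lt_trichotomy j k with h' | h' | h'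
    · exact absurd h (hlt j k h')
    · exact h'
    · exact absurd h.symm (hlt k j h')
  refine ⟨fun i => {y | ∃ k, (e k).1 = i ∧ x k = y}, ?_, ?_, ?_⟩
  · rintro i y ⟨k, rfl, rfl⟩
    exact hFS _ _
  · intro i
    choose k hk using fun n => he (i, n)
    refine Set.infinite_of_injective_forall_mem (f := fun n => x (k n)) ?_
      fun n => ⟨k n, by rw [hk], rfl⟩
    intro m n h
    have := hinj _ _ (congrArg v h)
    have h2 := hk m
    rw [this, hk n] at h2
    exact (Prod.ext_iff.1 h2).2.symm
  · rintro i j y ⟨k, -, rfl⟩ z ⟨l, -, rfl⟩ h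
    rw [hinj _ _ h]

/-- Some positive subtree of the part of `E` above `ν` has colour `v` everywhere on `W`. -/
inductive Pos (E W : Set α) (c : α → ℕ) : ℕ → α → Prop
  | leaf {ν : α} (h : ν ∈ W) : Pos E W c (c ν) ν
  | node {v : ℕ} {ν : α} (S : Set α) (hW : ν ∉ W) (hS : S ⊆ succs E ν) (hinf : S.Infinite)
      (h : ∀ σ ∈ S, Pos E W c v σ) : Pos E W c v ν

theorem Pos.eq_of_mem {c : α → ℕ} {v : ℕ} (h : Pos E W c v ν) (hν : ν ∈ W) : c ν = v := by
  cases h with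
  | leaf h => rfl
  | node S hW => exact absurd hν hW

theorem Pos.infinite {c : α → ℕ} {v : ℕ} (h : Pos E W c v ν) (hν : ν ∉ W) :
    {σ | σ ∈ succs E ν ∧ Pos E W c v σ}.Infinite := by
  cases h with
  | leaf h => exact absurd h hν
  | node S hW hS hinf h => exact hinf.mono fun x hx => ⟨hS hx, h x hx⟩

/-- Canonization: a colouring of a front is, on a positive subtree, the colouring induced by a
front below it. -/
theorem exists_canonical (hE : IsTree E) (hW : IsFront E W) (c : α → ℕ) :
    ∃ T, PSub T E ∧ ∃ Y, IsFront T Y ∧ (∀ y ∈ Y, ∃ w ∈ W ∩ T, y ≤ w) ∧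
      ∀ w ∈ W ∩ T, ∀ w' ∈ W ∩ T, (c w = c w' ↔ ∃ y ∈ Y, y ≤ w ∧ y ≤ w') := by
  classical
  obtain ⟨hWE, hWa, hWm⟩ := hE.isFront_iff.1 hW
  obtain ⟨r, hr⟩ := hE.exists_root
  -- The front sought consists of the lowest nodes at which some colour can be made constant.
  let K : α → Prop := fun ν => ∃ v, Pos E W c v ν
  have hcol : ∃ col : α → ℕ, ∀ ν, K ν → Pos E W c (col ν) ν := by
    refine ⟨fun ν => if h : K ν then h.choose else 0, fun ν h => ?_⟩
    simp only [dif_pos h]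
    exact h.choose_spec
  obtain ⟨col, hcol⟩ := hcol
  have hWK : ∀ w ∈ W, K w := fun w hw => ⟨_, Pos.leaf hw⟩
  let Y0 : Set α := {y | y ∈ E ∧ K y ∧ ∀ μ ∈ E, μ < y → ¬ K μ}
  have hY0 : ∀ x ∈ E, K x → ∃ y ∈ Y0, y ≤ x := by
    intro x hx hK
    obtain ⟨y, h1, h2, h3, h4⟩ := hE.exists_least_le K hx hx le_rfl hK
    exact ⟨y, ⟨h1, h3, h4⟩, h2⟩
  have hYuniq : ∀ x ∈ E, ∀ y ∈ Y0, ∀ y' ∈ Y0, y ≤ x → y' ≤ x → y = y' := by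
    intro x hx y hy y' hy' h h'
    rcases hE.le_or_le hy.1 hy'.1 hx h h' with hle | hle
    · rcases hle.eq_or_lt with he | hlt
      · exact he
      · exact absurd hy.2.1 (hy'.2.2 y hy.1 hlt)
    · rcases hle.eq_or_lt with he | hlt
      · exact he.symm
      · exact absurd hy'.2.1 (hy.2.2 y' hy'.1 hlt)
  let I : Type _ := {μ : α // μ ∈ E ∧ ¬ K μ ∧ {σ | σ ∈ succs E μ ∧ K σ}.Infinite}
  have hI : Countable I := (hE.countable.mono (s₁ := {μ | μ ∈ E ∧ ¬ K μ ∧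
    {σ | σ ∈ succs E μ ∧ K σ}.Infinite}) fun x hx => hx.1).to_subtype
  -- At a node outside `K`, the chosen colours of its successors in `K` are finite-to-one: a colour
  -- repeated infinitely often would put the node itself in `K`. Hence all these successor sets can
  -- be thinned simultaneously so that distinct selected successors have distinct colours.
  obtain ⟨S', hS1, hS2, hS3⟩ := exists_infinite_subsets_injOn
    (fun i : I => {σ | σ ∈ succs E i.1 ∧ K σ}) (fun i => i.2.2.2) col (by
      intro i n
      by_contra hinf
      refine i.2.2.1 ⟨n, Pos.node _ (fun h => i.2.2.1 (hWK _ h)) (fun x hx => hx.1.1) hinf ?_⟩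
      rintro σ ⟨⟨-, h⟩, rfl⟩
      exact hcol σ h)
  -- Three selection rules. From a front node `y` up to `W`, stay where the colour of `y` is
  -- positive. Below the front, keep only successors outside `K` if there are infinitely many of
  -- them; otherwise keep the thinned set of successors in `K`. Elsewhere nothing is removed.
  let s : α → Set α := fun μ =>
    {σ | (∀ y ∈ Y0, y ≤ μ → μ ∉ W → Pos E W c (col y) μ → Pos E W c (col y) σ) ∧
      ((∀ y ∈ Y0, ¬ y ≤ μ) → {σ | σ ∈ succs E μ ∧ ¬ K σ}.Infinite → ¬ K σ) ∧
      ((∀ y ∈ Y0, ¬ y ≤ μ) → ¬ {σ | σ ∈ succs E μ ∧ ¬ K σ}.Infinite →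
        ∃ i : I, i.1 = μ ∧ σ ∈ S' i)}
  have hs : ∀ μ ∈ E, μ ∉ maxNodes E → {σ | σ ∈ succs E μ ∧ σ ∈ s μ}.Infinite := by
    intro μ hμ hm
    have hinf := hE.succs_infinite_of_not_max hμ hm
    by_cases hy : ∃ y ∈ Y0, y ≤ μ
    · obtain ⟨y, hy, hle⟩ := hy
      by_cases hp : μ ∉ W ∧ Pos E W c (col y) μ
      · refine (hp.2.infinite hp.1).mono ?_
        rintro σ ⟨h1, h2⟩
        refine ⟨h1, fun y' hy' hle' _ _ => ?_, fun h => absurd hle (h y hy),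
          fun h => absurd hle (h y hy)⟩
        rwa [hYuniq μ hμ y' hy' y hy hle' hle]
      · refine hinf.mono fun σ h1 => ⟨h1, fun y' hy' hle' h3 h4 => ?_, fun h => absurd hle (h y hy),
          fun h => absurd hle (h y hy)⟩
        rw [hYuniq μ hμ y' hy' y hy hle' hle] at h4
        exact absurd ⟨h3, h4⟩ hp
    · push Not at hy
      have hK : ¬ K μ := fun h => by
        obtain ⟨y, h1, h2⟩ := hY0 μ hμ h
        exact hy y h1 h2
      by_cases hN : {σ | σ ∈ succs E μ ∧ ¬ K σ}.Infinite
      · exact hN.mono fun σ h => ⟨h.1, fun y h1 h2 => absurd h2 (hy y h1), fun _ _ => h.2,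
          fun _ h' => absurd hN h'⟩
      · have hKi : {σ | σ ∈ succs E μ ∧ K σ}.Infinite := by
          by_contra hfin
          refine hinf (((Set.not_infinite.1 hN).union (Set.not_infinite.1 hfin)).subset ?_)
          intro σ hσ
          by_cases h : K σ
          · exact Or.inr ⟨hσ, h⟩
          · exact Or.inl ⟨hσ, h⟩
        refine (hS2 ⟨μ, hμ, hK, hKi⟩).mono fun σ h => ⟨(hS1 _ h).1, fun y h1 h2 =>
          absurd h2 (hy y h1), fun _ h' => absurd h' hN, fun _ _ => ⟨_, rfl, h⟩⟩
  have hT := pSub_selTree hE hs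
  set T := selTree E s with hTdef
  have hTt := hT.isTree hE
  have hpos : ∀ y ∈ Y0, ∀ x ∈ T, y ≤ x → (∃ w ∈ W, x ≤ w) → Pos E W c (col y) x := by
    intro y hy x hx hyx hxw
    by_contra hneg
    obtain ⟨w, hw, hxw⟩ := hxw
    obtain ⟨x0, h1, h2, ⟨h3, h4⟩, h5⟩ := hE.exists_least_le
      (fun x => y ≤ x ∧ ¬ Pos E W c (col y) x) (hT.1.1 hx) (hT.1.1 hx) le_rfl ⟨hyx, hneg⟩
    have hne : y ≠ x0 := fun h => h4 (h ▸ hcol y hy.2.1)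
    have hlt : y < x0 := lt_of_le_of_ne h3 hne
    obtain ⟨μ, hμ, hμx⟩ := hE.exists_parent hr h1 fun h => (hr.2 hy.1).not_gt (h ▸ hlt)
    have hyμ : y ≤ μ := by
      rcases hE.le_or_le hy.1 hμ h1 h3 hμx.2.1.le with h | h
      · exact h
      · rcases h.eq_or_lt with h | h
        · exact h.ge
        · exact absurd ⟨y, hy.1, h, hlt⟩ hμx.2.2
    have hμP : Pos E W c (col y) μ := by
      by_contra h
      exact h5 μ hμ hμx.2.1 ⟨hyμ, h⟩
    have hμW : μ ∉ W := fun h =>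
      ((hμx.2.1.trans_le (h2.trans hxw)).ne (hWa.eq h hw (hμx.2.1.le.trans (h2.trans hxw))))
    exact h4 ((hx.2 μ hμ x0 hμx h2).1 y hy hyμ hμW hμP)
  -- A surviving front node other than the root was selected by the third rule, since the second
  -- excludes members of `K`. This makes `col` injective on the front.
  have hparent : ∀ y ∈ Y0, y ∈ T → y ≠ r → ∃ i : I, y ∈ S' i := by
    intro y hy hyT hne
    obtain ⟨μ, hμ, hμy⟩ := hE.exists_parent hr hy.1 hne
    have hno : ∀ y' ∈ Y0, ¬ y' ≤ μ := fun y' hy' hle =>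
      hy.2.2 y' hy'.1 (hle.trans_lt hμy.2.1) hy'.2.1
    obtain ⟨-, h2, h3⟩ := hyT.2 μ hμ y hμy le_rfl
    by_cases hN : {σ | σ ∈ succs E μ ∧ ¬ K σ}.Infinite
    · exact absurd hy.2.1 (h2 hno hN)
    · obtain ⟨i, -, hi⟩ := h3 hno hN
      exact ⟨i, hi⟩
  have hroot : ∀ y ∈ Y0, K r → y = r := fun y hy hK => by
    by_contra hne
    exact hy.2.2 r hr.1 (lt_of_le_of_ne (hr.2 hy.1) (Ne.symm hne)) hK
  have hinj : ∀ y ∈ Y0, y ∈ T → ∀ y' ∈ Y0, y' ∈ T → col y = col y' → y = y' := by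
    intro y hy hyT y' hy' hyT' h
    by_cases hK : K r
    · rw [hroot y hy hK, hroot y' hy' hK]
    · obtain ⟨i, hi⟩ := hparent y hy hyT fun he => hK (he ▸ hy.2.1)
      obtain ⟨j, hj⟩ := hparent y' hy' hyT' fun he => hK (he ▸ hy'.2.1)
      exact hS3 i j y hi y' hj h
  have hlow : ∀ w ∈ W ∩ T, ∃ y ∈ Y0 ∩ T, y ≤ w ∧ c w = col y := by
    rintro w ⟨hw, hwT⟩
    obtain ⟨y, hy, hle⟩ := hY0 w (hWE hw) (hWK w hw)
    exact ⟨y, ⟨hy, hT.1.2.2 y hy.1 w hwT hle⟩, hle,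
      (hpos y hy w hwT hle ⟨w, hw, le_rfl⟩).eq_of_mem hw⟩
  have hmax : ∀ z ∈ maxNodes T, ∃ w ∈ W ∩ T, w ≤ z := by
    intro z hz
    rw [hT.maxNodes_eq] at hz
    obtain ⟨w, hw, hle⟩ := hWm z hz.1
    exact ⟨w, ⟨hw, hT.1.2.2 w (hWE hw) z hz.2 hle⟩, hle⟩
  refine ⟨T, hT, Y0 ∩ T, hTt.isFront_iff.2 ⟨Set.inter_subset_right, ?_, ?_⟩, ?_, ?_⟩
  · rintro y ⟨hy, -⟩ y' ⟨hy', -⟩ hne hle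
    exact hne (hYuniq y' hy'.1 y hy y' hy' hle le_rfl)
  · intro z hz
    obtain ⟨w, hw, hle⟩ := hmax z hz
    obtain ⟨y, hy, hyw, -⟩ := hlow w hw
    exact ⟨y, hy, hyw.trans hle⟩
  · rintro y ⟨hy, hyT⟩
    obtain ⟨z, hz, hyz⟩ := hTt.exists_max_ge hyT
    obtain ⟨w, hw, hwz⟩ := hmax z hz
    refine ⟨w, hw, ?_⟩
    rcases hE.le_or_le hy.1 (hWE hw.1) (hT.1.1 hz.1) hyz hwz with h | h
    · exact h
    · rcases h.eq_or_lt with h | h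
      · exact h.ge
      · exact absurd (hWK w hw.1) (hy.2.2 w (hWE hw.1) h)
  · intro w hw w' hw'
    obtain ⟨y, hy, hyw, hc⟩ := hlow w hw
    obtain ⟨y', hy', hyw', hc'⟩ := hlow w' hw'
    constructor
    · intro h
      rw [hc, hc'] at h
      have := hinj y hy.1 hy.2 y' hy'.1 hy'.2 h
      exact ⟨y, hy, hyw, this ▸ hyw'⟩
    · rintro ⟨x, hx, h1, h2⟩
      rw [hc, hc', hYuniq w (hWE hw.1) y hy.1 x hx.1 hyw h1,
        hYuniq w' (hWE hw'.1) y' hy'.1 x hx.1 hyw' h2]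

end Canonization

/-! ### Gluing trees above a common root. -/

section GlueSet

variable {α ι : Type*} {r : α} {A : ι → Set α}

/-- The set obtained by putting `r` below the sets `A i`. -/
def glue (r : α) (A : ι → Set α) : Set α := insert r (⋃ i, A i)

theorem mem_glue_iff {x : α} : x ∈ glue r A ↔ x = r ∨ ∃ i, x ∈ A i := by
  simp [glue]

theorem root_mem_glue : r ∈ glue r A := Set.mem_insert _ _

theorem mem_glue {i : ι} {x : α} (h : x ∈ A i) : x ∈ glue r A := mem_glue_iff.2 (Or.inr ⟨i, h⟩)

end GlueSet

section Gluing

variable {α : Type*} [PartialOrder α] {ι : Type*} {r : α} {A : ι → Set α} {ρ : ι → α}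

theorem Incompat.mono {a b a' b' : α} (h : Incompat a b) (ha : a ≤ a') (hb : b ≤ b') :
    Incompat a' b' := fun ⟨c, h1, h2⟩ => h ⟨c, ha.trans h1, hb.trans h2⟩

theorem Incompat.symm {a b : α} (h : Incompat a b) : Incompat b a :=
  fun ⟨c, h1, h2⟩ => h ⟨c, h2, h1⟩

theorem Incompat.not_le {a b : α} (h : Incompat a b) : ¬ a ≤ b := fun hle => h ⟨b, hle, le_rfl⟩

theorem Incompat.ne {a b : α} (h : Incompat a b) : a ≠ b := fun he => h.not_le he.le

/-- Members of `B` that are incomparable are incompatible. -/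
def IncompatOn (B : Set α) : Prop := ∀ η ∈ B, ∀ ν ∈ B, ¬ η ≤ ν → ¬ ν ≤ η → Incompat η ν

theorem IncompatOn.mono {B C : Set α} (h : IncompatOn B) (hC : C ⊆ B) : IncompatOn C :=
  fun η hη ν hν => h η (hC hη) ν (hC hν)

theorem IncompatOn.singleton (a : α) : IncompatOn ({a} : Set α) := by
  rintro x rfl y rfl h
  exact absurd le_rfl h

theorem IncompatOn.succs {B : Set α} (hB : IncompatOn B) {ν σ τ : α} (hσ : σ ∈ succs B ν)
    (hτ : τ ∈ succs B ν) (hne : σ ≠ τ) : Incompat σ τ := by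
  refine hB σ hσ.1 τ hτ.1 (fun h => ?_) fun h => ?_
  · exact hτ.2.2 ⟨σ, hσ.1, hσ.2.1, lt_of_le_of_ne h hne⟩
  · exact hσ.2.2 ⟨τ, hτ.1, hτ.2.1, lt_of_le_of_ne h hne.symm⟩

/-- The sets `A i` are trees whose roots `ρ i` are pairwise incompatible and lie above `r`. -/
structure Gluable (r : α) (A : ι → Set α) (ρ : ι → α) : Prop where
  isTree : ∀ i, IsTree (A i)
  isLeast : ∀ i, IsLeast (A i) (ρ i)
  lt : ∀ i, r < ρ i
  incompat : ∀ i j, i ≠ j → Incompat (ρ i) (ρ j)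

namespace Gluable

variable (h : Gluable r A ρ)
include h

theorem root_lt {i : ι} {x : α} (hx : x ∈ A i) : r < x := (h.lt i).trans_le ((h.isLeast i).2 hx)

theorem isLeast_glue : IsLeast (glue r A) r := by
  refine ⟨root_mem_glue, fun x hx => ?_⟩
  rcases mem_glue_iff.1 hx with rfl | ⟨i, hi⟩
  · exact le_rfl
  · exact (h.root_lt hi).le

theorem mem_of_le {i : ι} {x y : α} (hx : x ∈ A i) (hy : y ∈ glue r A) (hxy : x ≤ y) :
    y ∈ A i := by
  rcases mem_glue_iff.1 hy with rfl | ⟨j, hj⟩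
  · exact absurd (h.root_lt hx) hxy.not_gt
  · by_cases hij : i = j
    · exact hij ▸ hj
    · exact absurd ⟨y, ((h.isLeast i).2 hx).trans hxy, (h.isLeast j).2 hj⟩ (h.incompat i j hij)

theorem mem_of_ge {i : ι} {x y : α} (hx : x ∈ glue r A) (hy : y ∈ A i) (hxy : x ≤ y)
    (hne : x ≠ r) : x ∈ A i := by
  rcases mem_glue_iff.1 hx with rfl | ⟨j, hj⟩
  · exact absurd rfl hne
  · by_cases hij : i = j
    · exact hij ▸ hj
    · exact absurd ⟨y, (h.isLeast i).2 hy, ((h.isLeast j).2 hj).trans hxy⟩ (h.incompat i j hij)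

theorem succs_root : succs (glue r A) r = Set.range ρ := by
  ext σ
  constructor
  · rintro ⟨h1, h2, h3⟩
    rcases mem_glue_iff.1 h1 with rfl | ⟨i, hi⟩
    · exact absurd h2 (lt_irrefl _)
    · refine ⟨i, ?_⟩
      by_contra hne
      exact h3 ⟨ρ i, mem_glue (h.isLeast i).1, h.lt i, lt_of_le_of_ne ((h.isLeast i).2 hi) hne⟩
  · rintro ⟨i, rfl⟩
    refine ⟨mem_glue (h.isLeast i).1, h.lt i, fun ⟨τ, hτ, h1, h2⟩ => ?_⟩
    have := h.mem_of_ge hτ (h.isLeast i).1 h2.le h1.ne'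
    exact ((h.isLeast i).2 this).not_gt h2

theorem succs_eq {i : ι} {ν : α} (hν : ν ∈ A i) : succs (glue r A) ν = succs (A i) ν := by
  ext σ
  constructor
  · rintro ⟨h1, h2, h3⟩
    exact ⟨h.mem_of_le hν h1 h2.le, h2, fun ⟨τ, hτ, h4⟩ => h3 ⟨τ, mem_glue hτ, h4⟩⟩
  · rintro ⟨h1, h2, h3⟩
    exact ⟨mem_glue h1, h2, fun ⟨τ, hτ, h4, h5⟩ => h3 ⟨τ, h.mem_of_le hν hτ h4.le, h4, h5⟩⟩

theorem maxNodes_eq [Nonempty ι] : maxNodes (glue r A) = ⋃ i, maxNodes (A i) := by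
  ext z
  simp only [Set.mem_iUnion]
  constructor
  · intro hz
    rcases mem_glue_iff.1 hz.1 with rfl | ⟨i, hi⟩
    · exact absurd (h.lt (Classical.arbitrary ι)) (hz.2 _ (mem_glue (h.isLeast _).1))
    · exact ⟨i, hi, fun ν hν => hz.2 ν (mem_glue hν)⟩
  · rintro ⟨i, hi⟩
    exact ⟨mem_glue hi.1, fun ν hν hlt => hi.2 ν (h.mem_of_le hi.1 hν hlt.le) hlt⟩

theorem injective : Function.Injective ρ := fun i j hij => by
  by_contra hne
  exact (h.incompat i j hne).ne hij

theorem isTree_glue [Countable ι] [Infinite ι] : IsTree (glue r A) where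
  countable := (Set.countable_iUnion fun i => (h.isTree i).countable).insert r
  exists_root := ⟨r, h.isLeast_glue⟩
  chain_below := by
    rintro ν hν x ⟨hx, hxν⟩ y ⟨hy, hyν⟩ -
    by_cases hxr : x = r
    · exact Or.inl (hxr ▸ h.isLeast_glue.2 hy)
    by_cases hyr : y = r
    · exact Or.inr (hyr ▸ h.isLeast_glue.2 hx)
    obtain ⟨i, hi⟩ := (mem_glue_iff.1 hx).resolve_left hxr
    have hνi := h.mem_of_le hi hν hxν.le
    exact (h.isTree i).le_or_le hi (h.mem_of_ge hy hνi hyν.le hyr) hνi hxν.le hyν.le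
  finite_below := by
    intro ν hν
    rcases mem_glue_iff.1 hν with rfl | ⟨i, hi⟩
    · refine Set.finite_empty.subset ?_
      rintro x ⟨hx, hlt⟩
      exact absurd hlt (h.isLeast_glue.2 hx).not_gt
    · refine (((h.isTree i).finite_below ν hi).insert r).subset ?_
      rintro x ⟨hx, hlt⟩
      by_cases hxr : x = r
      · exact Or.inl hxr
      · exact Or.inr ⟨h.mem_of_ge hx hi hlt.le hxr, hlt⟩
  no_omega_branch := by
    rintro ⟨f, hf, hfT⟩
    have h1 : f 1 ≠ r := ((h.isLeast_glue.2 (hfT 0)).trans_lt (hf Nat.zero_lt_one)).ne'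
    obtain ⟨i, hi⟩ := (mem_glue_iff.1 (hfT 1)).resolve_left h1
    refine (h.isTree i).no_omega_branch ⟨fun n => f (n + 1), fun a b hab => hf (by omega),
      fun n => h.mem_of_le hi (hfT _) (hf.monotone (by omega))⟩
  succs_infinite := by
    intro ν hν
    rcases mem_glue_iff.1 hν with rfl | ⟨i, hi⟩
    · right
      rw [h.succs_root]
      exact Set.infinite_range_of_injective h.injective
    · rw [h.succs_eq hi]
      exact (h.isTree i).succs_infinite ν hi

theorem incompatOn_glue (hA : ∀ i, IncompatOn (A i)) : IncompatOn (glue r A) := by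
  intro x hx y hy hxy hyx
  rcases mem_glue_iff.1 hx with rfl | ⟨i, hi⟩
  · exact absurd (h.isLeast_glue.2 hy) hxy
  rcases mem_glue_iff.1 hy with rfl | ⟨j, hj⟩
  · exact absurd (h.isLeast_glue.2 hx) hyx
  by_cases hij : i = j
  · subst hij
    exact hA i x hi y hj hxy hyx
  · exact (h.incompat i j hij).mono ((h.isLeast i).2 hi) ((h.isLeast j).2 hj)

end Gluable

end Gluing

/-! ### From abstract trees to `CWT`: incompatibility and escape. -/

section CWT

variable {α : Type*} [PartialOrder α] {B C D T Y : Set α} {ν : α}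

/-- The last condition in `IsCWT`. -/
def EscapeOn (B : Set α) : Prop :=
  ∀ ν ∈ B, ν ∉ maxNodes B → ∀ F : Set α, F.Finite → (∀ ρ ∈ F, ¬ ρ ≤ ν) →
    {ϱ | ϱ ∈ succs B ν ∧ ∀ ρ ∈ F, Incompat ρ ϱ}.Infinite

theorem IsTree.isCWT (hB : IsTree B) (h₁ : IncompatOn B) (h₂ : EscapeOn B) : IsCWT B :=
  ⟨hB.countable, hB.exists_root, hB.chain_below, hB.finite_below, hB.no_omega_branch,
    hB.succs_infinite, h₁, h₂⟩

theorem SSub.isCWT (h : SSub C B) (hB : IsCWT B) : IsCWT C := by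
  refine (h.isTree hB.isTree).isCWT (IncompatOn.mono hB.incompat h.1.1) fun ν hν hm F hF hFν => ?_
  have hm' : ν ∉ maxNodes B := fun h' => hm (by
    rw [(h.pSub hB.isTree).maxNodes_eq]; exact ⟨h', hν⟩)
  refine ((hB.escape ν (h.1.1 hν) hm' F hF hFν).sdiff (h.2 ν hν)).mono ?_
  rintro x ⟨⟨h1, h2⟩, h3⟩
  rw [h.1.succs_eq]
  exact ⟨⟨h1, by_contra fun hx => h3 ⟨h1, hx⟩⟩, h2⟩

/-- Escape does not pass to arbitrary positive subtrees. Here it comes from `C`: incompatibility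
with `F` is inherited upward from `C`-successors of a node to the `B`-successors above them. -/
theorem Cov.isCWT (h : Cov B C) (hB : IsCWT B) (hC : IsCWT C) : IsCWT (C ∩ B) := by
  have hp := h.pSub hC.isTree hB.isTree
  refine (hp.isTree hB.isTree).isCWT (IncompatOn.mono hB.incompat hp.1.1)
    fun ν hν hm F hF hFν => ?_
  have hm' : ν ∉ maxNodes B := fun h' => hm (by rw [hp.maxNodes_eq]; exact ⟨h', hν⟩)
  refine (h.infinite_succs hC.isTree hB.isTree hν.1 hν.2 hm' (P := fun x => ∀ ρ ∈ F, Incompat ρ x)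
    (fun x y hxy hx ρ hρ => (hx ρ hρ).mono le_rfl hxy)
    (hC.escape ν hν.1 (h.not_max hC.isTree hν.1 hν.2 hm') F hF hFν)).mono ?_
  rintro x ⟨⟨h1, h2⟩, h3⟩
  rw [hp.1.succs_eq]
  exact ⟨⟨h1, h2, h1.1⟩, h3⟩

theorem IsCWT.cone (hB : IsCWT B) (hν : ν ∈ B) : IsCWT (B ∩ Set.Ici ν) := by
  refine (hB.isTree.cone hν).isCWT (IncompatOn.mono hB.incompat Set.inter_subset_left)
    fun ρ hρ hm => ?_
  rw [succs_cone hρ.2]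
  refine hB.escape ρ hρ.1 fun h => hm ?_
  rw [maxNodes_cone]
  exact ⟨h, hρ.2⟩

/-- `sb` and `psb` only constrain successors; downward closure follows. If `μ` is the last node of
`C` below `ρ ≤ ν`, the `C`-successor of `μ` towards `ν` is a `B`-successor, hence lies below `ρ`,
against the choice of `μ`. -/
theorem lower_of_succs_subset (hB : IsTree B) (hCB : C ⊆ B) (hroot : SameRoot B C)
    (h : ∀ ν ∈ C, ν ∉ maxNodes B → succs C ν ⊆ succs B ν) (hC : IsTree C) : Lower C B := by
  obtain ⟨r, hr, hrC⟩ := hroot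
  refine ⟨hCB, ⟨r, hrC.1⟩, fun ρ hρ ν hν hle => ?_⟩
  obtain ⟨μ, hμ, hμρ, hμC, hmax⟩ :=
    hB.exists_greatest_le (fun x => x ∈ C) hρ hr.1 (hr.2 hρ) hrC.1
  rcases hμρ.eq_or_lt with rfl | hlt
  · exact hμC
  obtain ⟨σ, hσ, hσν⟩ := hC.exists_succ_le hν (hlt.trans_le hle)
  have hσB := h μ hμC (fun hm => hm.2 ρ hρ hlt) hσ
  have := hB.succ_le_of_lt hσB hρ (hCB hν) hlt hσν hle
  exact absurd (hmax σ hσB.1 this hσ.1) hσ.2.1.not_ge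

theorem mem_sb_iff (hB : IsCWT B) : C ∈ sb B ↔ SSub C B := by
  constructor
  · rintro ⟨h1, h2, h3, h4⟩
    refine ⟨lower_of_succs_subset hB.isTree h2 h3 (fun ν hν _ => (h4 ν hν).1) h1.isTree,
      fun ν hν => (h4 ν hν).2.subset fun x hx => ⟨hx.1, fun h => hx.2 h.1⟩⟩
  · intro h
    refine ⟨h.isCWT hB, h.1.1, ?_, fun ν hν => ?_⟩
    · obtain ⟨r, hr⟩ := hB.exists_root
      exact ⟨r, hr, h.1.isLeast hr⟩
    · rw [h.1.succs_eq, Set.sdiff_self_inter]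
      exact ⟨Set.inter_subset_left, h.2 ν hν⟩

theorem pSub_of_mem_psb (hB : IsCWT B) (h : C ∈ psb B) : PSub C B := by
  obtain ⟨h1, h2, h3, h4⟩ := h
  exact ⟨lower_of_succs_subset hB.isTree h2 h3 (fun ν hν hm => (h4 ν hν hm).1) h1.isTree,
    fun ν hν hm => (h4 ν hν hm).2.mono fun x hx => ⟨(h4 ν hν hm).1 hx, hx.1⟩⟩

theorem PSub.mem_psb (hB : IsCWT B) (hC : IsCWT C) (h : PSub C B) : C ∈ psb B := by
  obtain ⟨r, hr⟩ := hB.exists_root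
  refine ⟨hC, h.1.1, ⟨r, hr, h.1.isLeast hr⟩, fun ν hν hm => ?_⟩
  rw [h.1.succs_eq]
  exact ⟨Set.inter_subset_left, h.2 ν hν hm⟩

/-- If `Y` is an almost front of `B` and `B` is covered by an exhaustive subtree of `C`, then `Y`
is an almost front of `C`. -/
theorem TLE.almostFront (hB : IsCWT B) (hC : IsCWT C) (h : TLE B C) (hY : IsAlmostFront B Y)
    (hD : SSub D B) : ∃ E, SSub E C ∧ IsFront E (Y ∩ E) ∧ Y ∩ E ⊆ D := by
  obtain ⟨hYa, D', hD', hYD'⟩ := hY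
  rw [mem_sb_iff hB] at hD'
  have hB' := hB.isTree
  have hC' := hC.isTree
  have hDD : SSub (D' ∩ D) B := hD'.inter hB' hD
  have hDD' : SSub (D' ∩ D) D' :=
    hD'.trans (SSub.refl hB') |>.inter hB' hD |>.of_subset
      ⟨Set.inter_subset_left, hDD.1.2.1, fun ρ hρ ν hν hle =>
        hDD.1.2.2 ρ (hD'.1.1 hρ) ν hν hle⟩ hD'.1
  have hfr := (Cov.of_pSub (hDD'.pSub (hD'.isTree hB'))).isFront (hDD.isTree hB')
    (hD'.isTree hB') hYa hYD'
  obtain ⟨F, hF, hBF⟩ := h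
  obtain ⟨E, hE, hcov, -⟩ := hBF.restrict (hF.isTree hC') hB' hDD
  have hEC := hE.trans hF
  obtain ⟨h1, h2⟩ := hcov.isFront (hEC.isTree hC') (hDD.isTree hB') hYa hfr.1
  exact ⟨E, hEC, h1, fun y hy => (h2 hy).2⟩

/-- The exhaustive subtree `D` that covers `B` also covers `D ∩ B`, so almost fronts of `D ∩ B` pass
to `C` by `TLE.almostFront`. -/
theorem TLE.starLE (hB : IsCWT B) (hC : IsCWT C) (hroot : SameRoot B C) (h : TLE B C) :
    StarLE B C := by
  obtain ⟨D, hD, hBD⟩ := h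
  have hDc := hD.isCWT hC
  have hDB := hBD.isCWT hB hDc
  refine ⟨hB, hC, hroot, D, (mem_sb_iff hC).2 hD,
    (hBD.pSub hDc.isTree hB.isTree).mem_psb hB hDB, fun Y hY => ?_⟩
  obtain ⟨E, hE, hYE, -⟩ := TLE.almostFront hDB hC ⟨D, hD, hBD.inter hDc.isTree hB.isTree⟩ hY
    (SSub.refl hDB.isTree)
  exact ⟨hY.1, E, (mem_sb_iff hC).2 hE, hYE⟩

theorem IsFront.isAlmostFront (hB : IsCWT B) (hY : IsFront B Y) : IsAlmostFront B Y := by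
  refine ⟨hY.2.2, B, (mem_sb_iff hB).2 (SSub.refl hB.isTree), ?_⟩
  rwa [Set.inter_eq_left.2 hY.1]

section Below

variable (hB : IsTree B) (hY : IsFront B Y)
include hB hY

theorem IsTree.lower_below : Lower (below B Y) B := by
  obtain ⟨h1, -, h3⟩ := hB.isFront_iff.1 hY
  obtain ⟨x, hx⟩ := hB.nonempty
  obtain ⟨z, hz, -⟩ := hB.exists_max_ge hx
  obtain ⟨y, hy, -⟩ := h3 z hz
  exact Lower.below ⟨y, hy⟩ h1

theorem IsTree.succs_below (hν : ν ∈ below B Y) (hνY : ν ∉ Y) :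
    succs B ν ⊆ below B Y ∧ ν ∉ maxNodes B := by
  obtain ⟨h1, h2, h3⟩ := hB.isFront_iff.1 hY
  obtain ⟨hνB, y0, hy0, hle0⟩ := hν
  have hlt0 : ν < y0 := lt_of_le_of_ne hle0 fun h => hνY (h ▸ hy0)
  refine ⟨fun σ hσ => ⟨hσ.1, ?_⟩, fun hm => hm.2 y0 (h1 hy0) hlt0⟩
  obtain ⟨z, hz, hσz⟩ := hB.exists_max_ge hσ.1
  obtain ⟨y, hy, hyz⟩ := h3 z hz
  refine ⟨y, hy, hB.succ_le_of_lt hσ (h1 hy) hz.1 ?_ hσz hyz⟩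
  rcases hB.le_or_le hνB (h1 hy) hz.1 (hσ.2.1.le.trans hσz) hyz with h | h
  · exact lt_of_le_of_ne h fun he => hνY (he ▸ hy)
  · exact absurd (h.trans_lt hlt0) fun hlt => hlt.ne (h2.eq hy hy0 hlt.le)

theorem IsTree.max_below : maxNodes (below B Y) = Y := by
  obtain ⟨h1, h2, h3⟩ := hB.isFront_iff.1 hY
  ext ν
  constructor
  · intro hν
    by_contra hνY
    obtain ⟨hs, hm⟩ := hB.succs_below hY hν.1 hνY
    obtain ⟨σ, hσ⟩ := (hB.succs_infinite_of_not_max hν.1.1 hm).nonempty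
    exact hν.2 σ (hs hσ) hσ.2.1
  · intro hν
    refine ⟨⟨h1 hν, ν, hν, le_rfl⟩, ?_⟩
    rintro ρ ⟨-, y, hy, hle⟩ hlt
    exact (hlt.trans_le hle).ne (h2.eq hν hy (hlt.trans_le hle).le)

theorem IsTree.below : IsTree (below B Y) := by
  refine (hB.lower_below hY).isTree hB fun ν hν => ?_
  by_cases hνY : ν ∈ Y
  · left
    rw [← (hB.lower_below hY).succs_eq]
    exact succs_eq_empty_of_max (by rwa [hB.max_below hY])
  · right
    obtain ⟨hs, hm⟩ := hB.succs_below hY hν hνY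
    rw [Set.inter_eq_left.2 hs]
    exact hB.succs_infinite_of_not_max hν.1 hm

theorem IsTree.cov_below : Cov (TreeSys.below B Y) B := by
  intro z hz
  obtain ⟨-, -, h3⟩ := hB.isFront_iff.1 hY
  obtain ⟨y, hy, hle⟩ := h3 z hz
  exact ⟨y, by rwa [hB.max_below hY], hle, fun ρ hρ _ => hρ.1⟩

end Below

theorem IsCWT.below (hB : IsCWT B) (hY : IsFront B Y) : IsCWT (below B Y) := by
  have hl := hB.isTree.lower_below hY
  refine (hB.isTree.below hY).isCWT (IncompatOn.mono hB.incompat hl.1) fun ν hν hm F hF hFν => ?_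
  rw [hB.isTree.max_below hY] at hm
  obtain ⟨hs, hm⟩ := hB.isTree.succs_below hY hν hm
  rw [hl.succs_eq, Set.inter_eq_left.2 hs]
  exact hB.escape ν hν.1 hm F hF hFν

end CWT

/-! ### Countable conditions: strong escape, limits, and a new level above the root. -/

section Conditions

variable {P : Type*} [PartialOrder P]

/-- Every member of `N` that does not lie below `ν` is compatible with finitely many members
of `S` only. -/
def Esc (N : Set P) (ν : P) (S : Set P) : Prop :=
  ∀ ρ ∈ N, ¬ ρ ≤ ν → {σ | σ ∈ S ∧ ¬ Incompat ρ σ}.Finite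

theorem Esc.mono {N : Set P} {ν : P} {S S' : Set P} (h : Esc N ν S) (hS : S' ⊆ S) : Esc N ν S' :=
  fun ρ hρ hle => (h ρ hρ hle).subset fun _ hx => ⟨hS hx.1, hx.2⟩

theorem Esc.empty {N : Set P} {ν : P} : Esc N ν ∅ :=
  fun _ _ _ => Set.finite_empty.subset fun _ hx => hx.1

theorem Esc.infinite {N S F : Set P} {ν : P} (h : Esc N ν S) (hS : S.Infinite) (hF : F.Finite)
    (hFN : F ⊆ N) (hFν : ∀ ρ ∈ F, ¬ ρ ≤ ν) : {σ | σ ∈ S ∧ ∀ ρ ∈ F, Incompat ρ σ}.Infinite := by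
  refine (hS.sdiff (hF.biUnion fun ρ hρ => h ρ (hFN hρ) (hFν ρ hρ))).mono ?_
  rintro τ ⟨h1, h2⟩
  refine ⟨h1, fun ρ hρ => ?_⟩
  by_contra hcon
  exact h2 (Set.mem_iUnion₂.2 ⟨ρ, hρ, h1, hcon⟩)

variable [OrderBot P]

/-- Escape from members of `N` implies escape from members of `N'`, except at the root. -/
def Ext (N N' : Set P) : Prop :=
  ∀ ρ ∈ N', ∀ ν ∈ N, ν ≠ ⊥ → ¬ ρ ≤ ν → ∃ G ⊆ N, G.Finite ∧ (∀ g ∈ G, ¬ g ≤ ν) ∧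
    ∀ σ ∈ N, ν ≤ σ → (∀ g ∈ G, Incompat g σ) → Incompat ρ σ

theorem Ext.refl (N : Set P) : Ext N N := fun ρ hρ _ _ _ hle =>
  ⟨{ρ}, by simpa using hρ, Set.finite_singleton ρ, by simpa using hle, fun _ _ _ h => h ρ rfl⟩

theorem Ext.trans {N N' N'' : Set P} (h₁ : Ext N N') (h₂ : Ext N' N'') (hN : N ⊆ N') :
    Ext N N'' := by
  intro ρ hρ ν hν hne hle
  obtain ⟨G, hG, hGf, hGν, hGI⟩ := h₂ ρ hρ ν (hN hν) hne hle
  choose! H hH hHf hHν hHI using fun g (hg : g ∈ G) => h₁ g (hG hg) ν hν hne (hGν g hg)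
  refine ⟨⋃ g ∈ G, H g, Set.iUnion₂_subset hH, hGf.biUnion hHf, fun x hx => ?_,
    fun σ hσ hνσ h => ?_⟩
  · obtain ⟨g, hg, hx⟩ := Set.mem_iUnion₂.1 hx
    exact hHν g hg x hx
  · exact hGI σ (hN hσ) hνσ fun g hg => hHI g hg σ hσ hνσ fun x hx =>
      h x (Set.mem_iUnion₂.2 ⟨g, hg, hx⟩)

theorem Ext.iUnion {N : ℕ → Set P} (hN : Monotone N) (h : ∀ i j, i ≤ j → Ext (N i) (N j)) (n : ℕ) :
    Ext (N n) (⋃ i, N i) := by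
  intro ρ hρ
  obtain ⟨m, hm⟩ := Set.mem_iUnion.1 hρ
  exact h n (max n m) (le_max_left _ _) ρ (hN (le_max_right _ _) hm)

/-- A new `ρ` can be compatible only with members of `S` that are compatible with one of finitely
many old elements, each responsible for finitely many. -/
theorem Ext.esc {N N' S : Set P} {ν : P} (h : Ext N N') (hν : ν ∈ N) (hne : ν ≠ ⊥) (hS : S ⊆ N)
    (hνS : ∀ σ ∈ S, ν ≤ σ) (hE : Esc N ν S) : Esc N' ν S := by
  intro ρ hρ hle
  obtain ⟨G, hG, hGf, hGν, hGI⟩ := h ρ hρ ν hν hne hle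
  refine (hGf.biUnion fun g hg => hE g (hG hg) (hGν g hg)).subset ?_
  rintro σ ⟨hσ, hc⟩
  by_contra hcon
  refine hc (hGI σ (hS hσ) (hνS σ hσ) fun g hg => ?_)
  by_contra hgσ
  exact hcon (Set.mem_iUnion₂.2 ⟨g, hg, hσ, hgσ⟩)

/-- `η` has infinitely many pairwise incompatible members of `N` above it that escape from `N`. -/
def HasStar (N : Set P) (η : P) : Prop :=
  ∃ S : ℕ → P, (∀ k, S k ∈ N ∧ η < S k) ∧ (∀ i j, i ≠ j → Incompat (S i) (S j)) ∧
    Esc N η (Set.range S)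

theorem Ext.hasStar {N N' : Set P} {η : P} (h : Ext N N') (hN : N ⊆ N') (hη : η ∈ N) (hne : η ≠ ⊥)
    (hs : HasStar N η) : HasStar N' η := by
  obtain ⟨S, h1, h2, h3⟩ := hs
  refine ⟨S, fun k => ⟨hN (h1 k).1, (h1 k).2⟩, h2, h.esc hη hne ?_ ?_ h3⟩
  · rintro _ ⟨k, rfl⟩
    exact (h1 k).1
  · rintro _ ⟨k, rfl⟩
    exact (h1 k).2.le

/-- `B` is a nontrivial tree with root `⊥` inside `N` that strongly escapes from `N`. -/
structure Good (N B : Set P) : Prop where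
  isTree : IsTree B
  bot_mem : ⊥ ∈ B
  ne : B ≠ {⊥}
  sub : B ⊆ N
  incompat : IncompatOn B
  esc : ∀ ν ∈ B, Esc N ν (succs B ν)

theorem isLeast_bot {B : Set P} (h : ⊥ ∈ B) : IsLeast B ⊥ := ⟨h, fun _ _ => bot_le⟩

namespace Good

variable {N B T : Set P} (h : Good N B)
include h

theorem not_max : ⊥ ∉ maxNodes B := not_max_of_ne_singleton (isLeast_bot h.bot_mem) h.ne

theorem infinite_succs : (succs B ⊥).Infinite :=
  h.isTree.succs_infinite_of_not_max h.bot_mem h.not_max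

theorem of_pSub (hT : PSub T B) : Good N T where
  isTree := hT.isTree h.isTree
  bot_mem := hT.1.root_mem (isLeast_bot h.bot_mem)
  ne he := by
    have hb : (⊥ : P) ∈ maxNodes T := by rw [he, maxNodes_singleton]; rfl
    rw [hT.maxNodes_eq] at hb
    exact h.not_max hb.1
  sub := hT.1.1.trans h.sub
  incompat := h.incompat.mono hT.1.1
  esc ν hν := (h.esc ν (hT.1.1 hν)).mono (by rw [hT.1.succs_eq]; exact Set.inter_subset_left)

end Good

/-- A tree below a good tree weakly escapes at the root. -/
theorem Good.infinite_escape {N N' B C F : Set P} (hC : Good N C) (hB : Good N' B) (h : TLE B C)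
    (hF : F.Finite) (hFN : F ⊆ N) (hF0 : ∀ ρ ∈ F, ρ ≠ ⊥) :
    {σ | σ ∈ succs B ⊥ ∧ ∀ ρ ∈ F, Incompat ρ σ}.Infinite := by
  obtain ⟨D, hD, hBD⟩ := h
  have hDg := hC.of_pSub (hD.pSub hC.isTree)
  refine (hBD.infinite_succs hDg.isTree hB.isTree hDg.bot_mem hB.bot_mem hB.not_max
    (P := fun x => ∀ ρ ∈ F, Incompat ρ x) (fun x y hxy hx ρ hρ => (hx ρ hρ).mono le_rfl hxy)
    ((hDg.esc ⊥ hDg.bot_mem).infinite hDg.infinite_succs hF hFN fun ρ hρ hle =>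
      hF0 ρ hρ (le_bot_iff.1 hle))).mono fun x hx => ⟨hx.1.1, hx.2⟩

/-- Sequences of pairwise incompatible elements have a lower bound that is only compatible with
elements compatible with a term of the sequence. -/
def HasLumps (P : Type*) [PartialOrder P] : Prop :=
  ∀ S : ℕ → P, ∃ ρ, (∀ k, ρ ≤ S k) ∧ ∀ τ, (∀ k, Incompat τ (S k)) → Incompat τ ρ

/-- A new level can be inserted directly above the root. -/
theorem Good.exists_lump (hP : HasLumps P) {N T : Set P} (h : Good N T) (hN : N.Countable) :
    ∃ N' B', N ⊆ N' ∧ N'.Countable ∧ Good N' B' ∧ Ext N N' ∧ Cov T B' ∧ T ⊆ B' ∧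
      maxNodes B' ⊆ maxNodes T ∧ (∀ x ∈ succs B' ⊥, x ∉ N) ∧ ∀ η ∈ N', η ∉ N → HasStar N' η := by
  have hinf : Infinite (succs T ⊥) := h.infinite_succs.to_subtype
  have hcnt : Countable (succs T ⊥) := (h.isTree.countable.mono fun x hx => hx.1).to_subtype
  -- Split the successors of the root into infinitely many infinite blocks `s m`; one lump `l m`
  -- goes below each block.
  obtain ⟨e⟩ : Nonempty (ℕ × ℕ ≃ succs T ⊥) := nonempty_equiv_of_countable
  let s : ℕ → ℕ → P := fun m k => (e (m, k)).1
  have hs : ∀ m k, s m k ∈ succs T ⊥ := fun m k => (e (m, k)).2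
  have hsinj : ∀ m k m' k', s m k = s m' k' → m = m' ∧ k = k' := by
    intro m k m' k' he
    have := e.injective (Subtype.ext he)
    exact Prod.ext_iff.1 this
  have hsI : ∀ m k m' k', ¬ (m = m' ∧ k = k') → Incompat (s m k) (s m' k') :=
    fun m k m' k' hne => h.incompat.succs (hs m k) (hs m' k') fun he => hne (hsinj _ _ _ _ he)
  choose l hl hlI using fun m => hP (s m)
  have f1 : ∀ m m' k, m ≠ m' → Incompat (l m) (s m' k) := fun m m' k hne =>
    (hlI m _ fun k' => hsI _ _ _ _ fun hh => hne hh.1.symm).symm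
  have f2 : ∀ m m', m ≠ m' → Incompat (l m) (l m') := fun m m' hne => hlI _ _ fun k => f1 m m' k hne
  have f3 : ∀ m k, l m < s m k := fun m k => lt_of_le_of_ne (hl m k) fun he =>
    (hsI m k m (k + 1) (by omega)).not_le (he ▸ hl m (k + 1))
  have f4 : ∀ m, ⊥ < l m := fun m => bot_lt_iff_ne_bot.2 fun he =>
    (f2 m (m + 1) (by omega)).not_le (he ▸ bot_le)
  have hescbot : ∀ ρ ∈ N, ρ ≠ ⊥ → {σ | σ ∈ succs T ⊥ ∧ ¬ Incompat ρ σ}.Finite :=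
    fun ρ hρ hne => h.esc ⊥ h.bot_mem ρ hρ fun hle => hne (le_bot_iff.1 hle)
  have f5 : ∀ ρ ∈ N, ρ ≠ ⊥ → {m | ¬ Incompat ρ (l m)}.Finite := by
    intro ρ hρ hne
    have : ∀ m, ¬ Incompat ρ (l m) → ∃ k, ¬ Incompat ρ (s m k) := fun m hm => by
      by_contra! hcon
      exact hm (hlI m ρ hcon)
    choose! k hk using this
    refine Set.Finite.of_finite_image ((hescbot ρ hρ hne).subset ?_)
      (f := fun m => s m (k m)) fun m _ m' _ he => (hsinj _ _ _ _ he).1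
    rintro _ ⟨m, hm, rfl⟩
    exact ⟨hs _ _, hk m hm⟩
  -- A lump is compatible with all of its infinite block, which the escape of `T` at the root
  -- forbids for members of `N` other than `⊥`.
  have f6 : ∀ m, l m ∉ N := by
    intro m hm
    refine Set.infinite_of_injective_forall_mem (f := s m) (fun k k' he => (hsinj _ _ _ _ he).2)
      (fun k => (⟨hs m k, fun hI => hI.not_le (hl m k)⟩ :
        s m k ∈ {σ | σ ∈ succs T ⊥ ∧ ¬ Incompat (l m) σ})) (hescbot (l m) hm (f4 m).ne')
  have g1 : ∀ m, Gluable (l m) (fun k => T ∩ Set.Ici (s m k)) (s m) := fun m =>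
    ⟨fun k => h.isTree.cone (hs m k).1, fun k => isLeast_cone (hs m k).1, f3 m,
      fun i j hij => hsI _ _ _ _ fun hh => hij hh.2⟩
  let A : ℕ → Set P := fun m => glue (l m) fun k => T ∩ Set.Ici (s m k)
  have g2 : Gluable ⊥ A l := ⟨fun m => (g1 m).isTree_glue, fun m => (g1 m).isLeast_glue, f4, f2⟩
  have hmaxB : maxNodes (glue ⊥ A) ⊆ maxNodes T := by
    intro z hz
    rw [g2.maxNodes_eq] at hz
    obtain ⟨m, hz⟩ := Set.mem_iUnion.1 hz
    rw [(g1 m).maxNodes_eq] at hz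
    obtain ⟨k, hz⟩ := Set.mem_iUnion.1 hz
    rw [maxNodes_cone] at hz
    exact hz.1
  have hTB : T ⊆ glue ⊥ A := by
    intro x hx
    rcases eq_or_ne x ⊥ with rfl | hne
    · exact root_mem_glue
    · obtain ⟨σ, hσ, hle⟩ := h.isTree.exists_succ_le hx (bot_lt_iff_ne_bot.2 hne)
      obtain ⟨⟨m, k⟩, he⟩ := e.surjective ⟨σ, hσ⟩
      have he' : s m k = σ := congrArg Subtype.val he
      exact mem_glue (i := m) (mem_glue (i := k) ⟨hx, he' ▸ hle⟩)
  have hescl : ∀ m, Esc (N ∪ Set.range l) (l m) (Set.range (s m)) := by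
    rintro m ρ hρ hle
    rcases hρ with hρ | ⟨m', rfl⟩
    · refine (hescbot ρ hρ fun he => hle (he ▸ bot_le)).subset ?_
      rintro σ ⟨⟨k, rfl⟩, h2⟩
      exact ⟨hs m k, h2⟩
    · refine Set.finite_empty.subset ?_
      rintro σ ⟨⟨k, rfl⟩, h2⟩
      exact h2 (f1 m' m k fun he => hle (he ▸ le_rfl))
  refine ⟨N ∪ Set.range l, glue ⊥ A, Set.subset_union_left, hN.union (Set.countable_range l), ?_,
    ?_, ?_, hTB, hmaxB, ?_, ?_⟩
  · refine ⟨g2.isTree_glue, root_mem_glue, fun he => ?_, ?_, ?_, ?_⟩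
    · have : l 0 ∈ glue ⊥ A := mem_glue (i := 0) root_mem_glue
      rw [he] at this
      exact (f4 0).ne' this
    · intro x hx
      rcases mem_glue_iff.1 hx with rfl | ⟨m, hm⟩
      · exact Or.inl (h.sub h.bot_mem)
      · rcases mem_glue_iff.1 hm with rfl | ⟨k, hk⟩
        · exact Or.inr ⟨m, rfl⟩
        · exact Or.inl (h.sub hk.1)
    · exact g2.incompatOn_glue fun m => (g1 m).incompatOn_glue fun k =>
        h.incompat.mono Set.inter_subset_left
    · intro ν hν
      rcases mem_glue_iff.1 hν with rfl | ⟨m, hm⟩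
      · rw [g2.succs_root]
        rintro ρ hρ hle
        rcases hρ with hρ | ⟨m, rfl⟩
        · refine ((f5 ρ hρ fun he => hle he.le).image l).subset ?_
          rintro _ ⟨⟨m, rfl⟩, h2⟩
          exact ⟨m, h2, rfl⟩
        · refine (Set.finite_singleton (l m)).subset ?_
          rintro _ ⟨⟨m', rfl⟩, h2⟩
          by_contra hne
          exact h2 (f2 m m' fun he => hne (he ▸ rfl))
      · rw [g2.succs_eq hm]
        rcases mem_glue_iff.1 hm with rfl | ⟨k, hk⟩
        · rw [(g1 m).succs_root]
          exact hescl m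
        · rw [(g1 m).succs_eq hk, succs_cone hk.2]
          rintro ρ hρ hle
          rcases hρ with hρ | ⟨m', rfl⟩
          · exact h.esc ν hk.1 ρ hρ hle
          · refine Set.finite_empty.subset ?_
            rintro σ ⟨h1, h2⟩
            have hne : m' ≠ m := by
              rintro rfl
              exact hle ((f3 m' k).le.trans hk.2)
            exact h2 ((f1 m' m k hne).mono le_rfl (hk.2.trans h1.2.1.le))
  · intro ρ hρ ν hν hne hle
    rcases hρ with hρ | ⟨m, rfl⟩
    · exact Ext.refl N ρ hρ ν hν hne hle
    -- Since `ν ≠ ⊥`, only finitely many members of the block are compatible with `ν`. An extension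
    -- of `ν` that avoids these avoids the whole block, hence the lump. At the root the set would be
    -- the entire block.
    · refine ⟨{σ | σ ∈ Set.range (s m) ∧ ¬ Incompat ν σ}, ?_, ?_, ?_, ?_⟩
      · rintro _ ⟨⟨k, rfl⟩, -⟩
        exact h.sub (hs m k).1
      · refine (hescbot ν hν hne).subset ?_
        rintro _ ⟨⟨k, rfl⟩, h2⟩
        exact ⟨hs m k, h2⟩
      · rintro _ ⟨⟨k, rfl⟩, -⟩ hk
        exact hle ((hl m k).trans hk)
      · intro σ _ hνσ hG
        refine (hlI m σ fun k => ?_).symm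
        by_cases hk : Incompat ν (s m k)
        · exact hk.mono hνσ le_rfl
        · exact (hG _ ⟨⟨k, rfl⟩, hk⟩).symm
  · intro z hz
    exact ⟨z, hmaxB hz, le_rfl, fun ρ hρ _ => hTB hρ⟩
  · rw [g2.succs_root]
    rintro _ ⟨m, rfl⟩
    exact f6 m
  · rintro η hη hηN
    obtain ⟨m, rfl⟩ := hη.resolve_left hηN
    exact ⟨s m, fun k => ⟨Or.inl (h.sub (hs m k).1), f3 m k⟩,
      fun i j hij => hsI _ _ _ _ fun hh => hij hh.2, hescl m⟩

/-- The recursion remembers a finite set containing the earlier `x i` and `f i`. It is used with `R`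
as incompatibility, which makes the chosen roots pairwise incompatible and lets them escape from an
enumeration of the nodes. -/
theorem exists_seq_avoiding {β : Type*} (x : ℕ → β) (U : Set β) (hx : ∀ n, x n ∈ U)
    (S : ℕ → Set β) (hSU : ∀ n, S n ⊆ U) (R : β → β → Prop)
    (h : ∀ n (F : Finset β), ↑F ⊆ U → ∃ σ ∈ S n, ∀ ρ ∈ F, R ρ σ) :
    ∃ f : ℕ → β, (∀ n, f n ∈ S n) ∧ (∀ n, ∀ i < n, R (x i) (f n)) ∧
      ∀ n, ∀ i < n, R (f i) (f n) := by
  classical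
  have hF : ∀ n (F : Finset β), ∃ σ ∈ S n, ↑F ⊆ U → ∀ ρ ∈ F, R ρ σ := by
    intro n F
    by_cases hFU : (F : Set β) ⊆ U
    · obtain ⟨σ, h1, h2⟩ := h n F hFU
      exact ⟨σ, h1, fun _ => h2⟩
    · obtain ⟨σ, h1, -⟩ := h n ∅ (by simp)
      exact ⟨σ, h1, fun h' => absurd h' hFU⟩
  choose g hgS hg using hF
  let st : ℕ → Finset β := fun k => Nat.rec ∅ (fun k F => insert (x k) (insert (g k F) F)) k
  let f : ℕ → β := fun k => g k (st k)
  have hst : ∀ k, st (k + 1) = insert (x k) (insert (f k) (st k)) := fun k => rfl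
  have hmono : Monotone st := monotone_nat_of_le_succ fun k => by
    rw [hst]
    exact (Finset.subset_insert _ _).trans (Finset.subset_insert _ _)
  have hU : ∀ k, ∀ y ∈ st k, y ∈ U := by
    intro k
    induction k with
    | zero => simp [st]
    | succ k ih =>
      rw [hst]
      simp only [Finset.mem_insert]
      rintro y (rfl | rfl | hy)
      exacts [hx k, hSU k (hgS _ _), ih y hy]
  refine ⟨f, fun n => hgS _ _, fun n i hi => ?_, fun n i hi => ?_⟩
  · exact hg n (st n) (hU n) _ (hmono (Nat.succ_le_of_lt hi)
      (by rw [Nat.succ_eq_add_one, hst]; simp))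
  · exact hg n (st n) (hU n) _ (hmono (Nat.succ_le_of_lt hi)
      (by rw [Nat.succ_eq_add_one, hst]; simp))

/-- An increasing sequence of good trees has an upper bound. -/
theorem Good.exists_limit {N B : ℕ → Set P} (hN : Monotone N) (hNc : ∀ n, (N n).Countable)
    (hext : ∀ i j, i ≤ j → Ext (N i) (N j)) (hB : ∀ n, Good (N n) (B n))
    (hle : ∀ i j, i ≤ j → TLE (B i) (B j)) :
    ∃ T, Good (⋃ n, N n) T ∧ ∀ n, TLE (B n) T := by
  -- Intersecting finitely many exhaustive subtrees makes one subtree of `B n` cover all earlier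
  -- trees at once.
  have hC : ∀ n, ∃ C, SSub C (B n) ∧ ∀ k ≤ n, Cov (B k) C := by
    intro n
    have : ∀ j, ∃ C, SSub C (B n) ∧ ∀ k < j, k ≤ n → Cov (B k) C := by
      intro j
      induction j with
      | zero => exact ⟨B n, SSub.refl (hB n).isTree, fun k hk => absurd hk (Nat.not_lt_zero k)⟩
      | succ j ih =>
        obtain ⟨C, hC, hcov⟩ := ih
        by_cases hj : j ≤ n
        · obtain ⟨D, hD, hD'⟩ := hle j n hj
          have hCD := hC.inter (hB n).isTree hD
          have h1 : PSub (C ∩ D) C := (hCD.of_subset ⟨Set.inter_subset_left, hCD.1.2.1,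
            fun ρ hρ ν hν h => hCD.1.2.2 ρ (hC.1.1 hρ) ν hν h⟩ hC.1).pSub (hC.isTree (hB n).isTree)
          have h2 : PSub (C ∩ D) D := (hCD.of_subset ⟨Set.inter_subset_right, hCD.1.2.1,
            fun ρ hρ ν hν h => hCD.1.2.2 ρ (hD.1.1 hρ) ν hν h⟩ hD.1).pSub (hD.isTree (hB n).isTree)
          refine ⟨C ∩ D, hCD, fun k hk hkn => ?_⟩
          rcases Nat.lt_succ_iff_lt_or_eq.1 hk with hk | rfl
          · exact (hcov k hk hkn).mono h1
          · exact hD'.mono h2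
        · refine ⟨C, hC, fun k hk hkn => ?_⟩
          rcases Nat.lt_succ_iff_lt_or_eq.1 hk with hk | rfl
          · exact hcov k hk hkn
          · exact absurd hkn hj
    obtain ⟨C, hC, hcov⟩ := this (n + 1)
    exact ⟨C, hC, fun k hk => hcov k (Nat.lt_succ_of_le hk) hk⟩
  choose C hCB hcov using hC
  have hCt : ∀ n, IsTree (C n) := fun n => (hCB n).isTree (hB n).isTree
  have hbotC : ∀ n, ⊥ ∈ C n := fun n => (hCB n).1.root_mem (isLeast_bot (hB n).bot_mem)
  have hsC : ∀ n, succs (C n) ⊥ ⊆ (⋃ n, N n) \ {⊥} := fun n σ hσ =>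
    ⟨Set.mem_iUnion.2 ⟨n, (hB n).sub ((hCB n).1.1 hσ.1)⟩, hσ.2.1.ne'⟩
  have hesc : ∀ n (F : Finset P), ↑F ⊆ (⋃ n, N n) \ {⊥} →
      ∃ σ ∈ succs (C n) ⊥, ∀ ρ ∈ F, Incompat ρ σ := by
    intro n F hF
    have : ∀ ρ ∈ F, ∃ m, ρ ∈ N m := fun ρ hρ => Set.mem_iUnion.1 (hF hρ).1
    choose! g hg using this
    let m := max n (F.sup g)
    have hFm : ∀ ρ ∈ F, ρ ∈ N m := fun ρ hρ =>
      hN ((Finset.le_sup hρ).trans (le_max_right _ _)) (hg ρ hρ)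
    have := (hB m).infinite_escape (hB n) (hle n m (le_max_left _ _)) F.finite_toSet hFm
      fun ρ hρ => (hF hρ).2
    obtain ⟨σ, ⟨h1, h2⟩, h3⟩ := (this.sdiff ((hCB n).2 ⊥ (hbotC n))).nonempty
    refine ⟨σ, ?_, h2⟩
    rw [(hCB n).1.succs_eq]
    exact ⟨h1, by_contra fun hh => h3 ⟨h1, hh⟩⟩
  have hUne : ((⋃ n, N n) \ {(⊥ : P)}).Nonempty := by
    obtain ⟨σ, hσ, -⟩ := hesc 0 ∅ (by simp)
    exact ⟨σ, hsC 0 hσ⟩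
  obtain ⟨x, hx⟩ := ((Set.countable_iUnion hNc).mono Set.sdiff_subset).exists_eq_range hUne
  obtain ⟨l, hl, hxl, hll⟩ := exists_seq_avoiding x ((⋃ n, N n) \ {(⊥ : P)})
    (fun n => hx ▸ ⟨n, rfl⟩) (fun n => succs (C n) ⊥) hsC Incompat hesc
  -- The limit uses just one cone of each `C n`. Above its root, escape transfers by `Ext`; at `⊥`
  -- it holds because `l n` avoids the first `n` nodes.
  let A : ℕ → Set P := fun n => C n ∩ Set.Ici (l n)
  have hlI : ∀ i j, i ≠ j → Incompat (l i) (l j) := by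
    intro i j hij
    rcases lt_or_gt_of_ne hij with h | h
    · exact hll j i h
    · exact (hll i j h).symm
  have g : Gluable ⊥ A l := ⟨fun n => (hCt n).cone (hl n).1, fun n => isLeast_cone (hl n).1,
    fun n => (hl n).2.1, hlI⟩
  have hT := g.isTree_glue
  refine ⟨glue ⊥ A, ⟨hT, root_mem_glue, fun he => ?_, ?_, ?_, ?_⟩, fun k => ?_⟩
  · have : l 0 ∈ glue ⊥ A := mem_glue (i := 0) ⟨(hl 0).1, le_rfl⟩
    rw [he] at this
    exact (hl 0).2.1.ne' this
  · intro y hy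
    rcases mem_glue_iff.1 hy with rfl | ⟨n, hn⟩
    · exact Set.mem_iUnion.2 ⟨0, (hB 0).sub (hB 0).bot_mem⟩
    · exact Set.mem_iUnion.2 ⟨n, (hB n).sub ((hCB n).1.1 hn.1)⟩
  · exact g.incompatOn_glue fun n => (hB n).incompat.mono
      (Set.inter_subset_left.trans (hCB n).1.1)
  · intro ν hν
    rcases mem_glue_iff.1 hν with rfl | ⟨n, hn⟩
    · rw [g.succs_root]
      intro ρ hρ hle
      have : ρ ∈ (⋃ n, N n) \ {(⊥ : P)} := ⟨hρ, fun he => hle (le_bot_iff.2 he)⟩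
      rw [hx] at this
      obtain ⟨i, rfl⟩ := this
      refine ((Set.finite_Iic i).image l).subset ?_
      rintro _ ⟨⟨n, rfl⟩, h2⟩
      exact ⟨n, le_of_not_gt fun hin => h2 (hxl n i hin), rfl⟩
    · rw [g.succs_eq hn, succs_cone hn.2, (hCB n).1.succs_eq]
      have hνB := (hCB n).1.1 hn.1
      exact ((Ext.iUnion hN hext n).esc ((hB n).sub hνB) (g.root_lt hn).ne'
        (fun σ hσ => (hB n).sub hσ.1) (fun σ hσ => hσ.2.1.le) ((hB n).esc ν hνB)).mono
          Set.inter_subset_left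
  -- Dropping the first `k` cones removes finitely many successors of the root, and every remaining
  -- cone comes from a `C n` covering `B k`.
  · have hD : SSub {y | y ∈ glue ⊥ A ∧ ∀ n < k, y ∉ A n} (glue ⊥ A) := by
      refine ⟨⟨fun y hy => hy.1, ⟨⊥, root_mem_glue, fun n _ hn =>
        (g.root_lt hn).ne rfl⟩, fun ρ hρ ν hν hle => ⟨hρ, fun n hn hρn =>
          hν.2 n hn (g.mem_of_le hρn hν.1 hle)⟩⟩, fun ν hν => ?_⟩
      refine ((Set.finite_Iio k).image l).subset ?_
      rintro σ ⟨h1, h2⟩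
      have : ∃ n < k, σ ∈ A n := by
        by_contra! hcon
        exact h2 ⟨h1.1, hcon⟩
      obtain ⟨n, hn, hσ⟩ := this
      have hν0 : ν = ⊥ := by
        by_contra hne
        exact hν.2 n hn (g.mem_of_ge hν.1 hσ h1.2.1.le hne)
      subst hν0
      rw [g.succs_root] at h1
      obtain ⟨i, rfl⟩ := h1
      refine ⟨n, hn, ?_⟩
      by_contra hne
      exact (hlI n i fun he => hne (he ▸ rfl)).not_le hσ.2
    refine ⟨_, hD, fun z hz => ?_⟩
    rw [(hD.pSub hT).maxNodes_eq, g.maxNodes_eq] at hz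
    obtain ⟨hz, hzD⟩ := hz
    obtain ⟨n, hzn⟩ := Set.mem_iUnion.1 hz
    have hkn : k ≤ n := le_of_not_gt fun hlt => hzD.2 n hlt hzn.1
    have hzA : z ∈ A n := hzn.1
    change z ∈ maxNodes (C n ∩ Set.Ici (l n)) at hzn
    rw [maxNodes_cone] at hzn
    obtain ⟨η, h1, h2, h3⟩ := hcov n k hkn z hzn.1
    refine ⟨η, h1, h2, fun ρ hρ hle => hD.1.2.2 ρ ?_ z hzD (hle.trans h2)⟩
    have hρC := h3 ρ hρ hle
    rcases eq_or_ne ρ ⊥ with rfl | hne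
    · exact root_mem_glue
    · exact mem_glue (i := n) ⟨hρC, (hCt n).succ_le_of_lt (hl n) hρC hzn.1.1
        (bot_lt_iff_ne_bot.2 hne) hzA.2 (hle.trans h2)⟩

/-- A countable set of nodes together with a good tree. -/
structure Cond (P : Type*) [PartialOrder P] [OrderBot P] where
  N : Set P
  B : Set P
  countable : N.Countable
  good : Good N B
  star : ∀ η ∈ N, η ≠ ⊥ → HasStar N η

instance : Preorder (Cond P) where
  le p q := p.N ⊆ q.N ∧ Ext p.N q.N ∧ TLE p.B q.B
  le_refl p := ⟨subset_rfl, Ext.refl _, TLE.refl p.good.isTree⟩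
  le_trans p q r h₁ h₂ := ⟨h₁.1.trans h₂.1, h₁.2.1.trans h₂.2.1 h₁.1,
    h₁.2.2.trans q.good.isTree r.good.isTree h₂.2.2⟩

/-- `C` covers `B`, and the colouring `γ` of the maximal nodes of `B` in `C` is induced by a front
of `C`. -/
def Canon {α β : Type*} [PartialOrder α] (B : Set α) (γ : α → β) (C : Set α) : Prop :=
  Cov B C ∧ ∃ Y, IsFront C Y ∧ (∀ y ∈ Y, ∃ w ∈ maxNodes (C ∩ B), y ≤ w) ∧
    ∀ w ∈ maxNodes (C ∩ B), ∀ w' ∈ maxNodes (C ∩ B), (γ w = γ w' ↔ ∃ y ∈ Y, y ≤ w ∧ y ≤ w')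

/-- `q` extends `p` by a fresh level and fulfills the task `t` if it makes sense for `p`. -/
def Fulfills (t : (ℕ → P) × (ℕ → ℕ)) (p q : Cond P) : Prop :=
  p ≤ q ∧ (∀ x ∈ succs q.B ⊥, x ∉ p.N) ∧ (IsTree (Set.range t.1) → TLE (Set.range t.1) p.B →
    ∀ γ : P → ℕ, (∀ k, γ (t.1 k) = t.2 k) → Canon (Set.range t.1) γ q.B)

theorem Fulfills.mono {t : (ℕ → P) × (ℕ → ℕ)} {p p' q : Cond P} (hp : p ≤ p')
    (h : Fulfills t p' q) : Fulfills t p q :=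
  ⟨hp.trans h.1, fun x hx hxp => h.2.1 x hx (hp.1 hxp), fun h1 h2 =>
    h.2.2 h1 (h2.trans p.good.isTree p'.good.isTree hp.2.2)⟩

/-- In the exhaustive subtree `E` covering `B`, the maximal nodes of `B` form a front, so
`exists_canonical` applies to it. A positive subtree of `E` is positive in `T`. -/
theorem Good.exists_canon {N T B : Set P} (h : Good N T) (hB : IsTree B) (hBT : TLE B T)
    (γ : P → ℕ) : ∃ T', PSub T' T ∧ Canon B γ T' := by
  obtain ⟨E, hE, hcov⟩ := hBT
  have hEt := hE.isTree h.isTree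
  have hW : IsFront E (maxNodes B ∩ E) := by
    refine hEt.isFront_iff.2 ⟨Set.inter_subset_right, fun x hx y hy hne hle =>
      hne (eq_of_max_le hx.1 hy.1.1 hle), fun z hz => ?_⟩
    obtain ⟨η, h1, h2, h3⟩ := hcov z hz
    exact ⟨η, ⟨h1, h3 η h1.1 le_rfl⟩, h2⟩
  obtain ⟨T', hT', Y, hY, h1, h2⟩ := exists_canonical hEt hW γ
  have hT'T := hT'.trans (hE.pSub h.isTree)
  have hc := hcov.mono hT'
  have hmax : maxNodes (T' ∩ B) = maxNodes B ∩ E ∩ T' := by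
    rw [(hc.pSub (hT'.isTree hEt) hB).maxNodes_eq]
    ext x
    exact ⟨fun hx => ⟨⟨hx.1, hT'.1.1 hx.2.1⟩, hx.2.1⟩, fun hx => ⟨hx.1.1, hx.2, hx.1.1.1⟩⟩
  refine ⟨T', hT'T, hc, Y, hY, ?_, ?_⟩
  · rwa [hmax]
  · rwa [hmax]

/-- Canonicity depends on maximal nodes and the front below them, so it survives inserting lumps,
which creates no new maximal nodes. -/
theorem Canon.of_cov {α β : Type*} [PartialOrder α] {B C D : Set α} {γ : α → β} (hB : IsTree B)
    (hC : IsTree C) (hD : IsTree D) (h : Canon B γ C) (hCD : C ⊆ D)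
    (hm : maxNodes D ⊆ maxNodes C) : Canon B γ D := by
  obtain ⟨hcov, Y, hY, h1, h2⟩ := h
  have hcov' : Cov B D := fun z hz => by
    obtain ⟨η, h3, h4, h5⟩ := hcov z (hm hz)
    exact ⟨η, h3, h4, fun ρ hρ hle => hCD (h5 ρ hρ hle)⟩
  have hmax : maxNodes (D ∩ B) = maxNodes (C ∩ B) := by
    rw [(hcov.pSub hC hB).maxNodes_eq, (hcov'.pSub hD hB).maxNodes_eq]
    ext x
    refine ⟨fun ⟨hx, hxD⟩ => ⟨hx, ?_, hx.1⟩, fun hx => ⟨hx.1, hCD hx.2.1, hx.1.1⟩⟩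
    obtain ⟨z, hz, hle⟩ := hD.exists_max_ge hxD.1
    obtain ⟨η, h3, h4, h5⟩ := hcov z (hm hz)
    have hηC := h5 η h3.1 le_rfl
    rcases hD.le_or_le hxD.1 (hCD hηC) hz.1 hle h4 with h' | h'
    · exact eq_of_max_le hx h3.1 h' ▸ hηC
    · exact eq_of_max_le h3 hx.1 h' ▸ hηC
  obtain ⟨h6, h7, h8⟩ := hC.isFront_iff.1 hY
  exact ⟨hcov', Y, hD.isFront_iff.2 ⟨h6.trans hCD, h7, fun z hz => h8 z (hm hz)⟩,
    hmax ▸ h1, hmax ▸ h2⟩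

theorem Cond.exists_fulfills (hP : HasLumps P) (q : ℕ → Cond P) (hq : Monotone q)
    (t : (ℕ → P) × (ℕ → ℕ)) : ∃ r, ∀ n, Fulfills t (q n) r := by
  have hN : Monotone fun n => (q n).N := fun i j hij => (hq hij).1
  have hE : ∀ i j, i ≤ j → Ext (q i).N (q j).N := fun i j hij => (hq hij).2.1
  obtain ⟨T, hT, hqT⟩ := Good.exists_limit hN (fun n => (q n).countable) hE
    (fun n => (q n).good) fun i j hij => (hq hij).2.2
  have hT' : ∃ T', PSub T' T ∧ (IsTree (Set.range t.1) → ∀ n, TLE (Set.range t.1) (q n).B →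
      ∀ γ : P → ℕ, (∀ k, γ (t.1 k) = t.2 k) → Canon (Set.range t.1) γ T') := by
    -- A task may be meaningless: its range need not be a tree below the sequence, and the listed
    -- colours may conflict at repeated nodes. Then no thinning is needed.
    by_cases hcase : IsTree (Set.range t.1) ∧ (∃ n, TLE (Set.range t.1) (q n).B) ∧
      ∃ γ : P → ℕ, ∀ k, γ (t.1 k) = t.2 k
    · obtain ⟨h1, ⟨n, hn⟩, γ, hγ⟩ := hcase
      obtain ⟨T', h2, h3, Y, h4, h5, h6⟩ := hT.exists_canon h1
        (hn.trans (q n).good.isTree hT.isTree (hqT n)) γ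
      refine ⟨T', h2, fun _ _ _ γ' hγ' => ⟨h3, Y, h4, h5, fun w hw w' hw' => ?_⟩⟩
      rw [← h6 w hw w' hw']
      obtain ⟨k, rfl⟩ := hw.1.2
      obtain ⟨k', rfl⟩ := hw'.1.2
      rw [hγ, hγ, hγ', hγ']
    · exact ⟨T, PSub.refl hT.isTree, fun h1 n h2 γ h3 => absurd ⟨h1, ⟨n, h2⟩, γ, h3⟩ hcase⟩
  obtain ⟨T', hT'T, hcanon⟩ := hT'
  have hgood := hT.of_pSub hT'T
  have hNc : (⋃ n, (q n).N).Countable := Set.countable_iUnion fun n => (q n).countable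
  obtain ⟨N', B', h1, h2, h3, h4, h5, h6, h7, h8, h9⟩ := hgood.exists_lump hP hNc
  have hsub : ∀ n, (q n).N ⊆ ⋃ n, (q n).N := fun n =>
    Set.subset_iUnion (fun n => (q n).N) n
  have hext : ∀ n, Ext (q n).N N' := fun n => (Ext.iUnion hN hE n).trans h4 (hsub n)
  refine ⟨⟨N', B', h2, h3, fun η hη hne => ?_⟩, fun n => ⟨⟨(hsub n).trans h1, hext n, ?_⟩,
    fun x hx hxn => h8 x hx (hsub n hxn), fun h10 h11 γ hγ => ?_⟩⟩
  · by_cases hηN : η ∈ ⋃ n, (q n).N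
    · obtain ⟨n, hn⟩ := Set.mem_iUnion.1 hηN
      exact (hext n).hasStar ((hsub n).trans h1) hn hne ((q n).star η hn hne)
    · exact h9 η hη hηN
  · exact ((hqT n).trans hT.isTree hgood.isTree (hT'T.tle hT.isTree)).trans hgood.isTree h3.isTree
      (h5.tle h3.isTree)
  · exact (hcanon h10 n h11 γ hγ).of_cov h10 hgood.isTree h3.isTree h6 h7

end Conditions

/-! ### Bookkeeping and recursion of length `ω₁`. -/

section Chain

open Cardinal in
/-- A well-order of type `ω₁` in which every task occurs cofinally often. -/
theorem exists_tasks {T : Type} (hT : #T = ℵ₁) :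
    ∃ (J : Type) (_ : LinearOrder J) (_ : WellFoundedLT J) (task : J → T),
      (∀ j : J, (Set.Iio j).Countable) ∧
      ∀ S : Set J, S.Countable → ∀ t, ∃ j, task j = t ∧ ∀ i ∈ S, i < j := by
  let J := (ℵ₁ : Cardinal.{0}).ord.ToType
  have hJ : #J = ℵ₁ := mk_ord_toType _
  have hcount : ∀ j : J, (Set.Iio j).Countable := fun j => by
    rw [← le_aleph0_iff_set_countable, ← Order.lt_succ_iff, succ_aleph0]
    exact (mk_Iio_lt j (by simp [J])).trans_eq hJ
  have hTJ : #(T × J) = #J := by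
    rw [mk_prod, lift_id, lift_id, hT, hJ]
    exact mul_eq_self (aleph0_le_aleph 1)
  -- The first coordinate of `e.symm` is the task; each task then occurs at uncountably many
  -- positions, hence beyond any countable set.
  obtain ⟨e⟩ := Cardinal.eq.1 hTJ
  refine ⟨J, inferInstance, inferInstance, fun j => (e.symm j).1, hcount, fun S hS t => ?_⟩
  have h1 : (⋃ i ∈ S, Set.Iic i).Countable := hS.biUnion fun i _ => by
    rw [← Set.Iio_insert]
    exact (hcount i).insert i
  have h2 : ¬ (Set.range fun k : J => e (t, k)).Countable := by
    rw [← le_aleph0_iff_set_countable, mk_range_eq _ fun a b h => (Prod.ext_iff.1 (e.injective h)).2,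
      hJ, not_le]
    exact aleph0_lt_aleph_one
  obtain ⟨j, ⟨k, rfl⟩, hj⟩ := Set.not_subset.1 fun h => h2 (h1.mono h)
  refine ⟨e (t, k), by simp, fun i hi => ?_⟩
  by_contra hle
  exact hj (Set.mem_iUnion₂.2 ⟨i, hi, not_lt.1 hle⟩)

/-- Initial segments are countable, so the earlier conditions have a cofinal monotone `ℕ`-sequence
and `step` applies. By `hmono`, fulfilling a task over the cofinal terms fulfills it over all
earlier ones. -/
theorem exists_long_chain {T Q J : Type*} [LinearOrder J] [WellFoundedLT J] [Preorder Q] [Nonempty Q]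
    (task : J → T) (hJ : ∀ j : J, (Set.Iio j).Countable) (R : T → Q → Q → Prop)
    (hR : ∀ t p q, R t p q → p ≤ q) (hmono : ∀ t p p' q, p ≤ p' → R t p' q → R t p q)
    (step : ∀ f : ℕ → Q, Monotone f → ∀ t, ∃ q, ∀ n, R t (f n) q) :
    ∃ q : J → Q, ∀ i j, i < j → R (task j) (q i) (q j) := by
  classical
  let F : (j : J) → ((i : J) → i < j → Q) → Q := fun j prev =>
    if h : ∃ x, ∀ i (hi : i < j), R (task j) (prev i hi) x then h.choose else Classical.arbitrary Q
  let q : J → Q := (wellFounded_lt (α := J)).fix F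
  have hq : ∀ j, q j = F j fun i _ => q i := fun j => WellFounded.fix_eq _ _ _
  refine ⟨q, ?_⟩
  suffices h : ∀ j, ∀ i, i < j → R (task j) (q i) (q j) from fun i j => h j i
  intro j
  induction j using (wellFounded_lt (α := J)).induction with
  | _ j ih =>
    have hex : ∃ x, ∀ i (_ : i < j), R (task j) (q i) x := by
      by_cases hne : (Set.Iio j).Nonempty
      · have : Countable (Set.Iio j) := (hJ j).to_subtype
        have : Encodable (Set.Iio j) := Encodable.ofCountable _
        have : Inhabited (Set.Iio j) := ⟨⟨_, hne.some_mem⟩⟩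
        let f : Set.Iio j → Q := fun i => q i
        have hf : Monotone f := fun a b hab => by
          rcases hab.eq_or_lt with rfl | hlt
          · exact le_rfl
          · exact hR _ _ _ (ih b b.2 a hlt)
        have hd : Directed (· ≤ ·) f := hf.directed_le
        obtain ⟨x, hx⟩ := step _ hd.sequence_mono (task j)
        exact ⟨x, fun i hi => hmono _ _ _ _ (hd.le_sequence ⟨i, hi⟩) (hx _)⟩
      · exact ⟨Classical.arbitrary Q, fun i hi => absurd ⟨i, hi⟩ hne⟩
    intro i hi
    have h2 : q j = hex.choose := by
      rw [hq]
      simp only [F, dif_pos hex]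
    rw [h2]
    exact hex.choose_spec i hi

end Chain

/-! ### The ambient order of regions and the initial condition. -/

section Regions

/-- The nonempty sets of finite sequences, ordered by reverse inclusion. -/
abbrev Region := {s : (Set (List ℕ))ᵒᵈ // (OrderDual.ofDual s).Nonempty}

namespace Region

/-- A region as a set. -/
def set (a : Region) : Set (List ℕ) := OrderDual.ofDual a.1

/-- A nonempty set as a region. -/
def mk (s : Set (List ℕ)) (h : s.Nonempty) : Region := ⟨OrderDual.toDual s, h⟩

theorem le_iff {a b : Region} : a ≤ b ↔ b.set ⊆ a.set := Iff.rfl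

theorem incompat_iff {a b : Region} : Incompat a b ↔ ∀ x ∈ a.set, x ∉ b.set := by
  constructor
  · intro h x hx hxb
    refine h ⟨mk {x} ⟨x, rfl⟩, ?_, ?_⟩
    · rw [le_iff]; exact Set.singleton_subset_iff.2 hx
    · rw [le_iff]; exact Set.singleton_subset_iff.2 hxb
  · rintro h ⟨c, h1, h2⟩
    obtain ⟨x, hx⟩ : c.set.Nonempty := c.2
    exact h x (h1 hx) (h2 hx)

instance : OrderBot Region where
  bot := mk Set.univ ⟨[], trivial⟩
  bot_le _ := le_iff.2 (Set.subset_univ _)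

/-- Incompatibility of regions is disjointness, and a set disjoint from every `S k` is disjoint from
their union. -/
theorem hasLumps : HasLumps Region := by
  intro S
  refine ⟨mk (⋃ k, (S k).set) ?_, fun k => le_iff.2 (Set.subset_iUnion (fun k => (S k).set) k),
    fun τ h => ?_⟩
  · obtain ⟨x, hx⟩ : (S 0).set.Nonempty := (S 0).2
    exact ⟨x, Set.mem_iUnion.2 ⟨0, hx⟩⟩
  · rw [incompat_iff]
    intro x hx hxU
    obtain ⟨k, hk⟩ := Set.mem_iUnion.1 hxU
    exact incompat_iff.1 (h k) x hx hk

/-- The extensions of the sequence `t`. -/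
def cone (t : List ℕ) : Region := mk {u | t <+: u} ⟨t, List.prefix_rfl⟩

theorem mem_cone {t u : List ℕ} : u ∈ (cone t).set ↔ t <+: u := Iff.rfl

theorem cone_le_iff {t u : List ℕ} : cone t ≤ cone u ↔ t <+: u :=
  ⟨fun h => h (mem_cone.2 List.prefix_rfl), fun h _ hx => h.trans hx⟩

theorem cone_nil : cone [] = ⊥ := le_bot_iff.1 fun _ _ => mem_cone.2 List.nil_prefix

theorem cone_incompat {t u : List ℕ} (h : ¬ t <+: u) (h' : ¬ u <+: t) :
    Incompat (cone t) (cone u) := by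
  rw [incompat_iff]
  intro x hx hxu
  rcases List.prefix_or_prefix_of_prefix hx hxu with h1 | h1
  exacts [h h1, h' h1]

theorem append_prefix {t u : List ℕ} {k l : ℕ} (h : t ++ [k] <+: u) (h' : t ++ [l] <+: u) :
    k = l := by
  have := List.prefix_of_prefix_length_le h h' (by simp)
  have := this.eq_of_length (by simp)
  simpa using this

theorem cone_child_incompat (t : List ℕ) {k l : ℕ} (h : k ≠ l) :
    Incompat (cone (t ++ [k])) (cone (t ++ [l])) := by
  rw [incompat_iff]
  exact fun x hx hxl => h (append_prefix hx hxl)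

theorem cone_lt_child (t : List ℕ) (k : ℕ) : cone t < cone (t ++ [k]) := by
  refine lt_of_le_not_ge (cone_le_iff.2 (List.prefix_append _ _)) fun h => ?_
  have := (cone_le_iff.1 h).length_le
  simp at this

theorem cone_esc (t : List ℕ) :
    Esc (Set.range cone) (cone t) (Set.range fun k => cone (t ++ [k])) := by
  rintro _ ⟨u, rfl⟩ hle
  rw [cone_le_iff] at hle
  refine Set.Subsingleton.finite ?_
  have key : ∀ k, ¬ Incompat (cone u) (cone (t ++ [k])) → t ++ [k] <+: u := by
    intro k hk
    by_contra hcon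
    refine hk (cone_incompat (fun h => ?_) hcon)
    rcases List.prefix_concat_iff.1 h with h | h
    · exact hcon (h ▸ List.prefix_rfl)
    · exact hle h
  rintro _ ⟨⟨k, rfl⟩, hk⟩ _ ⟨⟨l, rfl⟩, hl⟩
  simp only [append_prefix (key k hk) (key l hl)]

/-- The starting nodes are the cones of finite sequences, with the tree of height one formed by `⊥`
and the cones `cone [k]`. Immediate extensions of a sequence witness `HasStar`. -/
theorem nonempty_cond : Nonempty (Cond Region) := by
  have g : Gluable (⊥ : Region) (fun k : ℕ => ({cone [k]} : Set Region)) (fun k => cone [k]) :=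
    ⟨fun k => IsTree.singleton _, fun k => isLeast_singleton, fun k => cone_nil ▸ cone_lt_child [] k,
      fun i j hij => cone_child_incompat [] hij⟩
  refine ⟨⟨Set.range cone, glue ⊥ fun k : ℕ => {cone [k]}, Set.countable_range _,
    ⟨g.isTree_glue, root_mem_glue, fun he => ?_, ?_, ?_, ?_⟩, ?_⟩⟩
  · have : cone [0] ∈ glue (⊥ : Region) fun k : ℕ => {cone [k]} := mem_glue (i := 0) rfl
    rw [he] at this
    exact (g.lt 0).ne' this
  · intro x hx
    rcases mem_glue_iff.1 hx with rfl | ⟨k, rfl⟩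
    · exact ⟨[], cone_nil⟩
    · exact ⟨[k], rfl⟩
  · exact g.incompatOn_glue fun k => IncompatOn.singleton _
  · intro ν hν
    rcases mem_glue_iff.1 hν with rfl | ⟨k, hk⟩
    · rw [g.succs_root, ← cone_nil]
      exact cone_esc []
    · rw [g.succs_eq hk, succs_eq_empty_of_max]
      · exact Esc.empty
      · rwa [maxNodes_singleton]
  · rintro _ ⟨t, rfl⟩ -
    exact ⟨fun k => cone (t ++ [k]), fun k => ⟨⟨_, rfl⟩, cone_lt_child t k⟩,
      fun i j hij => cone_child_incompat t hij, cone_esc t⟩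

open Cardinal in
-- The only place where CH is applied: there are `𝔠` countable sequences of regions and colours, so
-- `ω₁` steps can list them all.
theorem mk_tasks (CH : continuum.{0} = aleph.{0} 1) : #((ℕ → Region) × (ℕ → ℕ)) = ℵ₁ := by
  rw [← CH]
  apply le_antisymm
  · have h1 : #Region ≤ 𝔠 := (mk_set_le _).trans (by
      change #(Set (List ℕ)) ≤ 𝔠
      rw [mk_set, mk_list_eq_mk ℕ]
      simp)
    have h2 : #(ℕ → Region) ≤ 𝔠 := by
      rw [mk_arrow, lift_id, lift_id, mk_nat]
      exact (power_le_power_right h1).trans (by simp)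
    rw [mk_prod, lift_id, lift_id]
    have h3 : #(ℕ → ℕ) ≤ 𝔠 := by simp
    exact (mul_le_mul' h2 h3).trans (by simp)
  · have : #(ℕ → ℕ) = 𝔠 := by simp
    rw [← this, mk_prod, lift_id, lift_id]
    have h : #(ℕ → Region) ≠ 0 := mk_ne_zero_iff.2 ⟨fun _ => ⊥⟩
    exact le_mul_of_one_le_left' (Cardinal.one_le_iff_ne_zero.2 h)

end Region

end Regions

/-! ### Invariance under order embeddings. -/

section Image

variable {α β : Type*} [PartialOrder α] [PartialOrder β] (f : α ↪o β) {B C Y : Set α} {ν : α}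

theorem succs_image : succs (f '' B) (f ν) = f '' succs B ν := by
  ext σ
  constructor
  · rintro ⟨⟨x, hx, rfl⟩, h2, h3⟩
    exact ⟨x, ⟨hx, f.lt_iff_lt.1 h2, fun ⟨τ, hτ, h4, h5⟩ => h3 ⟨f τ, ⟨τ, hτ, rfl⟩,
      f.lt_iff_lt.2 h4, f.lt_iff_lt.2 h5⟩⟩, rfl⟩
  · rintro ⟨x, ⟨h1, h2, h3⟩, rfl⟩
    refine ⟨⟨x, h1, rfl⟩, f.lt_iff_lt.2 h2, ?_⟩
    rintro ⟨_, ⟨τ, hτ, rfl⟩, h4, h5⟩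
    exact h3 ⟨τ, hτ, f.lt_iff_lt.1 h4, f.lt_iff_lt.1 h5⟩

theorem maxNodes_image : maxNodes (f '' B) = f '' maxNodes B := by
  ext σ
  constructor
  · rintro ⟨⟨x, hx, rfl⟩, h2⟩
    exact ⟨x, ⟨hx, fun y hy hlt => h2 (f y) ⟨y, hy, rfl⟩ (f.lt_iff_lt.2 hlt)⟩, rfl⟩
  · rintro ⟨x, ⟨h1, h2⟩, rfl⟩
    refine ⟨⟨x, h1, rfl⟩, ?_⟩
    rintro _ ⟨y, hy, rfl⟩ hlt
    exact h2 y hy (f.lt_iff_lt.1 hlt)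

theorem isLeast_image_iff {r : α} : IsLeast (f '' B) (f r) ↔ IsLeast B r := by
  simp only [IsLeast, lowerBounds, Set.mem_image, Set.mem_ofPred_eq, f.injective.eq_iff,
    exists_eq_right, forall_exists_index, and_imp, forall_apply_eq_imp_iff₂, f.le_iff_le]

theorem pred_image : {ρ | ρ ∈ f '' B ∧ ρ < f ν} = f '' {ρ | ρ ∈ B ∧ ρ < ν} := by
  ext x
  constructor
  · rintro ⟨⟨y, hy, rfl⟩, h⟩
    exact ⟨y, ⟨hy, f.lt_iff_lt.1 h⟩, rfl⟩
  · rintro ⟨y, ⟨hy, h⟩, rfl⟩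
    exact ⟨⟨y, hy, rfl⟩, f.lt_iff_lt.2 h⟩

theorem isTree_image_iff : IsTree (f '' B) ↔ IsTree B := by
  constructor
  · intro h
    refine ⟨?_, ?_, fun ν hν => ?_, fun ν hν => ?_, ?_, fun ν hν => ?_⟩
    · exact Set.countable_of_injective_of_countable_image f.injective.injOn h.countable
    · obtain ⟨_, h1, h2⟩ := h.exists_root
      obtain ⟨r, hr, rfl⟩ := h1
      exact ⟨r, (isLeast_image_iff f).1 ⟨⟨r, hr, rfl⟩, h2⟩⟩
    · intro x hx y hy hne
      have := h.le_or_le (z := f ν) ⟨x, hx.1, rfl⟩ ⟨y, hy.1, rfl⟩ ⟨ν, hν, rfl⟩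
        (f.le_iff_le.2 hx.2.le) (f.le_iff_le.2 hy.2.le)
      simpa using this
    · have := h.finite_below (f ν) ⟨ν, hν, rfl⟩
      rw [pred_image] at this
      exact this.of_finite_image f.injective.injOn
    · rintro ⟨g, hg, hgB⟩
      exact h.no_omega_branch ⟨f ∘ g, f.strictMono.comp hg, fun n => ⟨g n, hgB n, rfl⟩⟩
    · have := h.succs_infinite (f ν) ⟨ν, hν, rfl⟩
      rw [succs_image, Set.image_eq_empty] at this
      exact this.imp_right fun h => h.of_image f
  · intro h
    refine ⟨h.countable.image f, ?_, ?_, ?_, ?_, ?_⟩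
    · obtain ⟨r, hr⟩ := h.exists_root
      exact ⟨f r, (isLeast_image_iff f).2 hr⟩
    · rintro _ ⟨ν, hν, rfl⟩ _ ⟨⟨x, hx, rfl⟩, hlt⟩ _ ⟨⟨y, hy, rfl⟩, hlt'⟩ -
      simpa using h.le_or_le hx hy hν (f.le_iff_le.1 hlt.le) (f.le_iff_le.1 hlt'.le)
    · rintro _ ⟨ν, hν, rfl⟩
      rw [pred_image]
      exact (h.finite_below ν hν).image f
    · rintro ⟨g, hg, hgB⟩
      choose g' h1 h2 using hgB
      refine h.no_omega_branch ⟨g', fun a b hab => ?_, h1⟩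
      rw [← f.lt_iff_lt, h2, h2]
      exact hg hab
    · rintro _ ⟨ν, hν, rfl⟩
      rw [succs_image, Set.image_eq_empty]
      exact (h.succs_infinite ν hν).imp_right fun h => h.image f.injective.injOn

theorem lower_image_iff : Lower (f '' B) (f '' C) ↔ Lower B C := by
  simp only [Lower, Set.image_subset_image_iff f.injective, Set.image_nonempty, Set.forall_mem_image,
    f.le_iff_le, f.injective.mem_set_image]

theorem sSub_image_iff : SSub (f '' B) (f '' C) ↔ SSub B C := by
  simp only [SSub, lower_image_iff, Set.forall_mem_image, succs_image,
    ← Set.image_sdiff f.injective, Set.finite_image_iff f.injective.injOn]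

theorem cov_image_iff : Cov (f '' B) (f '' C) ↔ Cov B C := by
  simp only [Cov, maxNodes_image, Set.forall_mem_image, Set.exists_mem_image, f.le_iff_le,
    f.injective.mem_set_image]

theorem tle_image_iff : TLE (f '' B) (f '' C) ↔ TLE B C := by
  constructor
  · rintro ⟨D, hD, hBD⟩
    obtain ⟨D, -, rfl⟩ := Set.subset_image_iff.1 hD.1.1
    exact ⟨D, (sSub_image_iff f).1 hD, (cov_image_iff f).1 hBD⟩
  · rintro ⟨D, hD, hBD⟩
    exact ⟨f '' D, (sSub_image_iff f).2 hD, (cov_image_iff f).2 hBD⟩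

theorem Canon.of_image {γ : β → ℕ} (hC : IsTree C) (h : Canon (f '' B) γ (f '' C)) :
    Canon B (γ ∘ f) C := by
  obtain ⟨h1, Y, hY, h2, h3⟩ := h
  obtain ⟨h4, h5, h6⟩ := ((isTree_image_iff f).2 hC).isFront_iff.1 hY
  obtain ⟨Y, hYC, rfl⟩ := Set.subset_image_iff.1 h4
  rw [← Set.image_inter f.injective, maxNodes_image] at h2 h3
  simp only [maxNodes_image, Set.forall_mem_image, Set.exists_mem_image, f.le_iff_le] at h2 h3 h6
  refine ⟨(cov_image_iff f).1 h1, Y, hC.isFront_iff.2 ⟨hYC, fun x hx y hy hne hle => ?_, h6⟩, h2, h3⟩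
  exact h5 ⟨x, hx, rfl⟩ ⟨y, hy, rfl⟩ (fun he => hne (f.injective he)) (f.le_iff_le.2 hle)

/-- Only this direction holds in general, as the suborder may miss common upper bounds. It suffices
because incompatibility is first arranged among all regions. -/
theorem Incompat.of_map {a b : α} (h : Incompat (f a) (f b)) : Incompat a b :=
  fun ⟨c, h1, h2⟩ => h ⟨f c, f.le_iff_le.2 h1, f.le_iff_le.2 h2⟩

end Image

/-! ### The generic sequence and its existence. -/

/-- A `≼`-increasing sequence `B` of trees, indexed by a linear order all of whose countable
subsets are bounded, that eventually decides every colouring. -/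
structure Generic (M J : Type) [PartialOrder M] [OrderBot M] [LinearOrder J] where
  B : J → Set M
  bounded : ∀ S : Set J, S.Countable → ∃ j, ∀ i ∈ S, i < j
  isCWT : ∀ j, IsCWT (B j)
  bot_mem : ∀ j, ⊥ ∈ B j
  ne : ∀ j, B j ≠ {⊥}
  tle : ∀ i j, i < j → TLE (B i) (B j)
  fresh : ∀ S : Set M, S.Countable → ∃ i, ∀ j, i < j → ∀ x ∈ succs (B j) ⊥, x ∉ S
  canon : ∀ C i, IsTree C → TLE C (B i) → ∀ (c : M → ℕ) (k : J), ∃ j, k < j ∧ Canon C c (B j)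
  exists_tree : ∀ η : M, η ≠ ⊥ → ∃ C, IsCWT C ∧ IsLeast C η ∧ C ≠ {η}

theorem exists_generic (CH : Cardinal.continuum.{0} = Cardinal.aleph.{0} 1) :
    ∃ (M J : Type) (_ : PartialOrder M) (_ : OrderBot M) (_ : LinearOrder J),
      Nonempty (Generic M J) := by
  obtain ⟨J, hJl, hJw, task, hJc, htask⟩ := exists_tasks (Region.mk_tasks CH)
  have hne := Region.nonempty_cond
  obtain ⟨q, hq⟩ := exists_long_chain task hJc Fulfills (fun t p q h => h.1)
    (fun t p p' q hp h => h.mono hp) (fun f hf t => Cond.exists_fulfills Region.hasLumps f hf t)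
  have hbdd : ∀ S : Set J, S.Countable → ∃ j, ∀ i ∈ S, i < j := fun S hS =>
    (htask S hS (fun _ => ⊥, fun _ => 0)).imp fun j h => h.2
  obtain ⟨j0, -⟩ := hbdd ∅ Set.countable_empty
  let U : Set Region := ⋃ j, (q j).N
  have hBU : ∀ j, (q j).B ⊆ U := fun j => (q j).good.sub.trans (Set.subset_iUnion (fun j => (q j).N) j)
  have hmono : Monotone q := fun i j hij => by
    rcases hij.eq_or_lt with rfl | hlt
    · exact le_rfl
    · exact (hq i j hlt).1
  -- Any countable subset of `M` lies in one stage `(q j).N`, so countable objects over `M` are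
  -- treated by the construction.
  let M := {p : Region // p ∈ U}
  let bot : OrderBot M :=
    { bot := ⟨⊥, hBU j0 (q j0).good.bot_mem⟩
      bot_le := fun a => (bot_le : ⊥ ≤ a.1) }
  let f : M ↪o Region := OrderEmbedding.subtype _
  have hfbot : f ⊥ = ⊥ := rfl
  have hUN : ∀ (S : Set M), S.Countable → ∀ k, ∃ j, k < j ∧ f '' S ⊆ (q j).N := by
    intro S hS k
    have : ∀ x : M, ∃ j, x.1 ∈ (q j).N := fun x => Set.mem_iUnion.1 x.2
    choose g hg using this
    obtain ⟨j, hj⟩ := hbdd (insert k (g '' S)) ((hS.image g).insert k)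
    refine ⟨j, hj k (Set.mem_insert _ _), ?_⟩
    rintro _ ⟨x, hx, rfl⟩
    exact (hmono (hj _ (Set.mem_insert_of_mem _ ⟨x, hx, rfl⟩)).le).1 (hg x)
  have hlift : ∀ j, ∃ B : Set M, f '' B = (q j).B := fun j =>
    ⟨f ⁻¹' (q j).B, Set.image_preimage_eq_of_subset fun x hx => ⟨⟨x, hBU j hx⟩, rfl⟩⟩
  choose B hB using hlift
  have hmemB : ∀ j x, f x ∈ (q j).B ↔ x ∈ B j := fun j x => by
    rw [← hB j, f.injective.mem_set_image]
  have hBt : ∀ j, IsTree (B j) := fun j => by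
    rw [← isTree_image_iff f, hB]
    exact (q j).good.isTree
  have hsuccs : ∀ j ν, succs (q j).B (f ν) = f '' succs (B j) ν := fun j ν => by
    rw [← succs_image, hB]
  have hBcwt : ∀ j, IsCWT (B j) := by
    intro j
    refine (hBt j).isCWT (fun x hx y hy h1 h2 => Incompat.of_map f ((q j).good.incompat _
      ((hmemB j x).2 hx) _ ((hmemB j y).2 hy) (mt f.le_iff_le.1 h1) (mt f.le_iff_le.1 h2)))
      fun ν hν hm F hF hFν => ?_
    obtain ⟨k, hjk, hFk⟩ := hUN F hF.countable j
    have hle := hmono hjk.le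
    have hνB := (hmemB j ν).2 hν
    have hFν' : ∀ ρ ∈ f '' F, ¬ ρ ≤ f ν := by
      rintro _ ⟨ρ, hρ, rfl⟩ h
      exact hFν ρ hρ (f.le_iff_le.1 h)
    -- Take a later stage `k` containing `F`. At the root the tree of stage `k` covers `(q j).B` and
    -- lends it its escape; at other nodes `Ext` carries strong escape up to stage `k`.
    have key : {σ | σ ∈ succs (q j).B (f ν) ∧ ∀ ρ ∈ f '' F, Incompat ρ σ}.Infinite := by
      rcases eq_or_ne ν ⊥ with rfl | hne
      · exact (q k).good.infinite_escape (q j).good hle.2.2 (hF.image f) hFk fun ρ hρ he =>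
          hFν' ρ hρ (he ▸ bot_le)
      · refine (hle.2.1.esc ((q j).good.sub hνB) (fun he => hne (f.injective he))
          (fun σ hσ => (q j).good.sub hσ.1) (fun σ hσ => hσ.2.1.le)
          ((q j).good.esc _ hνB)).infinite ?_ (hF.image f) hFk hFν'
        rw [hsuccs]
        exact ((hBt j).succs_infinite_of_not_max hν hm).image f.injective.injOn
    rw [hsuccs] at key
    refine Set.Infinite.of_image f (key.mono ?_)
    rintro _ ⟨⟨σ, hσ, rfl⟩, h⟩
    exact ⟨σ, ⟨hσ, fun ρ hρ => Incompat.of_map f (h _ ⟨ρ, hρ, rfl⟩)⟩, rfl⟩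
  refine ⟨M, J, inferInstance, bot, hJl, ⟨⟨B, hbdd, hBcwt, fun j => ?_, fun j he => ?_,
    fun i j hij => ?_, fun S hS => ?_, fun C i hC hCi c k => ?_, fun η hη => ?_⟩⟩⟩
  · rw [← hmemB]
    exact (q j).good.bot_mem
  · refine (q j).good.ne ?_
    rw [← hB, he, Set.image_singleton, hfbot]
  · rw [← tle_image_iff f, hB, hB]
    exact (hmono hij.le).2.2
  · obtain ⟨i, -, hi⟩ := hUN S hS j0
    refine ⟨i, fun j hij x hx hxS => (hq i j hij).2.1 (f x) ?_ (hi ⟨x, hxS, rfl⟩)⟩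
    rw [← hfbot, hsuccs]
    exact ⟨x, hx, rfl⟩
  · have hCt := (isTree_image_iff f).2 hC
    obtain ⟨b, hb⟩ := hCt.countable.exists_eq_range hCt.nonempty
    -- The value `0` off the range of `f` is irrelevant, since only nodes of the tree are coloured.
    let γ : Region → ℕ := Function.extend f c 0
    obtain ⟨j, hj, hij⟩ := htask {i, k} (Set.toFinite _).countable (b, γ ∘ b)
    refine ⟨j, hij k (by simp), ?_⟩
    have h := (hq i j (hij i (by simp))).2.2
    rw [hj] at h
    have h2 := h (by rwa [← hb]) (by rwa [← hb, ← hB, tle_image_iff]) γ fun k => rfl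
    simp only at h2
    rw [← hb, ← hB] at h2
    have h3 := h2.of_image f (hBt j)
    rwa [show γ ∘ f = c from Function.extend_comp f.injective c 0] at h3
  · obtain ⟨j, hj⟩ := Set.mem_iUnion.1 η.2
    have hne : f η ≠ ⊥ := fun he => hη (f.injective he)
    obtain ⟨S, hS, hSI, hSe⟩ := (q j).star η.1 hj hne
    let s : ℕ → M := fun k => ⟨S k, Set.mem_iUnion.2 ⟨j, (hS k).1⟩⟩
    have g : Gluable η (fun k : ℕ => ({s k} : Set M)) s := ⟨fun k => IsTree.singleton _,
      fun k => isLeast_singleton, fun k => (hS k).2, fun i j hij => Incompat.of_map f (hSI i j hij)⟩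
    refine ⟨_, g.isTree_glue.isCWT (g.incompatOn_glue fun k => IncompatOn.singleton _) ?_,
      g.isLeast_glue, fun he => ?_⟩
    · intro ν hν hm F hF hFν
      rcases mem_glue_iff.1 hν with rfl | ⟨k, hk⟩
      · rw [g.succs_root]
        obtain ⟨k, hjk, hFk⟩ := hUN F hF.countable j
        have hle := hmono hjk.le
        have hSr : Set.range S = f '' Set.range s := by
          rw [← Set.range_comp]; rfl
        have key := ((hle.2.1.esc hj hne (by rintro _ ⟨k, rfl⟩; exact (hS k).1)
          (by rintro _ ⟨k, rfl⟩; exact (hS k).2.le) hSe).infinite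
          (by
            rw [hSr]
            exact (Set.infinite_range_of_injective g.injective).image f.injective.injOn)
          (hF.image f) hFk (by
            rintro _ ⟨ρ, hρ, rfl⟩ h
            exact hFν ρ hρ (f.le_iff_le.1 h)))
        rw [hSr] at key
        refine Set.Infinite.of_image f (key.mono ?_)
        rintro _ ⟨⟨σ, hσ, rfl⟩, h⟩
        exact ⟨σ, ⟨hσ, fun ρ hρ => Incompat.of_map f (h _ ⟨ρ, hρ, rfl⟩)⟩, rfl⟩
      · refine absurd ?_ hm
        rw [g.maxNodes_eq]
        exact Set.mem_iUnion.2 ⟨k, by rwa [maxNodes_singleton]⟩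
    · have : s 0 ∈ glue η fun k : ℕ => ({s k} : Set M) := mem_glue (i := 0) rfl
      rw [he] at this
      exact (g.lt 0).ne' this

theorem bot_notMem_front {M : Type*} [PartialOrder M] [OrderBot M] {B Y : Set M}
    (hY : IsFront B Y) (hne : Y ≠ {⊥}) : ⊥ ∉ Y := fun h =>
  hne (Set.eq_singleton_iff_unique_mem.2 ⟨h, fun _ hx => (hY.2.2.eq h hx bot_le).symm⟩)

namespace Generic

/-! ### The system determined by a generic sequence. -/

section System

variable {M J : Type} [PartialOrder M] [OrderBot M] [LinearOrder J] (G : Generic M J)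
  {B C D T Y : Set M}

/-- The nontrivial trees with root `⊥` that lie below the generic sequence. -/
structure Mem (B : Set M) : Prop where
  isCWT : IsCWT B
  bot_mem : ⊥ ∈ B
  ne : B ≠ {⊥}
  exists_tle : ∃ j, TLE B (G.B j)

theorem mem_B (j : J) : G.Mem (G.B j) :=
  ⟨G.isCWT j, G.bot_mem j, G.ne j, j, TLE.refl (G.isCWT j).isTree⟩

namespace Mem

variable {G}

theorem of_tle (hC : G.Mem C) (h₁ : IsCWT B) (h₂ : ⊥ ∈ B) (h₃ : B ≠ {⊥}) (hle : TLE B C) :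
    G.Mem B := by
  obtain ⟨j, hj⟩ := hC.exists_tle
  exact ⟨h₁, h₂, h₃, j, hle.trans hC.isCWT.isTree (G.isCWT j).isTree hj⟩

variable (h : G.Mem B)
include h

theorem isTree : IsTree B := h.isCWT.isTree

theorem not_max : ⊥ ∉ maxNodes B := not_max_of_ne_singleton (isLeast_bot h.bot_mem) h.ne

theorem ne_of_pSub (hC : PSub C B) : C ≠ {⊥} := by
  intro he
  have hb : (⊥ : M) ∈ maxNodes C := by rw [he, maxNodes_singleton]; rfl
  rw [hC.maxNodes_eq] at hb
  exact h.not_max hb.1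

theorem sSub (hC : SSub C B) : G.Mem C :=
  of_tle h (hC.isCWT h.isCWT) (hC.1.root_mem (isLeast_bot h.bot_mem))
    (h.ne_of_pSub (hC.pSub h.isTree)) (hC.tle h.isTree)

/-- A covering subtree of `C` would contain a full path of `B` from `⊥` to a maximal node, hence a
successor of `⊥` in `B`. So freshness makes an increase strict, and the inclusion clause of
`Generic.le` holds vacuously. -/
theorem not_tle (hC : IsTree C) (hf : ∀ x ∈ succs B ⊥, x ∉ C) : ¬ TLE B C := by
  rintro ⟨D, hD, hBD⟩
  obtain ⟨x, hx⟩ := hD.1.2.1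
  obtain ⟨z, hz, -⟩ := (hD.isTree hC).exists_max_ge hx
  obtain ⟨η, h1, -, h3⟩ := hBD z hz
  have hη : ⊥ < η := bot_lt_iff_ne_bot.2 fun he => h.not_max (he ▸ h1)
  obtain ⟨σ, hσ, hle⟩ := h.isTree.exists_succ_le h1.1 hη
  exact hf σ hσ (hD.1.1 (h3 σ hσ.1 hle))

end Mem

/-- The order of the system: `≼`, refined by reverse inclusion between equivalent trees. -/
def le (B C : Set M) : Prop := G.Mem B ∧ G.Mem C ∧ TLE B C ∧ (TLE C B → C ⊆ B)

variable {G}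

theorem le_of_fresh (hB : G.Mem B) (hC : G.Mem C) (h : TLE B C) (hf : ∀ x ∈ succs C ⊥, x ∉ B) :
    G.le B C := ⟨hB, hC, h, fun h' => absurd h' (hC.not_tle hB.isTree hf)⟩

theorem le_of_subset (hB : G.Mem B) (hC : G.Mem C) (h : TLE B C) (hs : C ⊆ B) : G.le B C :=
  ⟨hB, hC, h, fun _ => hs⟩

/-- Pass beyond the indices bounding the members of `S` and beyond a stage at which the root's
successors avoid the countable set `⋃ B ∈ S, B`. -/
theorem exists_le {S : Set (Set M)} (hS : ∀ B ∈ S, G.Mem B) (hc : S.Countable) :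
    ∃ j, ∀ B ∈ S, G.le B (G.B j) ∧ ∀ x ∈ succs (G.B j) ⊥, x ∉ B := by
  have : Nonempty J := ⟨(G.bounded ∅ Set.countable_empty).choose⟩
  choose! g hg using fun B hB => (hS B hB).exists_tle
  obtain ⟨i, hi⟩ := G.fresh (⋃ B ∈ S, B) (hc.biUnion fun B hB => (hS B hB).isCWT.countable)
  obtain ⟨j, hj⟩ := G.bounded (insert i (g '' S)) ((hc.image g).insert i)
  refine ⟨j, fun B hB => ?_⟩
  have hf : ∀ x ∈ succs (G.B j) ⊥, x ∉ B := fun x hx hxB =>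
    hi j (hj i (Set.mem_insert _ _)) x hx (Set.mem_iUnion₂.2 ⟨B, hB, hxB⟩)
  refine ⟨le_of_fresh (hS B hB) (G.mem_B j) ?_ hf, hf⟩
  have hlt := hj (g B) (Set.mem_insert_of_mem _ ⟨B, hB, rfl⟩)
  exact (hg B hB).trans (G.isCWT _).isTree (G.isCWT j).isTree (G.tle _ _ hlt)

variable (G) in
/-- The system of trees obtained from a generic sequence. -/
def system : System M where
  A η := {B | IsCWT B ∧ IsLeast B η ∧ (η = ⊥ → B ≠ {⊥} → ∃ j, TLE B (G.B j))}
  le := G.le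
  isCWT η B hB := hB.1
  isLeast η B hB := hB.2.1
  singleton_mem η := by
    refine ⟨(IsTree.singleton η).isCWT (IncompatOn.singleton η) ?_, isLeast_singleton,
      fun h1 h2 => absurd (h1 ▸ rfl) h2⟩
    intro ν hν hm
    exact absurd (by rwa [maxNodes_singleton]) hm
  cone_mem η B hB ν hν := by
    refine ⟨hB.1.cone hν, isLeast_cone hν, ?_⟩
    rintro rfl h
    have hη : η = ⊥ := le_bot_iff.1 (hB.2.1.2 hν)
    rw [Set.Ici_bot, Set.inter_univ] at h ⊢
    exact hB.2.2 hη h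
  le_mem B₁ B₂ h := ⟨⟨⟨h.1.isCWT, isLeast_bot h.1.bot_mem, fun _ _ => h.1.exists_tle⟩, h.1.ne⟩,
    ⟨⟨h.2.1.isCWT, isLeast_bot h.2.1.bot_mem, fun _ _ => h.2.1.exists_tle⟩, h.2.1.ne⟩⟩
  le_refl B hB := by
    have hm : G.Mem B := ⟨hB.1.1, hB.1.2.1.1, hB.2, hB.1.2.2 rfl hB.2⟩
    exact le_of_subset hm hm (TLE.refl hm.isTree) subset_rfl
  le_trans B₁ B₂ B₃ h h' := by
    refine ⟨h.1, h'.2.1, h.2.2.1.trans h.2.1.isTree h'.2.1.isTree h'.2.2.1, fun h3 => ?_⟩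
    exact (h'.2.2.2 (h3.trans h.1.isTree h.2.1.isTree h.2.2.1)).trans
      (h.2.2.2 (h'.2.2.1.trans h'.2.1.isTree h.1.isTree h3))
  le_antisymm B₁ B₂ h h' := (h'.2.2.2 h.2.2.1).antisymm (h.2.2.2 h'.2.2.1)
  directed B₁ hB₁ B₂ hB₂ := by
    have hm₁ : G.Mem B₁ := ⟨hB₁.1.1, hB₁.1.2.1.1, hB₁.2, hB₁.1.2.2 rfl hB₁.2⟩
    have hm₂ : G.Mem B₂ := ⟨hB₂.1.1, hB₂.1.2.1.1, hB₂.2, hB₂.1.2.2 rfl hB₂.2⟩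
    obtain ⟨j, hj⟩ := exists_le (S := {B₁, B₂}) (by
      rintro B (rfl | rfl)
      exacts [hm₁, hm₂]) (Set.toFinite _).countable
    exact ⟨_, (hj B₁ (by simp)).1, (hj B₂ (by simp)).1⟩
  starLE_of_le B₁ B₂ h := h.2.2.1.starLE h.1.isCWT h.2.1.isCWT
    ⟨⊥, isLeast_bot h.1.bot_mem, isLeast_bot h.2.1.bot_mem⟩

theorem mem_BB_iff : B ∈ G.system.BB ↔ G.Mem B :=
  ⟨fun hB => ⟨hB.1.1, hB.1.2.1.1, hB.2, hB.1.2.2 rfl hB.2⟩,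
    fun h => ⟨⟨h.isCWT, isLeast_bot h.bot_mem, fun _ _ => h.exists_tle⟩, h.ne⟩⟩

theorem aleph1Directed : G.system.Aleph1Directed := by
  intro S hS hc
  obtain ⟨j, hj⟩ := exists_le (fun B hB => mem_BB_iff.1 (hS hB)) hc
  exact ⟨_, mem_BB_iff.2 (G.mem_B j), fun C hC => (hj C hC).1⟩

theorem fat : G.system.Fat := by
  intro B hB B₁ hB₁
  rw [mem_BB_iff] at hB
  rw [mem_sb_iff hB.isCWT] at hB₁
  have h1 := hB.sSub hB₁
  exact ⟨B₁, (mem_sb_iff h1.isCWT).2 (SSub.refl h1.isTree), mem_BB_iff.2 h1,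
    le_of_subset hB h1 ((hB₁.pSub hB.isTree).tle hB.isTree) hB₁.1.1⟩

theorem full : G.system.Full := by
  rintro η hη B hB B₁ hB₁
  refine ⟨hB₁.1, ?_, fun h => absurd h hη⟩
  obtain ⟨r, hr, hr'⟩ := hB₁.2.2.1
  rwa [hB.2.1.unique hr]

theorem below_mem {η : M} (hB : B ∈ G.system.A η) (hY : IsFront B Y) :
    below B Y ∈ G.system.A η := by
  obtain ⟨h1, h2, h3⟩ := hB
  have hl := h1.isTree.lower_below hY
  refine ⟨h1.below hY, hl.isLeast h2, ?_⟩
  rintro rfl hne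
  have hB : B ≠ {⊥} := by
    rintro rfl
    exact hne (Set.eq_singleton_iff_unique_mem.2 ⟨hl.root_mem h2, fun x hx => hl.1 hx⟩)
  obtain ⟨j, hj⟩ := h3 rfl hB
  exact ⟨j, ((h1.isTree.cov_below hY).tle h1.isTree).trans h1.isTree (G.isCWT j).isTree hj⟩

/-- Every colouring of the maximal nodes of `B` is decided by a member of the generic sequence. -/
theorem Mem.exists_canon (hB : G.Mem B) {β : Type} (c : M → β) : ∃ j, Canon B c (G.B j) ∧
    ∀ x ∈ succs (G.B j) ⊥, x ∉ B := by
  obtain ⟨e, he⟩ := Set.countable_iff_exists_injOn.1 (hB.isCWT.countable.image c)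
  obtain ⟨i, hi⟩ := hB.exists_tle
  obtain ⟨k, hk⟩ := G.fresh B hB.isCWT.countable
  obtain ⟨j, hkj, h1, Y, h2, h3, h4⟩ := G.canon B i hB.isTree hi (e ∘ c) k
  refine ⟨j, ⟨h1, Y, h2, h3, fun w hw w' hw' => ?_⟩, hk j hkj⟩
  rw [← h4 w hw w' hw']
  exact (he.eq_iff ⟨w, hw.1.2, rfl⟩ ⟨w', hw'.1.2, rfl⟩).symm

section Inter

variable {j : J} (hB : G.Mem B) (hcov : Cov B (G.B j))
include hB hcov

theorem Mem.inter : G.Mem (G.B j ∩ B) := by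
  have hp := hcov.pSub (G.isCWT j).isTree hB.isTree
  exact ⟨hcov.isCWT hB.isCWT (G.isCWT j), hp.1.root_mem (isLeast_bot hB.bot_mem),
    hB.ne_of_pSub hp, j, (hcov.inter (G.isCWT j).isTree hB.isTree).tle (G.isCWT j).isTree⟩

theorem Mem.inter_psb : G.B j ∩ B ∈ psb B :=
  (hcov.pSub (G.isCWT j).isTree hB.isTree).mem_psb hB.isCWT (hB.inter hcov).isCWT

theorem Mem.le_inter : G.le B (G.B j ∩ B) :=
  le_of_subset hB (hB.inter hcov) ((hcov.pSub (G.isCWT j).isTree hB.isTree).tle hB.isTree)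
    Set.inter_subset_right

end Inter

/-- The generic tree that decides `c` serves as the upper tree and its trace on `B` as the lower
one; the front is the one provided by `Canon`. -/
theorem large : G.system.Large := by
  intro B hB β c
  rw [mem_BB_iff] at hB
  obtain ⟨j, ⟨hcov, Y, h1, -, h2⟩, hf⟩ := hB.exists_canon c
  exact ⟨G.B j ∩ B, hB.inter_psb hcov, G.B j, mem_BB_iff.2 (G.mem_B j),
    mem_BB_iff.2 (hB.inter hcov), hB.le_inter hcov, le_of_fresh (hB.inter hcov) (G.mem_B j)
      ((hcov.inter (G.isCWT j).isTree hB.isTree).tle (G.isCWT j).isTree)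
      fun x hx hxB => hf x hx hxB.2, Y, h1, h2⟩

theorem Mem.front_infinite (hB : G.Mem B) (hY : IsFront B Y) (h : ⊥ ∉ Y) : Y.Infinite :=
  hB.isTree.front_infinite hY hB.bot_mem hB.not_max fun _ hy _ _ _ _ =>
    bot_lt_iff_ne_bot.2 fun he => h (he ▸ hy)

/-- Each front node can be assigned the colour of a maximal node above it, and distinct front nodes
get distinct colours. So the front has at most two elements; as fronts avoiding `⊥` are infinite, it
contains `⊥`. -/
theorem big : G.system.Big := by
  intro B hB c
  rw [mem_BB_iff] at hB
  obtain ⟨j, ⟨hcov, Y, h1, h2, h3⟩, -⟩ := hB.exists_canon c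
  refine ⟨G.B j ∩ B, hB.inter_psb hcov, mem_BB_iff.2 (hB.inter hcov), hB.le_inter hcov, ?_⟩
  intro η hη ν hν
  have hbot : ⊥ ∈ Y := by
    by_contra hbot
    refine (G.mem_B j).front_infinite h1 hbot ?_
    choose! w hw hle using h2
    refine Set.Finite.of_injOn (f := fun y => c (w y)) (t := Set.univ) (fun _ _ => trivial) ?_
      Set.finite_univ
    intro y hy y' hy' he
    obtain ⟨ρ, hρ, h4, h5⟩ := (h3 _ (hw y hy) _ (hw y' hy')).1 he
    have key : ∀ y ∈ Y, ρ ≤ w y → y = ρ := fun y hy hρy => by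
      rcases (G.isCWT j).isTree.le_or_le (h1.1 hy) (h1.1 hρ) (hw y hy).1.1 (hle y hy) hρy with h | h
      · exact h1.2.2.eq hy hρ h
      · exact (h1.2.2.eq hρ hy h).symm
    rw [key y hy h4, key y' hy' h5]
  exact (h3 η hη ν hν).2 ⟨⊥, hbot, bot_le, bot_le⟩

/-- In a tree `C` covering `B` whose first level is fresh, every branch through `ϱ` reaches a
`B`-successor of `⊥` strictly above `ϱ`. The infinitely many `C`-successors of `ϱ` lead to distinct
such nodes. -/
theorem exists_lumped (hB : G.Mem B) : ∃ C, G.Mem C ∧ G.le B C ∧ B ∩ succs C ⊥ = ∅ ∧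
    ∀ ϱ ∈ succs C ⊥, {ρ | ρ ∈ succs B ⊥ ∧ ϱ ≤ ρ}.Infinite := by
  obtain ⟨j, hj⟩ := exists_le (G := G) (S := {B}) (by rintro _ rfl; exact hB)
    (Set.countable_singleton B)
  obtain ⟨hle, hf⟩ := hj B rfl
  obtain ⟨C, hC, hcov⟩ := hle.2.2.1
  have hCm := (G.mem_B j).sSub hC
  have hfC : ∀ x ∈ succs C ⊥, x ∉ B := fun x hx => hf x (by
    rw [hC.1.succs_eq] at hx
    exact hx.1)
  refine ⟨C, hCm, le_of_fresh hB hCm (hcov.tle hCm.isTree) hfC,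
    Set.eq_empty_of_forall_notMem fun x hx => hfC x hx.2 hx.1, fun ϱ hϱ => ?_⟩
  have habove : ∀ z ∈ maxNodes C, ϱ ≤ z → ∃ σ ∈ succs B ⊥, σ ∈ C ∧ ϱ < σ ∧ σ ≤ z := by
    intro z hz hϱz
    obtain ⟨σ, h1, h2, h3⟩ := hcov.exists_succ hCm.isTree hB.isTree hCm.bot_mem hB.bot_mem
      hB.not_max hz bot_le
    refine ⟨σ, h1, h2, lt_of_le_of_ne ?_ fun he => hfC ϱ hϱ (he ▸ h1.1), h3⟩
    exact hCm.isTree.succ_le_of_lt hϱ h2 hz.1 h1.2.1 hϱz h3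
  have hm : ϱ ∉ maxNodes C := fun hm => by
    obtain ⟨σ, -, -, h3, h4⟩ := habove ϱ hm le_rfl
    exact h3.not_ge h4
  refine (hCm.isTree.infinite_of_forall_succ (R := {ρ | (ρ ∈ succs B ⊥ ∧ ϱ ≤ ρ) ∧ ρ ∈ C})
    subset_rfl (hCm.isTree.succs_infinite_of_not_max hϱ.1 hm) (fun x hx => hx.2) ?_).mono
      fun x hx => hx.1
  intro τ hτ
  obtain ⟨z, hz, hτz⟩ := hCm.isTree.exists_max_ge hτ.1
  obtain ⟨σ, h1, h2, h3, h4⟩ := habove z hz (hτ.2.1.le.trans hτz)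
  exact ⟨σ, ⟨⟨h1, h3.le⟩, h2⟩, hCm.isTree.succ_le_of_lt hτ h2 hz.1 h3 hτz h4⟩

/-! ### The families `D Y`: ultrafilters and Q-points. -/

section Ultrafilter

theorem mem_D_iff {Z : Set M} : Z ∈ G.system.D Y ↔ Z ⊆ Y ∧ ∃ B, G.Mem B ∧ IsAlmostFront B Y ∧
    ∃ C, SSub C B ∧ Y ∩ C ⊆ Z := by
  constructor
  · rintro ⟨h1, B, hB, C, hC, hY, hZ⟩
    rw [mem_BB_iff] at hB
    rw [mem_sb_iff hB.isCWT] at hC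
    exact ⟨h1, B, hB, hY, C, hC, by rwa [Set.inter_comm]⟩
  · rintro ⟨h1, B, hB, hY, C, hC, hZ⟩
    exact ⟨h1, B, mem_BB_iff.2 hB, C, (mem_sb_iff hB.isCWT).2 hC, hY, by rwa [Set.inter_comm]⟩

theorem D_mono {Z Z' : Set M} (h : Z ∈ G.system.D Y) (hZ : Z ⊆ Z') (hY : Z' ⊆ Y) :
    Z' ∈ G.system.D Y := ⟨hY, h.2.imp fun _ h => ⟨h.1, h.2.imp fun _ h => ⟨h.1, h.2.1, h.2.2.trans hZ⟩⟩⟩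

/-- Both witnesses move to exhaustive subtrees of one common upper bound `G.B j`, where they can be
intersected. -/
theorem D_inter {Z Z' : Set M} (h : Z ∈ G.system.D Y) (h' : Z' ∈ G.system.D Y) :
    Z ∩ Z' ∈ G.system.D Y := by
  rw [mem_D_iff] at h h' ⊢
  obtain ⟨h1, B, hB, hY, C, hC, hZ⟩ := h
  obtain ⟨h1', B', hB', hY', C', hC', hZ'⟩ := h'
  obtain ⟨j, hj⟩ := exists_le (G := G) (S := {B, B'}) (by
      rintro B (rfl | rfl)
      exacts [hB, hB']) (Set.toFinite _).countable
  obtain ⟨E, hE, hYE, hEC⟩ :=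
    (hj B (by simp)).1.2.2.1.almostFront hB.isCWT (G.isCWT j) hY hC
  obtain ⟨E', hE', hYE', hEC'⟩ :=
    (hj B' (by simp)).1.2.2.1.almostFront hB'.isCWT (G.isCWT j) hY' hC'
  refine ⟨fun x hx => h1 hx.1, G.B j, G.mem_B j, ⟨hY.1, E, (mem_sb_iff (G.isCWT j)).2 hE, hYE⟩,
    E ∩ E', hE.inter (G.isCWT j).isTree hE', fun x hx => ⟨hZ ⟨hx.1, hEC ⟨hx.1, hx.2.1⟩⟩,
      hZ' ⟨hx.1, hEC' ⟨hx.1, hx.2.2⟩⟩⟩⟩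

theorem exists_front_subset {Z : Set M} (h : Z ∈ G.system.D Y) :
    ∃ E, G.Mem E ∧ IsFront E (Y ∩ E) ∧ Y ∩ E ⊆ Z := by
  rw [mem_D_iff] at h
  obtain ⟨-, B, hB, hY, C, hC, hZ⟩ := h
  obtain ⟨E, hE, h1, h2⟩ := (TLE.refl hB.isTree).almostFront hB.isCWT hB.isCWT hY hC
  exact ⟨E, hB.sSub hE, h1, fun x hx => hZ ⟨hx.1, h2 hx⟩⟩

theorem D_nonempty {Z : Set M} (h : Z ∈ G.system.D Y) : Z.Nonempty := by
  obtain ⟨E, hE, h1, h2⟩ := exists_front_subset h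
  obtain ⟨z, hz, -⟩ := hE.isTree.exists_max_ge hE.bot_mem
  obtain ⟨y, hy, -⟩ := (hE.isTree.isFront_iff.1 h1).2.2 z hz
  exact ⟨y, h2 hy⟩

variable (hB : G.Mem B) (hY : IsFront B Y)
include hB hY

theorem front_mem_D : Y ∈ G.system.D Y :=
  mem_D_iff.2 ⟨subset_rfl, B, hB, hY.isAlmostFront hB.isCWT, B, SSub.refl hB.isTree,
    Set.inter_subset_left⟩

theorem mem_below (hne : Y ≠ {⊥}) : G.Mem (below B Y) := by
  have hl := hB.isTree.lower_below hY
  refine Mem.of_tle hB (hB.isCWT.below hY) (hl.root_mem (isLeast_bot hB.bot_mem)) (fun he => ?_)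
    ((hB.isTree.cov_below hY).tle hB.isTree)
  have := hB.isTree.max_below hY
  rw [he, maxNodes_singleton] at this
  exact hne this.symm

/-- `Y` is the set of maximal nodes of `below B Y`. Thus a positive subtree in the system, although
it may omit infinitely many successors, has its maximal nodes as a member of `D Y`: it serves as its
own witness. -/
theorem maxNodes_mem_D (hC : G.Mem C) (hp : PSub C (below B Y)) :
    maxNodes C ∈ G.system.D Y ∧ maxNodes C ⊆ Y := by
  have hm : maxNodes C = Y ∩ C := by rw [hp.maxNodes_eq, hB.isTree.max_below hY]
  have hsub : maxNodes C ⊆ Y := by rw [hm]; exact Set.inter_subset_left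
  refine ⟨mem_D_iff.2 ⟨hsub, C, hC, ⟨hY.2.2, C, (mem_sb_iff hC.isCWT).2 (SSub.refl hC.isTree), ?_⟩,
    C, SSub.refl hC.isTree, hm.ge⟩, hsub⟩
  refine hC.isTree.isFront_iff.2 ⟨Set.inter_subset_right, hY.2.2.subset Set.inter_subset_left,
    fun z hz => ⟨z, hm ▸ hz, le_rfl⟩⟩

theorem D_decides (Z : Set M) : Y ∩ Z ∈ G.system.D Y ∨ Y \ Z ∈ G.system.D Y := by
  classical
  have hYD := front_mem_D hB hY
  by_cases hne : Y = {⊥}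
  · by_cases hZ : ⊥ ∈ Z
    · left
      rwa [Set.inter_eq_left.2 (by rw [hne]; exact Set.singleton_subset_iff.2 hZ)]
    · right
      refine D_mono hYD (fun x hx => ⟨hx, fun hxZ => hZ ?_⟩) Set.sdiff_subset
      rw [hne] at hx
      exact Set.mem_singleton_iff.1 hx ▸ hxZ
  · have hT := mem_below hB hY hne
    obtain ⟨C, hC, hCB, -, hc⟩ := big (G := G) _ (mem_BB_iff.2 hT) (fun x => decide (x ∈ Z))
    obtain ⟨h1, h2⟩ := maxNodes_mem_D hB hY (mem_BB_iff.1 hCB) (pSub_of_mem_psb hT.isCWT hC)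
    by_cases hZ : ∃ x ∈ maxNodes C, x ∈ Z
    · obtain ⟨x, hx, hxZ⟩ := hZ
      left
      refine D_mono h1 (fun y hy => ⟨h2 hy, ?_⟩) Set.inter_subset_left
      have := hc x hx y hy
      simpa [hxZ] using this
    · right
      push Not at hZ
      exact D_mono h1 (fun y hy => ⟨h2 hy, hZ y hy⟩) Set.sdiff_subset

theorem isUltrafilterOn : IsUltrafilterOn Y (G.system.D Y) := by
  let F : Filter Y :=
    { sets := {Z | Subtype.val '' Z ∈ G.system.D Y}
      univ_sets := by
        simpa using front_mem_D hB hY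
      sets_of_superset := fun h hs => D_mono h (Set.image_mono hs) (Subtype.coe_image_subset _ _)
      inter_sets := fun h h' => by
        simp only [Set.mem_ofPred_eq, Set.image_inter Subtype.val_injective]
        exact D_inter h h' }
  have hF : ∀ Z : Set Y, Z ∈ F ↔ Subtype.val '' Z ∈ G.system.D Y := fun Z => Iff.rfl
  refine ⟨fun Z hZ => hZ.1, Ultrafilter.ofComplNotMemIff F fun Z => ?_, fun Z => hF Z⟩
  constructor
  · intro h
    rcases D_decides hB hY (Subtype.val '' Z) with h' | h'
    · rwa [hF, ← Set.inter_eq_right.2 (Subtype.coe_image_subset Y Z)]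
    · refine absurd ?_ h
      rw [hF]
      refine D_mono h' ?_ (Subtype.coe_image_subset _ _)
      rintro x ⟨hx, hxZ⟩
      exact ⟨⟨x, hx⟩, fun hh => hxZ ⟨_, hh, rfl⟩, rfl⟩
  · intro h h'
    rw [hF] at h h'
    obtain ⟨x, ⟨a, ha, rfl⟩, b, hb, hab⟩ := D_nonempty (D_inter h h')
    exact hb (Subtype.ext hab ▸ ha)

theorem isNonprincipalOn_iff : IsNonprincipalOn Y (G.system.D Y) ↔ Y ≠ {⊥} := by
  constructor
  · rintro ⟨-, h⟩ rfl
    exact h ⊥ rfl (front_mem_D hB hY)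
  · intro hne
    refine ⟨isUltrafilterOn hB hY, fun y _ hD => ?_⟩
    obtain ⟨E, hE, h1, h2⟩ := exists_front_subset hD
    exact hE.front_infinite h1 (fun h => bot_notMem_front hY hne h.1)
      ((Set.finite_singleton y).subset h2)

/-- Canonize `f` on `below B Y`. If two different maximal nodes received the same value, the front
node below both would lie strictly below them, hence below infinitely many maximal nodes of that
value, contradicting that `f` is finite-to-one. -/
theorem isQPointOn : IsQPointOn Y (G.system.D Y) := by
  refine ⟨hB.isCWT.countable.mono hY.1, isUltrafilterOn hB hY, fun β f hf => ?_⟩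
  by_cases hne : Y = {⊥}
  · refine ⟨Y, front_mem_D hB hY, ?_⟩
    rw [hne]
    exact Set.injOn_singleton f ⊥
  have hT := mem_below hB hY hne
  obtain ⟨j, ⟨hcov, Y', h1, -, h3⟩, -⟩ := hT.exists_canon f
  have hBj := (G.isCWT j).isTree
  have hp := hcov.pSub hBj hT.isTree
  obtain ⟨h4, h5⟩ := maxNodes_mem_D hB hY (hT.inter hcov) hp
  refine ⟨_, h4, fun η hη ν hν he => ?_⟩
  by_contra hην
  obtain ⟨y, hy, hyη, hyν⟩ := (h3 η hη ν hν).1 he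
  have hyj := h1.1 hy
  have hincomp : ∀ a ∈ maxNodes (G.B j ∩ below B Y), ∀ b ∈ maxNodes (G.B j ∩ below B Y),
      a ≤ b → a = b := fun a ha b hb => eq_of_max_le ha hb.1
  have hlt : y < η ∧ y < ν := by
    constructor
    · refine lt_of_le_of_ne hyη fun h => hην (hincomp η hη ν hν (h ▸ hyν))
    · refine lt_of_le_of_ne hyν fun h => hην (hincomp ν hν η hη (h ▸ hyη)).symm
  have hinf : {w | w ∈ maxNodes (G.B j ∩ below B Y) ∧ y ≤ w}.Infinite := by
    refine hBj.infinite_of_forall_succ subset_rfl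
      (hBj.succs_infinite_of_not_max hyj fun hm => hm.2 η hη.1.1 hlt.1) (fun w hw => hw.1.1.1) ?_
    intro τ hτ
    obtain ⟨z, hz, hτz⟩ := hBj.exists_max_ge hτ.1
    obtain ⟨w, hw, hwz, -⟩ := hcov.inter hBj hT.isTree z hz
    have hyw : y < w := by
      have hyz := hτ.2.1.le.trans hτz
      rcases hBj.le_or_le hyj hw.1.1 hz.1 hyz hwz with h | h
      · refine lt_of_le_of_ne h fun hh => ?_
        exact hlt.1.ne (hincomp y (hh ▸ hw) η hη hlt.1.le)
      · have := hincomp w hw η hη (h.trans hlt.1.le)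
        exact absurd (this ▸ h) hlt.1.not_ge
    exact ⟨w, ⟨hw, hyw.le⟩, hBj.succ_le_of_lt hτ hw.1.1 hz.1 hyw hτz hwz⟩
  refine hinf ((hf (f η)).subset ?_)
  rintro w ⟨hw, hyw⟩
  exact ⟨h5 hw, (h3 w hw η hη).2 ⟨y, hy, hyw, hyη⟩⟩

end Ultrafilter

end System

end Generic

end TreeSys

/-! ### The main theorem. -/

theorem mainTheorem1 (CH : Cardinal.continuum.{0} = Cardinal.aleph.{0} 1) :
    ∃ (M : Type) (_ : PartialOrder M) (_ : OrderBot M) (x : TreeSys.System M),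
      -- (a)
      (∀ η : M, x.A η ≠ {{η}}) ∧ x.Aleph1Directed ∧
      -- (b), (e)
      (∀ B ∈ x.BB, ∀ Y : Set M, TreeSys.IsFront B Y →
        TreeSys.IsUltrafilterOn Y (x.D Y) ∧
        (TreeSys.IsNonprincipalOn Y (x.D Y) ↔ Y ≠ {⊥}) ∧
        TreeSys.IsQPointOn Y (x.D Y)) ∧
      -- (c)
      (∀ B₁ ∈ x.BB, ∃ B₂ ∈ x.BB, x.le B₁ B₂ ∧ B₁ ∩ TreeSys.succs B₂ ⊥ = ∅ ∧
        ∀ ϱ ∈ TreeSys.succs B₂ ⊥, {ρ | ρ ∈ TreeSys.succs B₁ ⊥ ∧ ϱ ≤ ρ}.Infinite) ∧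
      -- (d)
      (∀ η : M, ∀ B ∈ x.A η, ∀ Y : Set M, TreeSys.IsFront B Y → TreeSys.below B Y ∈ x.A η) ∧
      -- (f)
      x.Fat ∧ x.Big ∧ x.Large ∧ x.Full := by
  obtain ⟨M, J, hM, hbot, hJ, ⟨G⟩⟩ := TreeSys.exists_generic CH
  refine ⟨M, hM, hbot, G.system, fun η he => ?_, TreeSys.Generic.aleph1Directed,
    fun B hB Y hY => ?_, fun B hB => ?_, fun η B hB Y hY => TreeSys.Generic.below_mem hB hY,
    TreeSys.Generic.fat, TreeSys.Generic.big, TreeSys.Generic.large, TreeSys.Generic.full⟩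
  · rcases eq_or_ne η ⊥ with rfl | hη
    · obtain ⟨j, -⟩ := G.bounded ∅ Set.countable_empty
      have hj := TreeSys.Generic.mem_BB_iff.2 (G.mem_B j)
      have h := hj.1
      rw [he] at h
      exact hj.2 h
    · obtain ⟨C, h1, h2, h3⟩ := G.exists_tree η hη
      have h : C ∈ G.system.A η := ⟨h1, h2, fun h => absurd h hη⟩
      rw [he] at h
      exact h3 h
  · rw [TreeSys.Generic.mem_BB_iff] at hB
    exact ⟨TreeSys.Generic.isUltrafilterOn hB hY, TreeSys.Generic.isNonprincipalOn_iff hB hY,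
      TreeSys.Generic.isQPointOn hB hY⟩
  · obtain ⟨C, h1, h2⟩ := TreeSys.Generic.exists_lumped (TreeSys.Generic.mem_BB_iff.1 hB)
    exact ⟨C, TreeSys.Generic.mem_BB_iff.2 h1, h2⟩
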